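/- **Main Exact Existence and Uniqueness Theorem.** *Conventions.* Let $\theta\in\mathbb R$ and $A_\theta=(\theta-\frac\pi2,\theta+\frac\pi2)$. A *sectorial domain with opening $A_\theta$* is a simply connected domain $S\subset\mathbb C\setminus\{0\}$ whose closure in the real-oriented blowup of $\mathbb C$ at $0$ meets the circle of directions exactly in $\bar A_\theta$, and which contains a Borel disc $\{\hbar : \operatorname{Re}(e^{i\theta}/\hbar)>1/d\}$ for some $d>0$. For functions $f(x,\hbar)$ on $W\times S$, a formal series $\hat f=\sum_k f_k(x)\hbar^k$, and a scale $\sigma$ on $W$, we write "$f\simeq\hat f$ as $\hbar\to0$ along $\bar A_\theta$, wrt $\sigma$, uniformly on $W$" (*uniform Gevrey asymptotics*; no scale mentioned means $\sigma=1$) if there are a sectorial domain $S'\subset S$ with opening $A_\theta$ and constants $C,M>0$ such that for all $n\ge0$, $x\in W$, $\hbar\in S'$, $$\Big|f(x,\hbar)-\sum_{k=0}^{n-1}f_k(x)\hbar^k\Big|\le |\sigma(x)|\,C M^n n!\,|\hbar|^n .$$ *Setting.* Let $X\subset\mathbb C$ be a domain, $S$ a sectorial domain with opening $A_\theta$, and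 consider the Riccati equation $$\hbar\,\partial_x f=af^2+bf+c, \qquad (\ast)$$ where $a,b,c$ are holomorphic on $X\times S$ and admit locally uniform (Poincaré) asymptotic expansions $\hat a=\sum a_k\hbar^k$, $\hat b=\sum b_k\hbar^k$, $\hat c=\sum c_k\hbar^k$ with $a_k,b_k,c_k$ holomorphic on $X$, as $\hbar\to0$ along $A_\theta$. Assume that $D_0=b_0^2-4a_0c_0$ is not identically zero. Let $x_0\in X$ with $D_0(x_0)\ne0$ and let $\alpha\in\{+,-\}$, $\varepsilon=\pm1$ accordingly. *Hypotheses.* 1. $W\subset X$ is a WKB $(\theta,\alpha)$-halfstrip domain containing $x_0$: there is a holomorphic square root $\sqrt{D_0}$ on $W$, and with $\Phi(x)=\int_{x_0}^x\sqrt{D_0(t)}\,dt$ (possibly multivalued), $W=\Phi^{-1}(H)$ for a halfstrip $H=\{z : \operatorname{dist}(z,z_1+\varepsilon e^{i\theta}\mathbb R_{\ge0})<r\}$, $r>0$; that is, there is a holomorphic map $\psi$ on $H\ni 0$ with $\psi(H)=W$, $\psi(0)=x_0$ and $\sqrt{D_0(\psi(z))}\,\psi'(z)=1$. If $\alpha=-$,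 then $a_0$ is nonvanishing on $W$. If $\alpha=+$, the branch satisfies $\sqrt{D_0}=b_0$ at every zero of $a_0$ in $W$ (no condition if there is none; $\sqrt{D_0}=b_0$ if $a_0\equiv0$). 2. $a\simeq\hat a$, $b\simeq\hat b$, $c\simeq\hat c$ as $\hbar\to0$ along $\bar A_\theta$, wrt $\sqrt{D_0}$, uniformly on $W$. *Conclusion.* Let $f_0^\alpha=\frac{-b_0+\varepsilon\sqrt{D_0}}{2a_0}$ where $a_0\neq0$ and $f_0^\alpha=-c_0/b_0$ at the zeros of $a_0$. There is a unique formal solution $\hat f_\alpha=\sum_k f_k^\alpha\hbar^k$ of $\hbar\,\partial_x\hat f=\hat a\hat f^2+\hat b\hat f+\hat c$ with coefficients holomorphic on $W$ and with leading term $f_0^\alpha$. For every domain $U_0$ whose closure is a compact subset of $W$, there is a sectorial domain $S_0\subset S$ with the same opening $A_\theta$ such that there is a unique holomorphic solution $f$ of $(\ast)$ on $U_0\times S_0$ with $$f\simeq\hat f_\alpha\quad\text{as }\hbar\to0\text{ along }\bar A_\theta,\text{ uniformly on }U_0 .$$ -/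

import Mathlib

open Set Filter Topology

namespace Riccati

/-- The Borel disc of diameter `d` bisected by the direction `θ`. -/
def borelDisc (θ d : ℝ) : Set ℂ :=
  {h | h ≠ 0 ∧ 1 / d < (Complex.exp (θ * Complex.I) / h).re}

/-- The directions (as unit complex numbers) along which `S` accumulates at the origin, i.e. the
intersection of the closure of `S` in the real-oriented blowup of `ℂ` at `0` with the boundary
circle. -/
def directionsAtZero (S : Set ℂ) : Set ℂ :=
  {u | MapClusterPt u (𝓝[S \ {0}] 0) fun h : ℂ => h / (‖h‖ : ℂ)}

/-- `S` is a sectorial domain at the origin whose opening is the halfplane arc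
`(θ - π/2, θ + π/2)`: a simply connected domain in `ℂ \ {0}` whose directions at the origin are
exactly those of the closed arc `[θ - π/2, θ + π/2]`, and which contains a Borel disc bisected
by `θ`. -/
structure IsSectorialDomain (θ : ℝ) (S : Set ℂ) : Prop where
  isOpen : IsOpen S
  simplyConnected : IsSimplyConnected S
  zero_notMem : (0 : ℂ) ∉ S
  directions : directionsAtZero S =
    {u : ℂ | ‖u‖ = 1 ∧ 0 ≤ (u * Complex.exp (-(θ * Complex.I))).re}
  borel : ∃ d : ℝ, 0 < d ∧ borelDisc θ d ⊆ S

/-- The remainder of order `n` of `f` with respect to the formal power series `∑ fₖ(x) ħᵏ`. -/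
noncomputable def remainder (f : ℂ → ℂ → ℂ) (fhat : ℕ → ℂ → ℂ) (n : ℕ) (x h : ℂ) : ℂ :=
  f x h - ∑ k ∈ Finset.range n, fhat k x * h ^ k

/-- `f ∼ ∑ fₖ ħᵏ` as `ħ → 0` along the open arc `(θ - π/2, θ + π/2)`, locally uniformly for all
`x ∈ X` (Poincaré asymptotics; every compact subarc lies in some `[θ - β, θ + β]`, `β < π/2`). -/
def LocUnifAsymptotic (θ : ℝ) (X S : Set ℂ) (f : ℂ → ℂ → ℂ) (fhat : ℕ → ℂ → ℂ) : Prop :=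
  ∀ x₀ ∈ X, ∃ U : Set ℂ, IsOpen U ∧ x₀ ∈ U ∧ U ⊆ X ∧
    ∀ (n : ℕ) (β : ℝ), 0 < β → β < Real.pi / 2 →
      ∃ ρ C : ℝ, 0 < ρ ∧ 0 < C ∧ ∀ x ∈ U, ∀ h ∈ S, ‖h‖ < ρ →
        |Complex.arg (h * Complex.exp (-(θ * Complex.I)))| ≤ β →
          ‖remainder f fhat n x h‖ ≤ C * ‖h‖ ^ n

/-- `f ≃ ∑ fₖ ħᵏ` as `ħ → 0` along the closed arc `[θ - π/2, θ + π/2]`, with respect to the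
asymptotic scale `σ`, uniformly for all `x ∈ W` (Gevrey asymptotics). -/
def UnifGevreyAsymptotic (θ : ℝ) (W S : Set ℂ) (σ : ℂ → ℂ)
    (f : ℂ → ℂ → ℂ) (fhat : ℕ → ℂ → ℂ) : Prop :=
  ∃ S' ⊆ S, IsSectorialDomain θ S' ∧ ∃ C M : ℝ, 0 < C ∧ 0 < M ∧
    ∀ (n : ℕ), ∀ x ∈ W, ∀ h ∈ S',
      ‖remainder f fhat n x h‖ ≤ ‖σ x‖ * (C * M ^ n * (n.factorial : ℝ) * ‖h‖ ^ n)

/-- The leading-order discriminant `D₀ = b₀² - 4 a₀ c₀`. -/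
def disc₀ (ahat bhat chat : ℕ → ℂ → ℂ) (x : ℂ) : ℂ :=
  bhat 0 x ^ 2 - 4 * ahat 0 x * chat 0 x

/-- The halfstrip `{z | dist (z, z₁ + e^{iθ} ℝ_±) < r}`, the sign being that of `ε = ±1`. -/
def halfstrip (θ ε : ℝ) (z₁ : ℂ) (r : ℝ) : Set ℂ :=
  Metric.thickening r
    {z | ∃ t : ℝ, 0 ≤ t ∧ z = z₁ + (ε * t : ℝ) * Complex.exp (θ * Complex.I)}

/-- `W ⊆ X` is a WKB `(θ, ±)`-halfstrip domain containing `x₀`, with respect to a univalued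
holomorphic square root `s` of `D` on `W`. The Liouville transformation `Φ(x) = ∫_{x₀}^x s` may be
multivalued on `W`, but its inverse is a univalued map `ψ` from a halfstrip onto `W`; it is pinned
down by `Φ(x₀) = 0` and `dΦ = s dx`, i.e. by `ψ 0 = x₀` and `s (ψ z) * ψ' z = 1`. -/
structure IsWKBHalfstrip (X : Set ℂ) (D s : ℂ → ℂ) (θ ε : ℝ) (x₀ : ℂ) (W : Set ℂ) : Prop where
  subset : W ⊆ X
  differentiableOn : DifferentiableOn ℂ s W
  sq_eq : ∀ x ∈ W, s x ^ 2 = D x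
  exists_param : ∃ (z₁ : ℂ) (r : ℝ) (ψ : ℂ → ℂ), 0 < r ∧
    0 ∈ halfstrip θ ε z₁ r ∧ ψ 0 = x₀ ∧
    DifferentiableOn ℂ ψ (halfstrip θ ε z₁ r) ∧
    (∀ z ∈ halfstrip θ ε z₁ r, s (ψ z) * deriv ψ z = 1) ∧
    ψ '' halfstrip θ ε z₁ r = W

open scoped Classical in
/-- The leading-order solution `f₀^±`: it is `(-b₀ ± s) / (2 a₀)` where `a₀ ≠ 0`, and `-c₀ / b₀` at
the zeros of `a₀`. -/
noncomputable def leadingSolution (ahat bhat chat : ℕ → ℂ → ℂ) (s : ℂ → ℂ) (ε : ℝ) (x : ℂ) : ℂ :=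
  if ahat 0 x = 0 then -chat 0 x / bhat 0 x else (-bhat 0 x + ε * s x) / (2 * ahat 0 x)

/-- `∑ fₖ ħᵏ` has holomorphic coefficients on `W` and satisfies the formal Riccati equation
`ħ ∂ₓ f = a f² + b f + c` on `W`. -/
structure IsFormalSolution (W : Set ℂ) (ahat bhat chat fhat : ℕ → ℂ → ℂ) : Prop where
  differentiableOn : ∀ k, DifferentiableOn ℂ (fhat k) W
  equation : ∀ x ∈ W,
    (PowerSeries.X * PowerSeries.mk fun k => deriv (fhat k) x : PowerSeries ℂ) =
      (PowerSeries.mk fun k => ahat k x) * (PowerSeries.mk fun k => fhat k x) ^ 2 +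
      (PowerSeries.mk fun k => bhat k x) * (PowerSeries.mk fun k => fhat k x) +
      PowerSeries.mk fun k => chat k x

/-- `f` is a holomorphic solution of the Riccati equation `ħ ∂ₓ f = a f² + b f + c` on `U × S`. -/
structure IsHolomorphicSolution (a b c : ℂ → ℂ → ℂ) (U S : Set ℂ) (f : ℂ → ℂ → ℂ) : Prop where
  differentiableOn : DifferentiableOn ℂ (Function.uncurry f) (U ×ˢ S)
  equation : ∀ x ∈ U, ∀ h ∈ S,
    h * deriv (fun y => f y h) x = a x h * f x h ^ 2 + b x h * f x h + c x h

end Riccati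

/-!
In the Liouville coordinate `z`, `x = ψ z`, the Riccati equation becomes
`h ∂_z f = A f² + B f + C` on a halfstrip, with `A = a / √D₀` etc., uniform Gevrey expansions, and
leading-order discriminant `B₀² - 4 A₀ C₀ = 1`. The leading-order solution `f₀ ∘ ψ` need not be
bounded on the halfstrip (it may have poles at the boundary, or grow at infinity), so the equation
is first projectivised: `f = y₁ / y₂` where `h ∂_z y = M y` up to a scalar term and
`M = [[B/2, C], [-A, -B/2]]`. Since the discriminant is `1`, `P = 1/2 - ε M₀` is a *bounded*
projection, and one looks for an exact invariant graph `Y = P + w` over its range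
(`exists_invariant_graph`). The unknown `w` satisfies a quadratic equation
`h ∂_z w = ε w + h Q(w)` with bounded coefficients and `w = O(h)`.

Such equations are solved by `exists_gevrey_solution`. With `κ = ε e^{iθ}` and `p = e^{iθ} / h`,
bounded solutions are fixed points of `w = -κ ∫₀^∞ e^{-pt} Q(w)(z + κ t) dt`; a halfstrip is stable
under translation by `κ t`, and on a small Borel disc `Re p` is large, so Picard iteration converges
(`exists_bounded_solution`). The formal solution satisfies factorial bounds by Nagumo's argument
(`norm_formal_quad_le`). The remainders of the exact solution solve linear equations along the same
rays, and a bounded solution of `u' = p u + r` obeys `‖u 0‖ ≤ sup ‖r‖ / Re p`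
(`norm_le_of_ray_ode`), whence the Gevrey estimates by induction on the order
(`norm_rem_solution_le`). The same ray estimate shows that the fixed point really is a graph over
the range of `P`. Applying `Y` to the eigenvector `(f₀ ∘ ψ, 1)` gives `y`, and dividing
(`IsGevrey.exists_div`) gives an exact solution wherever `f₀ ∘ ψ` is bounded
(`exists_gevrey_riccati`).

The formal solution of the Riccati equation exists and is unique because the linearisation
`2 a₀ f₀ + b₀ = ± √D₀` does not vanish (`exists_isFormalSolution`, `IsFormalSolution.unique`); as
the coefficients of an exact solution form a formal solution (`IsGevrey.isFormalSolution`), those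
found on the halfstrip are the `fₖ ∘ ψ`. By Nevanlinna's theorem (`eq_zero_of_gevrey_flat`), proved
with the Phragmén-Lindelöf principle, a function on a Borel disc is determined by its Gevrey
expansion. This is used twice: the exact solution takes equal values at points with the same image
under `ψ`, which need not be injective, and so descends to the original coordinate
(`IsGevrey.exists_descent`); and the exact solution is unique. The sectorial domain in the conclusion
is a small Borel disc.
-/

namespace Riccati

/-! ### Bounded solutions on rays, and holomorphy of uniform limits -/

section Tools

variable {E : Type*} [NormedAddCommGroup E] [NormedSpace ℂ E]

/-- A priori bound along a ray: a bounded solution of `u' = p u + r` on `[0, ∞)` with `0 < Re p` is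
controlled by the forcing term alone, because the homogeneous solution `exp (p t)` is unbounded. -/
theorem norm_le_of_ray_ode {u r : ℝ → E} {p : ℂ} {R B : ℝ} (hp : 0 < p.re)
    (hu : ∀ t, 0 ≤ t → HasDerivAt u (p • u t + r t) t)
    (hB : ∀ t, 0 ≤ t → ‖u t‖ ≤ B) (hr : ∀ t, 0 ≤ t → ‖r t‖ ≤ R) : ‖u 0‖ ≤ R / p.re := by
  have hR : 0 ≤ R := (norm_nonneg _).trans (hr 0 le_rfl)
  have hnexp : ∀ t : ℝ, ‖Complex.exp (-(p * t))‖ = Real.exp (-(p.re * t)) := by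
    intro t
    rw [Complex.norm_exp]
    simp
  set m : ℝ → E := fun t : ℝ => Complex.exp (-(p * t)) • u t with hm
  have hexp : ∀ t : ℝ, HasDerivAt (fun t : ℝ => Complex.exp (-(p * t)))
      (Complex.exp (-(p * t)) * -p) t := by
    intro t
    have h1 : HasDerivAt (fun t : ℝ => -(p * (t : ℂ))) (-p) t := by
      simpa using (((hasDerivAt_id t).ofReal_comp).const_mul p).fun_neg
    exact h1.cexp
  have hmd : ∀ t : ℝ, 0 ≤ t → HasDerivAt m (Complex.exp (-(p * t)) • r t) t := by
    intro t ht
    refine ((hexp t).fun_smul (hu t ht)).congr_deriv ?_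
    simp only [smul_add, smul_smul, mul_neg, neg_smul]
    abel
  have key : ∀ T, 0 ≤ T → ‖u 0‖ ≤ Real.exp (-(p.re * T)) * B + R / p.re := by
    intro T hT
    have h3 := image_norm_le_of_norm_deriv_right_le_deriv_boundary (a := 0) (b := T)
      (f := fun t : ℝ => m t - m 0) (f' := fun t : ℝ => Complex.exp (-(p * t)) • r t)
      (B := fun t => R / p.re * (1 - Real.exp (-(p.re * t))))
      (B' := fun t => R * Real.exp (-(p.re * t)))
      (fun t ht => ((hmd t ht.1).sub_const _).continuousAt.continuousWithinAt)
      (fun t ht => ((hmd t ht.1).sub_const _).hasDerivWithinAt)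
      (by simp) (fun t => by
        have h1 : HasDerivAt (fun t : ℝ => -(p.re * t)) (-p.re) t := by
          simpa using ((hasDerivAt_id t).const_mul p.re).fun_neg
        refine ((h1.exp.const_sub 1).const_mul (R / p.re)).congr_deriv ?_
        field_simp)
      (fun t ht => by
        rw [norm_smul, hnexp, mul_comm]
        exact mul_le_mul_of_nonneg_right (hr t ht.1) (Real.exp_pos _).le)
      (right_mem_Icc.2 hT)
    have hm0 : m 0 = u 0 := by simp [hm]
    have hmT : ‖m T‖ ≤ Real.exp (-(p.re * T)) * B := by
      simp only [hm, norm_smul, hnexp]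
      exact mul_le_mul_of_nonneg_left (hB T hT) (Real.exp_pos _).le
    have h4 : R / p.re * (1 - Real.exp (-(p.re * T))) ≤ R / p.re := by
      have : 0 ≤ R / p.re := by positivity
      nlinarith [Real.exp_pos (-(p.re * T))]
    have h5 : ‖u 0‖ ≤ ‖m T‖ + ‖m T - m 0‖ := by
      rw [← hm0]
      have := norm_sub_norm_le (m 0) (m T)
      rw [norm_sub_rev] at this
      linarith
    linarith
  have hlim : Tendsto (fun T : ℝ => Real.exp (-(p.re * T)) * B + R / p.re) atTop
      (𝓝 (0 * B + R / p.re)) := by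
    refine ((Tendsto.mul_const B ?_).add_const _)
    exact Real.tendsto_exp_neg_atTop_nhds_zero.comp (tendsto_id.const_mul_atTop hp)
  have := ge_of_tendsto hlim (eventually_atTop.2 ⟨0, fun T hT => key T hT⟩)
  simpa using this

variable {G : Type*} [NormedAddCommGroup G] [NormedSpace ℂ G]

/-- Cauchy estimate for the Fréchet derivative of a bounded holomorphic map. -/
theorem norm_fderiv_le_of_norm_le {f : G → E} {x : G} {δ C : ℝ} (hδ : 0 < δ)
    (hf : DifferentiableOn ℂ f (Metric.ball x δ)) (hC : ∀ y ∈ Metric.ball x δ, ‖f y‖ ≤ C) :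
    ‖fderiv ℂ f x‖ ≤ 2 * C / δ := by
  refine Complex.norm_fderiv_le_div_of_mapsTo_ball hf (fun y hy => ?_) hδ
  rw [Metric.mem_closedBall, dist_eq_norm]
  have h1 := hC y hy
  have h2 := hC x (Metric.mem_ball_self hδ)
  linarith [norm_sub_le (f y) (f x)]

/-- A uniform limit of holomorphic maps on an open subset of a complex normed space is
holomorphic. -/
theorem differentiableOn_of_uniform_limit [CompleteSpace E] {F : ℕ → G → E} {f : G → E} {U : Set G}
    (hU : IsOpen U) (hF : ∀ n, DifferentiableOn ℂ (F n) U) {b : ℕ → ℝ}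
    (hb : Tendsto b atTop (𝓝 0)) (hFf : ∀ n, ∀ x ∈ U, ‖F n x - f x‖ ≤ b n) :
    DifferentiableOn ℂ f U := by
  intro x hx
  obtain ⟨δ, hδ, hball⟩ := Metric.isOpen_iff.1 hU x hx
  have hsub : ∀ y ∈ Metric.ball x (δ / 2), Metric.ball y (δ / 2) ⊆ U := fun y hy =>
    (Metric.ball_subset_ball' (by
      have := Metric.mem_ball.1 hy
      linarith)).trans hball
  have hcau : ∀ n m, ∀ y ∈ Metric.ball x (δ / 2),
      ‖fderiv ℂ (F n) y - fderiv ℂ (F m) y‖ ≤ 2 * (b n + b m) / (δ / 2) := by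
    intro n m y hy
    have hyU : y ∈ U := hsub y hy (Metric.mem_ball_self (by positivity))
    have hd : ∀ n, DifferentiableAt ℂ (F n) y := fun n => (hF n).differentiableAt (hU.mem_nhds hyU)
    rw [← fderiv_sub (hd n) (hd m)]
    refine norm_fderiv_le_of_norm_le (by positivity)
      (((hF n).sub (hF m)).mono (hsub y hy)) fun z hz => ?_
    have h1 := hFf n z (hsub y hy hz)
    have h2 := hFf m z (hsub y hy hz)
    have h3 : (F n - F m) z = (F n z - f z) - (F m z - f z) := by simp
    rw [h3]
    exact (norm_sub_le _ _).trans (add_le_add h1 h2)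
  have hlimb : Tendsto (fun N : ℕ × ℕ => 2 * (b N.1 + b N.2) / (δ / 2)) atTop (𝓝 0) := by
    have h0 : Tendsto (fun N : ℕ × ℕ => 2 * (b N.1 + b N.2) / (δ / 2)) atTop
        (𝓝 (2 * (0 + 0) / (δ / 2))) := by
      rw [← prod_atTop_atTop_eq]
      exact (((hb.comp tendsto_fst).add (hb.comp tendsto_snd)).const_mul 2).div_const _
    simpa using h0
  have hC : UniformCauchySeqOn (fun n => fderiv ℂ (F n)) atTop (Metric.ball x (δ / 2)) := by
    rw [Metric.uniformCauchySeqOn_iff]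
    intro e he
    have := (hlimb.eventually (gt_mem_nhds he))
    rw [← prod_atTop_atTop_eq] at this
    obtain ⟨N, hN⟩ := (eventually_atTop_prod_self.1 (by rwa [prod_atTop_atTop_eq] at this))
    refine ⟨N, fun m hm n hn y hy => ?_⟩
    rw [dist_eq_norm]
    exact (hcau m n y hy).trans_lt (hN m n hm hn)
  have hlim : ∀ y, y ∈ Metric.ball x (δ / 2) → ∃ L, Tendsto (fun n => fderiv ℂ (F n) y) atTop (𝓝 L) :=
    fun y hy => cauchySeq_tendsto_of_complete (hC.cauchySeq hy)
  choose! g' hg' using hlim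
  have hunif := hC.tendstoUniformlyOn_of_tendsto hg'
  have := hasFDerivAt_of_tendstoUniformlyOn Metric.isOpen_ball hunif
    (fun n y hy => ((hF n).differentiableAt
      (hU.mem_nhds (hsub y hy (Metric.mem_ball_self (by positivity))))).hasFDerivAt)
    (g := f) (fun y hy => by
      have hyU := hsub y hy (Metric.mem_ball_self (by positivity))
      rw [tendsto_iff_norm_sub_tendsto_zero]
      exact squeeze_zero (fun _ => norm_nonneg _) (fun n => hFf n y hyU) hb)
    (Metric.mem_ball_self (by positivity : 0 < δ / 2))
  exact this.differentiableAt.differentiableWithinAt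

end Tools

/-! ### The Laplace-type integral along a ray -/

section LaplaceRay

open MeasureTheory

variable {E : Type*} [NormedAddCommGroup E] [NormedSpace ℂ E]

/-- The Laplace integral along the ray `z + κ ℝ₊`, as a function of `(z, h)`: it inverts the operator
`p - κ ∂_z`, where `p = ω / h`, on bounded holomorphic functions. -/
noncomputable def laplaceRay (ω κ : ℂ) (f : ℂ × ℂ → E) (x : ℂ × ℂ) : E :=
  ∫ t in Ioi (0 : ℝ), Complex.exp (-(t * (ω / x.2))) • f (x.1 + t * κ, x.2)

variable {ω κ : ℂ} {V D : Set ℂ} {c : ℝ}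

theorem norm_exp_ray {ω h : ℂ} {c t : ℝ} (hc : c < (ω / h).re) (ht : 0 ≤ t) :
    ‖Complex.exp (-(t * (ω / h)))‖ ≤ Real.exp (-c * t) := by
  rw [Complex.norm_exp]
  apply Real.exp_le_exp.2
  simp only [Complex.neg_re, Complex.re_ofReal_mul]
  nlinarith

theorem norm_laplaceRay_integrand_le (hDc : ∀ h ∈ D, h ≠ 0 ∧ c < (ω / h).re)
    (hVκ : ∀ z ∈ V, ∀ t : ℝ, 0 ≤ t → z + t * κ ∈ V)
    {f : ℂ × ℂ → E} {B : ℝ} (hB : ∀ x ∈ V ×ˢ D, ‖f x‖ ≤ B) {x : ℂ × ℂ} (hx : x ∈ V ×ˢ D) {t : ℝ}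
    (ht : 0 ≤ t) :
    ‖Complex.exp (-(t * (ω / x.2))) • f (x.1 + t * κ, x.2)‖ ≤ B * Real.exp (-c * t) := by
  rw [norm_smul, mul_comm B]
  exact mul_le_mul (norm_exp_ray (hDc _ hx.2).2 ht) (hB _ ⟨hVκ _ hx.1 t ht, hx.2⟩)
    (norm_nonneg _) (Real.exp_pos _).le

theorem integrableOn_const_mul_exp (hc : 0 < c) (B : ℝ) :
    IntegrableOn (fun t => B * Real.exp (-c * t)) (Ioi 0) :=
  (integrableOn_exp_mul_Ioi (by linarith) 0).const_mul B

theorem norm_laplaceRay_le (hc : 0 < c) (hDc : ∀ h ∈ D, h ≠ 0 ∧ c < (ω / h).re)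
    (hVκ : ∀ z ∈ V, ∀ t : ℝ, 0 ≤ t → z + t * κ ∈ V)
    {f : ℂ × ℂ → E} {B : ℝ} (hB : ∀ x ∈ V ×ˢ D, ‖f x‖ ≤ B) {x : ℂ × ℂ} (hx : x ∈ V ×ˢ D) :
    ‖laplaceRay ω κ f x‖ ≤ B / c := by
  have h1 := norm_integral_le_of_norm_le (μ := volume.restrict (Ioi (0 : ℝ)))
    (integrableOn_const_mul_exp hc B)
    (ae_restrict_of_forall_mem measurableSet_Ioi fun t (ht : 0 < t) =>
      norm_laplaceRay_integrand_le hDc hVκ hB hx ht.le)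
  refine h1.trans (le_of_eq ?_)
  rw [integral_const_mul, integral_exp_mul_Ioi (by linarith)]
  simp
  ring

/-- `laplaceRay` preserves joint holomorphy, and solves `κ ∂_z J = p J - f`. -/
theorem exists_hasFDerivAt_laplaceRay [CompleteSpace E] (hV : IsOpen V) (hD : IsOpen D) (hc : 0 < c)
    (hDc : ∀ h ∈ D, h ≠ 0 ∧ c < (ω / h).re)
    (hVκ : ∀ z ∈ V, ∀ t : ℝ, 0 ≤ t → z + t * κ ∈ V)
    {f : ℂ × ℂ → E} (hf : DifferentiableOn ℂ f (V ×ˢ D)) {B : ℝ} (hB : ∀ x ∈ V ×ˢ D, ‖f x‖ ≤ B)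
    {x : ℂ × ℂ} (hx : x ∈ V ×ˢ D) :
    ∃ L : ℂ × ℂ →L[ℂ] E, HasFDerivAt (laplaceRay ω κ f) L x ∧
      L (κ, 0) = (ω / x.2) • laplaceRay ω κ f x - f x := by
  have hO : IsOpen (V ×ˢ D) := hV.prod hD
  set F : ℂ × ℂ → ℝ → E := fun x t => Complex.exp (-(t * (ω / x.2))) • f (x.1 + t * κ, x.2) with hF
  have hshift : ∀ y ∈ V ×ˢ D, ∀ t : ℝ, 0 ≤ t → (y.1 + t * κ, y.2) ∈ V ×ˢ D :=
    fun y hy t ht => ⟨hVκ _ hy.1 t ht, hy.2⟩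
  have hFd : ∀ t : ℝ, 0 ≤ t → DifferentiableOn ℂ (fun y => F y t) (V ×ˢ D) := by
    intro t ht y hy
    have h1 : DifferentiableAt ℂ (fun y : ℂ × ℂ => Complex.exp (-(t * (ω / y.2)))) y := by
      have : y.2 ≠ 0 := (hDc _ hy.2).1
      fun_prop (disch := assumption)
    have h2 : DifferentiableAt ℂ f (y.1 + t * κ, y.2) :=
      hf.differentiableAt (hO.mem_nhds (hshift y hy t ht))
    have h3 : DifferentiableAt ℂ (fun y : ℂ × ℂ => f (y.1 + t * κ, y.2)) y :=
      DifferentiableAt.comp (g := f) (f := fun y : ℂ × ℂ => (y.1 + t * κ, y.2)) y h2 (by fun_prop)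
    exact (h1.smul h3).differentiableWithinAt
  have hFB : ∀ y ∈ V ×ˢ D, ∀ t : ℝ, 0 ≤ t → ‖F y t‖ ≤ B * Real.exp (-c * t) := fun y hy t ht =>
    norm_laplaceRay_integrand_le hDc hVκ hB hy ht
  have hFcont : ∀ y ∈ V ×ˢ D, ContinuousOn (F y) (Ici 0) := by
    intro y hy
    refine ContinuousOn.smul (by fun_prop) ?_
    exact hf.continuousOn.comp (by fun_prop) fun t ht => hshift y hy t ht
  have hFmeas : ∀ y ∈ V ×ˢ D, AEStronglyMeasurable (F y) (volume.restrict (Ioi 0)) := fun y hy =>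
    ((hFcont y hy).mono Ioi_subset_Ici_self).aestronglyMeasurable measurableSet_Ioi
  have hFint : ∀ y ∈ V ×ˢ D, IntegrableOn (F y) (Ioi 0) := fun y hy =>
    (integrableOn_const_mul_exp hc B).mono' (hFmeas y hy)
      (ae_restrict_of_forall_mem measurableSet_Ioi fun t (ht : 0 < t) => hFB y hy t ht.le)
  obtain ⟨δ, hδ, hball⟩ := Metric.isOpen_iff.1 hO x hx
  have hsub : ∀ y ∈ Metric.ball x (δ / 2), Metric.ball y (δ / 2) ⊆ V ×ˢ D := fun y hy =>
    (Metric.ball_subset_ball' (by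
      have := Metric.mem_ball.1 hy
      linarith)).trans hball
  have hself : ∀ y ∈ Metric.ball x (δ / 2), y ∈ V ×ˢ D := fun y hy =>
    hsub y hy (Metric.mem_ball_self (by positivity))
  set F' : ℂ × ℂ → ℝ → (ℂ × ℂ →L[ℂ] E) := fun y t => fderiv ℂ (fun y => F y t) y with hF'
  have hF'd : ∀ y ∈ V ×ˢ D, ∀ t : ℝ, 0 ≤ t → HasFDerivAt (fun y => F y t) (F' y t) y :=
    fun y hy t ht => ((hFd t ht).differentiableAt (hO.mem_nhds hy)).hasFDerivAt
  have hF'B : ∀ t : ℝ, 0 ≤ t → ∀ y ∈ Metric.ball x (δ / 2),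
      ‖F' y t‖ ≤ (4 * B / δ) * Real.exp (-c * t) := by
    intro t ht y hy
    refine (norm_fderiv_le_of_norm_le (by positivity) ((hFd t ht).mono (hsub y hy))
      fun z hz => hFB z (hsub y hy hz) t ht).trans (le_of_eq ?_)
    field_simp
    ring
  -- directional derivatives are pointwise limits of difference quotients, hence measurable in `t`
  have hF'v : ∀ v : ℂ × ℂ, AEStronglyMeasurable (fun t => F' x t v) (volume.restrict (Ioi 0)) := by
    intro v
    have hnear : ∀ᶠ n : ℕ in atTop, x + ((n : ℂ) + 1)⁻¹ • v ∈ V ×ˢ D := by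
      have : Tendsto (fun n : ℕ => x + ((n : ℂ) + 1)⁻¹ • v) atTop (𝓝 (x + (0 : ℂ) • v)) := by
        refine tendsto_const_nhds.add (Tendsto.smul_const ?_ v)
        simpa using (tendsto_one_div_add_atTop_nhds_zero_nat (𝕜 := ℂ))
      rw [zero_smul, add_zero] at this
      exact this.eventually_mem (hO.mem_nhds hx)
    obtain ⟨N, hN⟩ := eventually_atTop.1 hnear
    refine aestronglyMeasurable_of_tendsto_ae atTop
      (f := fun (n : ℕ) t => (((n + N : ℕ) : ℂ) + 1) •
        (F (x + (((n + N : ℕ) : ℂ) + 1)⁻¹ • v) t - F x t)) (fun n => ?_) ?_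
    · exact ((hFmeas _ (hN _ (Nat.le_add_left _ _))).sub (hFmeas x hx)).const_smul _
    · refine ae_restrict_of_forall_mem measurableSet_Ioi fun t (ht : 0 < t) => ?_
      refine (hF'd x hx t ht.le).lim v ?_
      have hn : ∀ n : ℕ, ‖((n + N : ℕ) : ℂ) + 1‖ = (n : ℝ) + (N + 1) := fun n => by
        rw [← Nat.cast_succ, Complex.norm_natCast]
        push_cast
        ring
      simp_rw [hn]
      exact tendsto_atTop_add_const_right _ _ tendsto_natCast_atTop_atTop
  have hF'meas : AEStronglyMeasurable (F' x) (volume.restrict (Ioi 0)) := by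
    have : F' x = fun t => (ContinuousLinearMap.fst ℂ ℂ ℂ).smulRight (F' x t (1, 0)) +
        (ContinuousLinearMap.snd ℂ ℂ ℂ).smulRight (F' x t (0, 1)) := by
      funext t
      ext <;> simp
    rw [this]
    refine AEStronglyMeasurable.add ?_ ?_
    · exact (ContinuousLinearMap.smulRightL ℂ (ℂ × ℂ) E
        (ContinuousLinearMap.fst ℂ ℂ ℂ)).continuous.comp_aestronglyMeasurable (hF'v _)
    · exact (ContinuousLinearMap.smulRightL ℂ (ℂ × ℂ) E
        (ContinuousLinearMap.snd ℂ ℂ ℂ)).continuous.comp_aestronglyMeasurable (hF'v _)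
  have hmain : HasFDerivAt (fun y => ∫ t in Ioi (0 : ℝ), F y t) (∫ t in Ioi (0 : ℝ), F' x t) x := by
    refine hasFDerivAt_integral_of_dominated_of_fderiv_le
      (Metric.ball_mem_nhds x (by positivity : 0 < δ / 2)) ?_ (hFint x hx) hF'meas
      (ae_restrict_of_forall_mem measurableSet_Ioi fun t (ht : 0 < t) => hF'B t ht.le)
      (integrableOn_const_mul_exp hc _)
      (ae_restrict_of_forall_mem measurableSet_Ioi fun t (ht : 0 < t) y hy =>
        hF'd y (hself y hy) t ht.le)
    filter_upwards [hO.mem_nhds hx] with y hy using hFmeas y hy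
  have hF'int : IntegrableOn (F' x) (Ioi 0) :=
    (integrableOn_const_mul_exp hc _).mono' hF'meas
      (ae_restrict_of_forall_mem measurableSet_Ioi fun t (ht : 0 < t) =>
        hF'B t ht.le x (Metric.mem_ball_self (by positivity)))
  refine ⟨_, hmain, ?_⟩
  rw [ContinuousLinearMap.integral_apply hF'int]
  -- along the ray, `∂_t F = ∂_κ F - p F`; integrate this over `[0, ∞)`
  have hG : ∀ t ∈ Ici (0 : ℝ), HasDerivAt (F x) (F' x t (κ, 0) - (ω / x.2) • F x t) t := by
    intro t ht
    have h2 : HasFDerivAt f (fderiv ℂ f (x.1 + t * κ, x.2)) (x.1 + t * κ, x.2) :=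
      (hf.differentiableAt (hO.mem_nhds (hshift x hx t ht))).hasFDerivAt
    have h3 : HasDerivAt (fun s : ℝ => f (x.1 + s * κ, x.2))
        (fderiv ℂ f (x.1 + t * κ, x.2) (κ, 0)) t := by
      have hl : HasDerivAt (fun s : ℝ => (x.1 + s * κ, x.2)) (κ, (0 : ℂ)) t := by
        refine HasDerivAt.prodMk ?_ (hasDerivAt_const _ _)
        simpa using ((hasDerivAt_id t).ofReal_comp.mul_const κ).const_add x.1
      exact (h2.restrictScalars ℝ).comp_hasDerivAt t hl
    have h4 : F' x t (κ, 0) =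
        Complex.exp (-(t * (ω / x.2))) • fderiv ℂ f (x.1 + t * κ, x.2) (κ, 0) := by
      have hl : HasDerivAt (fun s : ℂ => (x.1 + s * κ, x.2)) (κ, (0 : ℂ)) 0 := by
        refine HasDerivAt.prodMk ?_ (hasDerivAt_const _ _)
        simpa using ((hasDerivAt_id (0 : ℂ)).mul_const κ).const_add x.1
      have hl' : HasDerivAt (fun s : ℂ => (x.1 + s * κ + t * κ, x.2)) (κ, (0 : ℂ)) 0 := by
        refine HasDerivAt.prodMk ?_ (hasDerivAt_const _ _)
        simpa using (((hasDerivAt_id (0 : ℂ)).mul_const κ).const_add x.1).add_const (t * κ)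
      have e1 := HasFDerivAt.comp_hasDerivAt_of_eq (0 : ℂ) (hF'd x hx t ht) hl (by simp)
      have e2 := HasFDerivAt.comp_hasDerivAt_of_eq (0 : ℂ) h2 hl' (by simp)
      exact e1.unique (e2.const_smul (Complex.exp (-(t * (ω / x.2)))))
    have h5 : HasDerivAt (fun s : ℝ => Complex.exp (-(s * (ω / x.2))))
        (Complex.exp (-(t * (ω / x.2))) * -(ω / x.2)) t := by
      have : HasDerivAt (fun s : ℝ => -((s : ℂ) * (ω / x.2))) (-(ω / x.2)) t := by
        simpa using ((hasDerivAt_id t).ofReal_comp.mul_const (ω / x.2)).fun_neg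
      exact this.cexp
    refine (h5.fun_smul h3).congr_deriv ?_
    rw [h4]
    simp only [hF, smul_smul, mul_neg, neg_smul, sub_eq_add_neg, mul_comm (ω / x.2)]
  have hzero : Tendsto (F x) atTop (𝓝 0) := by
    refine squeeze_zero_norm' (eventually_atTop.2 ⟨0, fun t ht => hFB x hx t ht⟩) ?_
    have : Tendsto (fun t : ℝ => Real.exp (-c * t)) atTop (𝓝 0) :=
      Real.tendsto_exp_atBot.comp (tendsto_id.const_mul_atTop_of_neg (by linarith))
    simpa using this.const_mul B
  have hI1 : IntegrableOn (fun t => F' x t (κ, 0)) (Ioi 0) := hF'int.apply_continuousLinearMap _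
  have hI2 : IntegrableOn (fun t => (ω / x.2) • F x t) (Ioi 0) := (hFint x hx).smul _
  have hfin := integral_Ioi_of_hasDerivAt_of_tendsto' hG (hI1.sub hI2) hzero
  rw [integral_sub hI1 hI2, integral_smul] at hfin
  have hF0 : F x 0 = f x := by simp [hF]
  rw [hF0, zero_sub, sub_eq_iff_eq_add] at hfin
  rw [hfin]
  simp only [laplaceRay, hF]
  abel

end LaplaceRay

/-! ### Halfstrips, Borel discs and factorial estimates -/

section Halfstrip

theorem mem_halfstrip {θ ε : ℝ} {z₁ z : ℂ} {r : ℝ} : z ∈ halfstrip θ ε z₁ r ↔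
    ∃ t : ℝ, 0 ≤ t ∧ dist z (z₁ + (ε * t : ℝ) * Complex.exp (θ * Complex.I)) < r := by
  rw [halfstrip, Metric.mem_thickening_iff]
  constructor
  · rintro ⟨y, ⟨t, ht, rfl⟩, h⟩
    exact ⟨t, ht, h⟩
  · rintro ⟨t, ht, h⟩
    exact ⟨_, ⟨t, ht, rfl⟩, h⟩

theorem isOpen_halfstrip {θ ε : ℝ} {z₁ : ℂ} {r : ℝ} : IsOpen (halfstrip θ ε z₁ r) :=
  Metric.isOpen_thickening

theorem halfstrip_mono {θ ε : ℝ} {z₁ : ℂ} {r r' : ℝ} (h : r ≤ r') :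
    halfstrip θ ε z₁ r ⊆ halfstrip θ ε z₁ r' := Metric.thickening_mono h _

theorem mem_halfstrip_of_dist_le {θ ε : ℝ} {z₁ z y : ℂ} {r σ : ℝ} (hz : z ∈ halfstrip θ ε z₁ r)
    (hy : dist y z ≤ σ) : y ∈ halfstrip θ ε z₁ (r + σ) := by
  obtain ⟨t, ht, h⟩ := mem_halfstrip.1 hz
  exact mem_halfstrip.2 ⟨t, ht, by
    have := dist_triangle y z (z₁ + (ε * t : ℝ) * Complex.exp (θ * Complex.I))
    linarith⟩

theorem add_mem_halfstrip {θ ε : ℝ} {z₁ z : ℂ} {r : ℝ} (hz : z ∈ halfstrip θ ε z₁ r) {t : ℝ}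
    (ht : 0 ≤ t) : z + t * (ε * Complex.exp (θ * Complex.I)) ∈ halfstrip θ ε z₁ r := by
  obtain ⟨u, hu, h⟩ := mem_halfstrip.1 hz
  refine mem_halfstrip.2 ⟨u + t, by positivity, ?_⟩
  rw [dist_eq_norm] at h ⊢
  convert h using 2
  push_cast
  ring

theorem isOpen_borelDisc {θ d : ℝ} : IsOpen (borelDisc θ d) := by
  have h1 : IsOpen {h : ℂ | h ≠ 0} := isOpen_ne
  have h2 : ContinuousOn (fun h : ℂ => (Complex.exp (θ * Complex.I) / h).re) {h : ℂ | h ≠ 0} :=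
    Complex.continuous_re.comp_continuousOn
      (continuousOn_const.div continuousOn_id fun _ hx => hx)
  exact h2.isOpen_inter_preimage h1 isOpen_Ioi

theorem borelDisc_mono {θ d d' : ℝ} (hd : 0 < d) (h : d ≤ d') : borelDisc θ d ⊆ borelDisc θ d' :=
  fun _ hx => ⟨hx.1, (one_div_le_one_div_of_le hd h).trans_lt hx.2⟩

theorem norm_exp_mul_I (θ : ℝ) : ‖Complex.exp (θ * Complex.I)‖ = 1 :=
  Complex.norm_exp_ofReal_mul_I θ

theorem norm_lt_of_mem_borelDisc {θ d : ℝ} (hd : 0 < d) {h : ℂ} (hh : h ∈ borelDisc θ d) :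
    ‖h‖ < d := by
  have h1 := hh.2.trans_le (Complex.re_le_norm _)
  rw [norm_div, norm_exp_mul_I] at h1
  exact (one_div_lt_one_div hd (norm_pos_iff.2 hh.1)).1 h1

/-- The Borel disc contains points of arbitrarily small modulus. -/
theorem smul_mem_borelDisc {θ d : ℝ} {t : ℝ} (ht : 0 < t) (htd : t < d) :
    (t : ℂ) * Complex.exp (θ * Complex.I) ∈ borelDisc θ d := by
  have h0 := Complex.exp_ne_zero (θ * Complex.I)
  have h1 : (t : ℂ) ≠ 0 := by exact_mod_cast ht.ne'
  refine ⟨mul_ne_zero h1 h0, ?_⟩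
  have : Complex.exp (θ * Complex.I) / (t * Complex.exp (θ * Complex.I)) = ((1 / t : ℝ) : ℂ) := by
    push_cast
    field_simp
  rw [this, Complex.ofReal_re]
  exact one_div_lt_one_div_of_lt ht htd

theorem tendsto_smul_borelDisc {θ d : ℝ} (hd : 0 < d) :
    Tendsto (fun t : ℝ => (t : ℂ) * Complex.exp (θ * Complex.I)) (𝓝[>] 0)
      (𝓝[borelDisc θ d] 0) := by
  refine tendsto_nhdsWithin_iff.2 ⟨?_, ?_⟩
  · have : Tendsto (fun t : ℝ => (t : ℂ) * Complex.exp (θ * Complex.I)) (𝓝 0)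
        (𝓝 (((0 : ℝ) : ℂ) * Complex.exp (θ * Complex.I))) := by
      apply Continuous.tendsto (by fun_prop)
    simpa using this.mono_left nhdsWithin_le_nhds
  · filter_upwards [Ioo_mem_nhdsGT hd] with t ht using smul_mem_borelDisc ht.1 ht.2

theorem neBot_borelDisc {θ d : ℝ} (hd : 0 < d) : (𝓝[borelDisc θ d] (0 : ℂ)).NeBot :=
  (tendsto_smul_borelDisc hd).neBot

end Halfstrip

section Factorials

/-- The Gevrey weight `Mⁿ n!`. -/
noncomputable def gev (M : ℝ) (n : ℕ) : ℝ := M ^ n * (n.factorial : ℝ)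

theorem gev_nonneg {M : ℝ} (hM : 0 ≤ M) (n : ℕ) : 0 ≤ gev M n := by
  unfold gev
  positivity

theorem gev_pos {M : ℝ} (hM : 0 < M) (n : ℕ) : 0 < gev M n := by
  unfold gev
  positivity

@[simp] theorem gev_zero (M : ℝ) : gev M 0 = 1 := by simp [gev]

theorem gev_mono {M M' : ℝ} (hM : 0 ≤ M) (h : M ≤ M') (n : ℕ) : gev M n ≤ gev M' n := by
  unfold gev
  gcongr

theorem gev_succ (M : ℝ) (n : ℕ) : gev M (n + 1) = M * (n + 1) * gev M n := by
  unfold gev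
  rw [Nat.factorial_succ]
  push_cast
  ring

theorem gev_succ_le {M : ℝ} (hM : 0 ≤ M) (n : ℕ) : gev M (n + 1) ≤ M * gev (2 * M) n := by
  have h1 : ((n : ℝ) + 1) ≤ 2 ^ n := by
    exact_mod_cast Nat.lt_two_pow_self (n := n)
  rw [gev_succ, mul_assoc]
  refine mul_le_mul_of_nonneg_left ?_ hM
  unfold gev
  rw [mul_pow]
  nlinarith [mul_nonneg (pow_nonneg hM n) (Nat.cast_nonneg (α := ℝ) n.factorial)]

theorem mul_gev (a M : ℝ) (n : ℕ) : gev (a * M) n = a ^ n * gev M n := by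
  simp [gev, mul_pow, mul_assoc]

theorem factorial_succ_mul_factorial_succ_le (i j : ℕ) :
    (i + 1).factorial * (j + 1).factorial ≤ (i + j + 1).factorial := by
  induction j with
  | zero => simp
  | succ j ih =>
    rw [Nat.factorial_succ (j + 1), show i + (j + 1) + 1 = (i + j + 1) + 1 by ring,
      Nat.factorial_succ (i + j + 1)]
    calc _ = (j + 1 + 1) * ((i + 1).factorial * (j + 1).factorial) := by ring
      _ ≤ _ := Nat.mul_le_mul (by omega) ih

theorem sum_factorial_mul_factorial_le (n : ℕ) :
    ∑ p ∈ Finset.HasAntidiagonal.antidiagonal n, p.1.factorial * p.2.factorial ≤ 3 * n.factorial := by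
  rcases n with _ | n
  · simp
  rcases n with _ | n
  · decide
  have h : ∀ i ∈ Finset.range (n + 1),
      (i + 1).factorial * (n + 2 - (i + 1)).factorial ≤ (n + 1).factorial := by
    intro i hi
    have hi' := Finset.mem_range.1 hi
    have := factorial_succ_mul_factorial_succ_le i (n - i)
    rwa [show n + 2 - (i + 1) = n - i + 1 by omega, show n + 1 = i + (n - i) + 1 by omega]
  rw [Finset.Nat.sum_antidiagonal_eq_sum_range_succ (f := fun i j => i.factorial * j.factorial),
    Finset.sum_range_succ, Finset.sum_range_succ']
  have h5 := Finset.sum_le_sum h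
  simp only [Finset.sum_const, Finset.card_range, smul_eq_mul] at h5
  have h6 : (n + 2).factorial = (n + 2) * (n + 1).factorial := Nat.factorial_succ _
  simp only [Nat.factorial_zero, Nat.sub_zero, Nat.sub_self, one_mul, mul_one]
  show _ ≤ 3 * (n + 2).factorial
  have : (n + 1) * (n + 1).factorial ≤ (n + 2).factorial := by
    rw [h6]; exact Nat.mul_le_mul_right _ (by omega)
  simp only [Nat.add_assoc, Nat.reduceAdd] at *
  omega

theorem sum_gev_mul_gev_le {M : ℝ} (hM : 0 ≤ M) (n : ℕ) :
    ∑ p ∈ Finset.HasAntidiagonal.antidiagonal n, gev M p.1 * gev M p.2 ≤ 3 * gev M n := by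
  have h1 : ∀ p ∈ Finset.HasAntidiagonal.antidiagonal n, gev M p.1 * gev M p.2 =
      M ^ n * ((p.1.factorial * p.2.factorial : ℕ) : ℝ) := by
    intro p hp
    rw [← Finset.HasAntidiagonal.mem_antidiagonal.1 hp, pow_add]
    simp only [gev]
    push_cast
    ring
  rw [Finset.sum_congr rfl h1, ← Finset.mul_sum, ← Nat.cast_sum]
  have h2 : ((∑ p ∈ Finset.HasAntidiagonal.antidiagonal n, p.1.factorial * p.2.factorial : ℕ) : ℝ) ≤
      3 * (n.factorial : ℝ) := by exact_mod_cast sum_factorial_mul_factorial_le n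
  unfold gev
  nlinarith [pow_nonneg hM n]

end Factorials

section Conv

variable {E₁ E₂ E₃ : Type*} [NormedAddCommGroup E₁] [NormedSpace ℂ E₁] [NormedAddCommGroup E₂]
  [NormedSpace ℂ E₂] [NormedAddCommGroup E₃] [NormedSpace ℂ E₃]

/-- The Cauchy product of two coefficient sequences along a bilinear map. -/
noncomputable def conv (β : E₁ →L[ℂ] E₂ →L[ℂ] E₃) (f : ℕ → E₁) (g : ℕ → E₂) (n : ℕ) : E₃ :=
  ∑ p ∈ Finset.HasAntidiagonal.antidiagonal n, β (f p.1) (g p.2)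

theorem conv_congr {β : E₁ →L[ℂ] E₂ →L[ℂ] E₃} {f f' : ℕ → E₁} {g g' : ℕ → E₂} {n : ℕ}
    (hf : ∀ i ≤ n, f i = f' i) (hg : ∀ i ≤ n, g i = g' i) : conv β f g n = conv β f' g' n := by
  refine Finset.sum_congr rfl fun p hp => ?_
  have := Finset.HasAntidiagonal.mem_antidiagonal.1 hp
  rw [hf p.1 (by omega), hg p.2 (by omega)]

theorem norm_conv_le {β : E₁ →L[ℂ] E₂ →L[ℂ] E₃} (hβ : ∀ x y, ‖β x y‖ ≤ ‖x‖ * ‖y‖)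
    {f : ℕ → E₁} {g : ℕ → E₂} {n : ℕ} {C₁ C₂ M : ℝ} (hM : 0 ≤ M)
    (hf : ∀ i ≤ n, ‖f i‖ ≤ C₁ * gev M i) (hg : ∀ i ≤ n, ‖g i‖ ≤ C₂ * gev M i) :
    ‖conv β f g n‖ ≤ 3 * C₁ * C₂ * gev M n := by
  have hC₁ : 0 ≤ C₁ := by simpa using (norm_nonneg _).trans (hf 0 (Nat.zero_le _))
  have hC₂ : 0 ≤ C₂ := by simpa using (norm_nonneg _).trans (hg 0 (Nat.zero_le _))
  calc ‖conv β f g n‖ ≤ ∑ p ∈ Finset.HasAntidiagonal.antidiagonal n, C₁ * C₂ * (gev M p.1 * gev M p.2) := by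
        refine norm_sum_le_of_le _ fun p hp => (hβ _ _).trans ?_
        have := Finset.HasAntidiagonal.mem_antidiagonal.1 hp
        calc _ ≤ (C₁ * gev M p.1) * (C₂ * gev M p.2) :=
              mul_le_mul (hf _ (by omega)) (hg _ (by omega)) (norm_nonneg _)
                (mul_nonneg hC₁ (gev_nonneg hM _))
          _ = _ := by ring
    _ ≤ C₁ * C₂ * (3 * gev M n) := by
        rw [← Finset.mul_sum]
        exact mul_le_mul_of_nonneg_left (sum_gev_mul_gev_le hM n) (mul_nonneg hC₁ hC₂)
    _ = _ := by ring

end Conv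

section Remainder

variable {E E₁ E₂ E₃ : Type*} [NormedAddCommGroup E₁] [NormedSpace ℂ E₁] [NormedAddCommGroup E₂]
  [NormedSpace ℂ E₂] [NormedAddCommGroup E₃] [NormedSpace ℂ E₃] [NormedAddCommGroup E]
  [NormedSpace ℂ E]

/-- The remainder of order `n` of the value `f` with respect to `∑ fₖ hᵏ`, for a fixed `h`. -/
noncomputable def rem (f : E) (fk : ℕ → E) (h : ℂ) (n : ℕ) : E := f - ∑ k ∈ Finset.range n, h ^ k • fk k

@[simp] theorem rem_zero (f : E) (fk : ℕ → E) (h : ℂ) : rem f fk h 0 = f := by simp [rem]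

theorem rem_succ (f : E) (fk : ℕ → E) (h : ℂ) (n : ℕ) :
    rem f fk h (n + 1) = rem f fk h n - h ^ n • fk n := by
  simp only [rem, Finset.sum_range_succ]
  abel

theorem sum_conv_eq (β : E₁ →L[ℂ] E₂ →L[ℂ] E₃) (f : ℕ → E₁) (g : ℕ → E₂) (h : ℂ) (n : ℕ) :
    ∑ k ∈ Finset.range n, h ^ k • conv β f g k =
      ∑ k ∈ Finset.range n, h ^ k • β (∑ i ∈ Finset.range (n - k), h ^ i • f i) (g k) := by
  induction n with
  | zero => simp
  | succ n ih =>
    have h1 : ∀ k ∈ Finset.range n,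
        h ^ k • β (∑ i ∈ Finset.range (n + 1 - k), h ^ i • f i) (g k) =
        h ^ k • β (∑ i ∈ Finset.range (n - k), h ^ i • f i) (g k) + h ^ n • β (f (n - k)) (g k) := by
      intro k hk
      have hk' := Finset.mem_range.1 hk
      have h2 : n + 1 - k = (n - k) + 1 := by omega
      rw [h2, Finset.sum_range_succ, map_add, add_apply, smul_add, map_smul,
        smul_apply, smul_smul, ← pow_add]
      congr 3
      omega
    rw [Finset.sum_range_succ, ih, Finset.sum_range_succ, Finset.sum_congr rfl h1,
      Finset.sum_add_distrib, add_assoc]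
    congr 1
    have h3 : conv β f g n = ∑ k ∈ Finset.range (n + 1), β (f (n - k)) (g k) := by
      unfold conv
      rw [← Finset.Nat.sum_antidiagonal_swap,
        Finset.Nat.sum_antidiagonal_eq_sum_range_succ_mk]
      rfl
    rw [h3, Finset.sum_range_succ, smul_add, Finset.smul_sum]
    simp

/-- The remainder of a product: `R_n (f g) = f R_n(g) + ∑_{k<n} hᵏ R_{n-k}(f) g_k`. -/
theorem rem_conv (β : E₁ →L[ℂ] E₂ →L[ℂ] E₃) (f : E₁) (g : E₂) (fk : ℕ → E₁) (gk : ℕ → E₂) (h : ℂ)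
    (n : ℕ) : rem (β f g) (conv β fk gk) h n =
      β f (rem g gk h n) + ∑ k ∈ Finset.range n, h ^ k • β (rem f fk h (n - k)) (gk k) := by
  rw [rem, sum_conv_eq]
  simp only [rem, map_sub, map_sum, map_smul, sub_apply, smul_sub,
    Finset.sum_sub_distrib]
  abel

/-- The part of the remainder of a product that involves remainders of the first factor. When
`g₀ = 0`, only remainders of order strictly below `n` enter. -/
theorem norm_sum_rem_le {β : E₁ →L[ℂ] E₂ →L[ℂ] E₃} (hβ : ∀ x y, ‖β x y‖ ≤ ‖x‖ * ‖y‖)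
    {f : E₁} {fk : ℕ → E₁} {gk : ℕ → E₂} {h : ℂ} {n : ℕ} {C₁ C₂ M : ℝ} (hM : 0 ≤ M)
    (hC₁ : 0 ≤ C₁) (hC₂ : 0 ≤ C₂)
    (hf : ∀ i ≤ n, (gk 0 = 0 → i < n) → ‖rem f fk h i‖ ≤ C₁ * gev M i * ‖h‖ ^ i)
    (hg : ∀ i ≤ n, ‖gk i‖ ≤ C₂ * gev M i) :
    ‖∑ k ∈ Finset.range n, h ^ k • β (rem f fk h (n - k)) (gk k)‖ ≤
      3 * C₁ * C₂ * gev M n * ‖h‖ ^ n := by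
  have h1 : ∀ k ∈ Finset.range n, ‖h ^ k • β (rem f fk h (n - k)) (gk k)‖ ≤
      C₁ * C₂ * ‖h‖ ^ n * (gev M (n - k) * gev M k) := by
    intro k hk
    have hk' := Finset.mem_range.1 hk
    rw [norm_smul, norm_pow]
    by_cases h0 : gk k = 0
    · rw [h0]
      simp only [map_zero, norm_zero, mul_zero]
      have := gev_nonneg hM (n - k)
      have := gev_nonneg hM k
      positivity
    have h2 : ‖rem f fk h (n - k)‖ ≤ C₁ * gev M (n - k) * ‖h‖ ^ (n - k) := by
      refine hf _ (Nat.sub_le _ _) fun h00 => ?_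
      have : k ≠ 0 := by
        rintro rfl
        exact h0 h00
      omega
    calc _ ≤ ‖h‖ ^ k * ((C₁ * gev M (n - k) * ‖h‖ ^ (n - k)) * (C₂ * gev M k)) := by
          refine mul_le_mul_of_nonneg_left ((hβ _ _).trans ?_) (by positivity)
          exact mul_le_mul h2 (hg k hk'.le) (norm_nonneg _)
            (mul_nonneg (mul_nonneg hC₁ (gev_nonneg hM _)) (by positivity))
      _ = _ := by
          have : ‖h‖ ^ n = ‖h‖ ^ k * ‖h‖ ^ (n - k) := by rw [← pow_add]; congr 1; omega
          rw [this]
          ring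
  refine (norm_sum_le_of_le _ h1).trans ?_
  rw [← Finset.mul_sum]
  have h3 : ∑ k ∈ Finset.range n, gev M (n - k) * gev M k ≤ 3 * gev M n := by
    refine le_trans ?_ (sum_gev_mul_gev_le hM n)
    rw [← Finset.Nat.sum_antidiagonal_swap, Finset.Nat.sum_antidiagonal_eq_sum_range_succ_mk,
      Finset.sum_range_succ]
    exact le_add_of_nonneg_right (mul_nonneg (gev_nonneg hM _) (gev_nonneg hM _))
  calc _ ≤ C₁ * C₂ * ‖h‖ ^ n * (3 * gev M n) :=
        mul_le_mul_of_nonneg_left h3 (by positivity)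
    _ = _ := by ring

theorem norm_rem_conv_le {β : E₁ →L[ℂ] E₂ →L[ℂ] E₃} (hβ : ∀ x y, ‖β x y‖ ≤ ‖x‖ * ‖y‖)
    {f : E₁} {g : E₂} {fk : ℕ → E₁} {gk : ℕ → E₂} {h : ℂ} {n : ℕ} {C₁ C₂ M : ℝ} (hM : 0 ≤ M)
    (hC₁ : 0 ≤ C₁) (hC₂ : 0 ≤ C₂)
    (hf : ∀ i ≤ n, (gk 0 = 0 → i < n) → ‖rem f fk h i‖ ≤ C₁ * gev M i * ‖h‖ ^ i)
    (hg : ∀ i ≤ n, ‖gk i‖ ≤ C₂ * gev M i) :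
    ‖rem (β f g) (conv β fk gk) h n‖ ≤
      ‖f‖ * ‖rem g gk h n‖ + 3 * C₁ * C₂ * gev M n * ‖h‖ ^ n := by
  rw [rem_conv]
  exact (norm_add_le _ _).trans (add_le_add (hβ _ _) (norm_sum_rem_le hβ hM hC₁ hC₂ hf hg))

end Remainder

section Recursion

/-- Course-of-values recursion for sequences: the `n`-th term is prescribed by the truncation of the
sequence below `n`. -/
theorem exists_seq_of_step {X : Type*} [Zero X] (step : ℕ → (ℕ → X) → X) :
    ∃ u : ℕ → X, ∀ n, u n = step n fun k => if k < n then u k else 0 := by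
  classical
  let F : (n : ℕ) → ((m : ℕ) → m < n → X) → X := fun n ih =>
    step n fun k => if hk : k < n then ih k hk else 0
  refine ⟨fun n => WellFounded.fix Nat.lt_wfRel.wf F n, fun n => ?_⟩
  show WellFounded.fix Nat.lt_wfRel.wf F n = _
  rw [WellFounded.fix_eq]
  simp only [F, dite_eq_ite]

end Recursion

/-! ### Gevrey expansions and formal solutions of quadratic equations -/

section Gevrey

variable {E : Type*} [NormedAddCommGroup E] [NormedSpace ℂ E]

/-- A holomorphic family `f` on `U × D` with holomorphic coefficients `fₖ` on `U` and uniform Gevrey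
remainder estimates `‖f - ∑_{k<n} fₖ hᵏ‖ ≤ C Mⁿ n! |h|ⁿ`. -/
structure IsGevrey (U D : Set ℂ) (f : ℂ → ℂ → E) (fk : ℕ → ℂ → E) : Prop where
  holo : DifferentiableOn ℂ (Function.uncurry f) (U ×ˢ D)
  coeff_holo : ∀ k, DifferentiableOn ℂ (fk k) U
  bound : ∃ C M : ℝ, 0 < C ∧ 0 < M ∧ ∀ n, ∀ z ∈ U, ∀ h ∈ D,
    ‖rem (f z h) (fun k => fk k z) h n‖ ≤ C * gev M n * ‖h‖ ^ n

theorem IsGevrey.mono {U U' D D' : Set ℂ} {f : ℂ → ℂ → E} {fk : ℕ → ℂ → E}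
    (hf : IsGevrey U D f fk) (hU : U' ⊆ U) (hD : D' ⊆ D) : IsGevrey U' D' f fk := by
  obtain ⟨C, M, hC, hM, hb⟩ := hf.bound
  exact ⟨hf.holo.mono (prod_mono hU hD), fun k => (hf.coeff_holo k).mono hU,
    C, M, hC, hM, fun n z hz h hh => hb n z (hU hz) h (hD hh)⟩

/-- The coefficients of a Gevrey expansion inherit the bound of the remainders. -/
theorem norm_coeff_le_of_rem {F : Filter ℂ} [F.NeBot] (hF : Tendsto (fun h : ℂ => ‖h‖) F (𝓝[>] 0))
    {f : ℂ → E} {fk : ℕ → E} {a b : ℝ} {n : ℕ}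
    (h1 : ∀ᶠ h in F, ‖rem (f h) fk h n‖ ≤ a * ‖h‖ ^ n)
    (h2 : ∀ᶠ h in F, ‖rem (f h) fk h (n + 1)‖ ≤ b * ‖h‖ ^ (n + 1)) : ‖fk n‖ ≤ a := by
  have h3 : ∀ᶠ h in F, ‖fk n‖ ≤ a + b * ‖h‖ := by
    filter_upwards [h1, h2, (tendsto_nhdsWithin_iff.1 hF).2] with h h1 h2 h3
    have h4 : h ^ n • fk n = rem (f h) fk h n - rem (f h) fk h (n + 1) := by
      rw [rem_succ]; abel
    have h5 : ‖h‖ ^ n * ‖fk n‖ ≤ ‖h‖ ^ n * (a + b * ‖h‖) := by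
      rw [← norm_pow, ← norm_smul, h4, norm_pow]
      refine (norm_sub_le _ _).trans ((add_le_add h1 h2).trans (le_of_eq ?_))
      ring
    exact le_of_mul_le_mul_left h5 (pow_pos h3 n)
  have h4 : Tendsto (fun h : ℂ => a + b * ‖h‖) F (𝓝 (a + b * 0)) :=
    ((tendsto_nhdsWithin_iff.1 hF).1.const_mul b).const_add a
  simpa using ge_of_tendsto h4 h3

theorem tendsto_norm_borelDisc {θ d : ℝ} :
    Tendsto (fun h : ℂ => ‖h‖) (𝓝[borelDisc θ d] 0) (𝓝[>] 0) := by
  refine tendsto_nhdsWithin_iff.2 ⟨?_, ?_⟩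
  · have : Tendsto (fun h : ℂ => ‖h‖) (𝓝 0) (𝓝 ‖(0 : ℂ)‖) := continuous_norm.tendsto _
    rw [norm_zero] at this
    exact this.mono_left nhdsWithin_le_nhds
  · filter_upwards [self_mem_nhdsWithin] with h hh using norm_pos_iff.2 hh.1

/-- On a Borel disc, one pair of constants bounds both the remainders and the coefficients. -/
theorem IsGevrey.exists_bounds {U : Set ℂ} {θ d : ℝ} (hd : 0 < d) {f : ℂ → ℂ → E} {fk : ℕ → ℂ → E}
    (hf : IsGevrey U (borelDisc θ d) f fk) : ∃ C M : ℝ, 0 < C ∧ 0 < M ∧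
      (∀ n, ∀ z ∈ U, ∀ h ∈ borelDisc θ d,
        ‖rem (f z h) (fun k => fk k z) h n‖ ≤ C * gev M n * ‖h‖ ^ n) ∧
      ∀ n, ∀ z ∈ U, ‖fk n z‖ ≤ C * gev M n := by
  obtain ⟨C, M, hC, hM, hb⟩ := hf.bound
  refine ⟨C, M, hC, hM, hb, fun n z hz => ?_⟩
  have := neBot_borelDisc (θ := θ) hd
  exact norm_coeff_le_of_rem (f := f z) (fk := fun k => fk k z) (tendsto_norm_borelDisc (θ := θ))
    (eventually_of_mem self_mem_nhdsWithin fun h hh => hb n z hz h hh)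
    (eventually_of_mem self_mem_nhdsWithin fun h hh => hb (n + 1) z hz h hh)

end Gevrey

section Quadratic

variable {E : Type*} [NormedAddCommGroup E] [NormedSpace ℂ E]

/-- The evaluation pairing of a space of operators with its source. -/
noncomputable def evalPairing (E F : Type*) [NormedAddCommGroup E] [NormedSpace ℂ E]
    [NormedAddCommGroup F] [NormedSpace ℂ F] : (E →L[ℂ] F) →L[ℂ] E →L[ℂ] F :=
  ContinuousLinearMap.id ℂ (E →L[ℂ] F)

theorem evalPairing_apply {E F : Type*} [NormedAddCommGroup E] [NormedSpace ℂ E]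
    [NormedAddCommGroup F] [NormedSpace ℂ F] (f : E →L[ℂ] F) (x : E) :
    evalPairing E F f x = f x := rfl

theorem norm_evalPairing_le {E F : Type*} [NormedAddCommGroup E] [NormedSpace ℂ E]
    [NormedAddCommGroup F] [NormedSpace ℂ F] (f : E →L[ℂ] F) (x : E) :
    ‖evalPairing E F f x‖ ≤ ‖f‖ * ‖x‖ := f.le_opNorm x

/-- The `k`-th coefficient of `A(w, w) + B w + C` for formal power series `A, B, C, w`. -/
noncomputable def quadCoeff (A : ℕ → E →L[ℂ] E →L[ℂ] E) (B : ℕ → E →L[ℂ] E) (C : ℕ → E)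
    (w : ℕ → E) (k : ℕ) : E :=
  conv (evalPairing E E) (conv (evalPairing E (E →L[ℂ] E)) A w) w k +
    conv (evalPairing E E) B w k + C k

theorem quadCoeff_congr {A : ℕ → E →L[ℂ] E →L[ℂ] E} {B : ℕ → E →L[ℂ] E} {C : ℕ → E}
    {w w' : ℕ → E} {k : ℕ} (h : ∀ i ≤ k, w i = w' i) :
    quadCoeff A B C w k = quadCoeff A B C w' k := by
  unfold quadCoeff
  congr 1
  congr 1
  · exact conv_congr (fun i hi => conv_congr (fun _ _ => rfl) fun j hj => h j (hj.trans hi)) h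
  · exact conv_congr (fun _ _ => rfl) h

theorem differentiableOn_conv {E₁ E₂ E₃ : Type*} [NormedAddCommGroup E₁] [NormedSpace ℂ E₁]
    [NormedAddCommGroup E₂] [NormedSpace ℂ E₂] [NormedAddCommGroup E₃] [NormedSpace ℂ E₃]
    {β : E₁ →L[ℂ] E₂ →L[ℂ] E₃} {f : ℕ → ℂ → E₁} {g : ℕ → ℂ → E₂} {n : ℕ} {U : Set ℂ}
    (hf : ∀ i ≤ n, DifferentiableOn ℂ (f i) U) (hg : ∀ i ≤ n, DifferentiableOn ℂ (g i) U) :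
    DifferentiableOn ℂ (fun z => conv β (fun k => f k z) (fun k => g k z) n) U := by
  unfold conv
  refine DifferentiableOn.fun_sum fun p hp => ?_
  have := Finset.HasAntidiagonal.mem_antidiagonal.1 hp
  exact (β.differentiable.comp_differentiableOn (hf p.1 (by omega))).clm_apply (hg p.2 (by omega))

theorem norm_quadCoeff_le {A : ℕ → E →L[ℂ] E →L[ℂ] E} {B : ℕ → E →L[ℂ] E} {C : ℕ → E}
    {w : ℕ → E} {k : ℕ} {K M : ℝ} (hM : 0 ≤ M) (hA : ∀ i, ‖A i‖ ≤ K * gev M i)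
    (hB : ∀ i, ‖B i‖ ≤ K * gev M i) (hC : ∀ i, ‖C i‖ ≤ K * gev M i)
    (hw : ∀ i ≤ k, ‖w i‖ ≤ 1 * gev M i) : ‖quadCoeff A B C w k‖ ≤ 13 * K * gev M k := by
  have h0 : ∀ i ≤ k, ‖conv (evalPairing E (E →L[ℂ] E)) A w i‖ ≤ 3 * K * 1 * gev M i :=
    fun i hi => norm_conv_le (β := evalPairing E (E →L[ℂ] E))
      (norm_evalPairing_le (E := E) (F := E →L[ℂ] E)) hM (fun j _ => hA j)
      fun j hj => hw j (hj.trans hi)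
  have h1 := norm_conv_le (β := evalPairing E E) norm_evalPairing_le hM h0 hw
  have h2 := norm_conv_le (β := evalPairing E E) norm_evalPairing_le hM (f := B) (g := w) (n := k)
    (fun j _ => hB j) hw
  have h3 := hC k
  unfold quadCoeff
  refine (norm_add₃_le).trans ?_
  linarith

/-- The formal solution of `h ∂_z w = ε w + h (A(w, w) + B w + C)` with `w₀ = 0`; comparing the
coefficients of `h ^ (k + 1)` and using `ε = ε⁻¹` gives the recursion. -/
theorem exists_formal_quad (A : ℕ → ℂ → E →L[ℂ] E →L[ℂ] E) (B : ℕ → ℂ → E →L[ℂ] E)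
    (C : ℕ → ℂ → E) (ε : ℂ) : ∃ w : ℕ → ℂ → E, w 0 = 0 ∧ ∀ k z, w (k + 1) z =
      ε • (deriv (w k) z - quadCoeff (fun i => A i z) (fun i => B i z) (fun i => C i z)
        (fun i => w i z) k) := by
  obtain ⟨w, hw⟩ := exists_seq_of_step (X := ℂ → E) fun n u => match n with
    | 0 => 0
    | k + 1 => fun z => ε • (deriv (u k) z - quadCoeff (fun i => A i z) (fun i => B i z)
        (fun i => C i z) (fun i => u i z) k)
  refine ⟨w, hw 0, fun k z => ?_⟩
  rw [hw (k + 1)]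
  simp only [Nat.lt_succ_self, if_true]
  congr 2
  refine quadCoeff_congr fun i hi => ?_
  rw [if_pos (Nat.lt_succ_of_le hi)]

theorem differentiableOn_formal_quad [CompleteSpace E] {U : Set ℂ} (hU : IsOpen U)
    {A : ℕ → ℂ → E →L[ℂ] E →L[ℂ] E} {B : ℕ → ℂ → E →L[ℂ] E}
    {C : ℕ → ℂ → E} {ε : ℂ} (hA : ∀ k, DifferentiableOn ℂ (A k) U)
    (hB : ∀ k, DifferentiableOn ℂ (B k) U) (hC : ∀ k, DifferentiableOn ℂ (C k) U)
    {w : ℕ → ℂ → E} (h0 : w 0 = 0) (hw : ∀ k z, w (k + 1) z =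
      ε • (deriv (w k) z - quadCoeff (fun i => A i z) (fun i => B i z) (fun i => C i z)
        (fun i => w i z) k)) (k : ℕ) : DifferentiableOn ℂ (w k) U := by
  induction k using Nat.strong_induction_on with
  | _ n ih =>
    rcases n with _ | k
    · rw [h0]
      exact differentiableOn_const 0
    · rw [show w (k + 1) = _ from funext (hw k)]
      refine DifferentiableOn.fun_const_smul (DifferentiableOn.fun_sub
        ((ih k (Nat.lt_succ_self k)).deriv hU) ?_) ε
      have hi : ∀ i ≤ k, DifferentiableOn ℂ (w i) U := fun i hi => ih i (Nat.lt_succ_of_le hi)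
      unfold quadCoeff
      refine DifferentiableOn.fun_add (DifferentiableOn.fun_add ?_ ?_) (hC k)
      · exact differentiableOn_conv (f := fun n z => conv (evalPairing E (E →L[ℂ] E))
          (fun i => A i z) (fun i => w i z) n)
          (fun i hik => differentiableOn_conv (fun j _ => hA j) fun j hj => hi j (hj.trans hik)) hi
      · exact differentiableOn_conv (fun j _ => hB j) hi

theorem one_add_inv_pow_le (k : ℕ) (hk : k ≠ 0) : (((k : ℝ) + 1) / k) ^ k ≤ 3 := by
  have hk' : (0 : ℝ) < k := by positivity
  have h1 : ((k : ℝ) + 1) / k ≤ Real.exp (1 / k) := by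
    have := Real.add_one_le_exp (1 / (k : ℝ))
    have h2 : ((k : ℝ) + 1) / k = 1 / k + 1 := by field_simp; ring
    rwa [h2]
  calc (((k : ℝ) + 1) / k) ^ k ≤ Real.exp (1 / k) ^ k := by gcongr
    _ = Real.exp 1 := by
      rw [← Real.exp_nat_mul]
      congr 1
      field_simp
    _ ≤ 3 := by linarith [Real.exp_one_lt_d9]

/-- Nagumo-type estimate: the formal solution is Gevrey on every smaller halfstrip. One derivative
costs a factor `3 (k + 1) / (r - ρ)`, by Cauchy's estimate on a circle of radius
`(r - ρ) / (k + 1)`. -/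
theorem norm_formal_quad_le [CompleteSpace E] {θ ε' : ℝ} {z₁ : ℂ} {r : ℝ}
    {A : ℕ → ℂ → E →L[ℂ] E →L[ℂ] E} {B : ℕ → ℂ → E →L[ℂ] E}
    {C : ℕ → ℂ → E} {ε : ℂ} (hε : ‖ε‖ = 1)
    (hA : ∀ k, DifferentiableOn ℂ (A k) (halfstrip θ ε' z₁ r))
    (hB : ∀ k, DifferentiableOn ℂ (B k) (halfstrip θ ε' z₁ r))
    (hC : ∀ k, DifferentiableOn ℂ (C k) (halfstrip θ ε' z₁ r))
    {K M : ℝ} (hK : 0 ≤ K) (hM : 0 ≤ M)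
    (hAK : ∀ k, ∀ z ∈ halfstrip θ ε' z₁ r, ‖A k z‖ ≤ K * gev M k)
    (hBK : ∀ k, ∀ z ∈ halfstrip θ ε' z₁ r, ‖B k z‖ ≤ K * gev M k)
    (hCK : ∀ k, ∀ z ∈ halfstrip θ ε' z₁ r, ‖C k z‖ ≤ K * gev M k)
    {w : ℕ → ℂ → E} (h0 : w 0 = 0) (hw : ∀ k z, w (k + 1) z =
      ε • (deriv (w k) z - quadCoeff (fun i => A i z) (fun i => B i z) (fun i => C i z)
        (fun i => w i z) k)) {N : ℝ} (hN1 : M * r ≤ N) (hN2 : 3 + 13 * K * r ≤ N) (hr : 0 < r)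
    (k : ℕ) : ∀ ρ, 0 ≤ ρ → ρ < r → ∀ z ∈ halfstrip θ ε' z₁ ρ, ‖w k z‖ ≤ gev (N / (r - ρ)) k := by
  have hN : 0 ≤ N := by nlinarith [mul_nonneg hK hr.le]
  have hd := differentiableOn_formal_quad isOpen_halfstrip hA hB hC h0 hw
  induction k using Nat.strong_induction_on with
  | _ n ih =>
    intro ρ hρ0 hρ z hz
    have hτ : 0 < r - ρ := by linarith
    have hNτ : 0 ≤ N / (r - ρ) := by positivity
    rcases n with _ | k
    · simp [h0]
    have hzr : z ∈ halfstrip θ ε' z₁ r := halfstrip_mono hρ.le hz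
    have hMN : M ≤ N / (r - ρ) := by
      rw [le_div_iff₀ hτ]
      nlinarith
    have hg : ∀ i, K * gev M i ≤ K * gev (N / (r - ρ)) i := fun i =>
      mul_le_mul_of_nonneg_left (gev_mono hM hMN i) hK
    have hQ := norm_quadCoeff_le (k := k) (w := fun i => w i z) hNτ
      (fun i => (hAK i z hzr).trans (hg i)) (fun i => (hBK i z hzr).trans (hg i))
      (fun i => (hCK i z hzr).trans (hg i))
      (fun i hi => by rw [one_mul]; exact ih i (Nat.lt_succ_of_le hi) ρ hρ0 hρ z hz)
    -- enlarging the strip by `σ = (r - ρ) / (k + 1)` multiplies the bound for `w k` by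
    -- `((k + 1) / k) ^ k ≤ 3`
    have hder : ‖deriv (w k) z‖ ≤ 3 * (k + 1) / (r - ρ) * gev (N / (r - ρ)) k := by
      rcases eq_or_ne k 0 with rfl | hk
      · rw [h0]
        simp only [Pi.zero_def, deriv_const, norm_zero]
        exact mul_nonneg (by positivity) (gev_nonneg hNτ 0)
      have hk' : (0 : ℝ) < k := by positivity
      set σ := (r - ρ) / (k + 1) with hσ
      have hσ0 : 0 < σ := by positivity
      have hρ' : r - (ρ + σ) = (r - ρ) * (k / (k + 1)) := by
        rw [hσ]; field_simp; ring
      have hρr : ρ + σ < r := by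
        have : 0 < r - (ρ + σ) := by rw [hρ']; positivity
        linarith
      have hcl : Metric.closedBall z σ ⊆ halfstrip θ ε' z₁ (ρ + σ) := fun y hy =>
        mem_halfstrip_of_dist_le hz (Metric.mem_closedBall.1 hy)
      have hcau := Complex.norm_deriv_le_of_forall_mem_sphere_norm_le (f := w k) hσ0
        (C := 3 * gev (N / (r - ρ)) k)
        (DifferentiableOn.diffContOnCl (by
          rw [closure_ball z hσ0.ne']
          exact (hd k).mono (hcl.trans (halfstrip_mono hρr.le))))
        (fun y hy => by
          have h1 := ih k (Nat.lt_succ_self k) (ρ + σ) (by linarith) hρr y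
            (hcl (Metric.sphere_subset_closedBall hy))
          refine h1.trans ?_
          have h2 : N / (r - (ρ + σ)) = (((k : ℝ) + 1) / k) * (N / (r - ρ)) := by
            rw [hρ']; field_simp
          rw [h2, mul_gev]
          exact mul_le_mul_of_nonneg_right (one_add_inv_pow_le k hk) (gev_nonneg hNτ k))
      refine hcau.trans (le_of_eq ?_)
      rw [hσ]
      field_simp
    rw [hw k z, norm_smul, hε, one_mul, gev_succ]
    refine (norm_sub_le _ _).trans ((add_le_add hder hQ).trans ?_)
    rw [← add_mul]
    refine mul_le_mul_of_nonneg_right ?_ (gev_nonneg hNτ k)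
    rw [div_add' _ _ _ hτ.ne', div_mul_eq_mul_div]
    refine div_le_div_of_nonneg_right ?_ hτ.le
    have hk0 : (0 : ℝ) ≤ k := Nat.cast_nonneg k
    have h5 : 13 * K * (r - ρ) ≤ 13 * K * r := by nlinarith [mul_nonneg hK hρ0]
    have h6 : 13 * K * r ≤ 13 * K * r * (k + 1) := by nlinarith [mul_nonneg (mul_nonneg hK hr.le) hk0]
    nlinarith

end Quadratic

/-! ### Bounded solutions of quadratic singularly perturbed equations -/

section Picard

open MeasureTheory

variable {E : Type*} [NormedAddCommGroup E] [NormedSpace ℂ E]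

theorem integrableOn_laplaceRay {ω κ : ℂ} {V D : Set ℂ} {c : ℝ} (hc : 0 < c)
    (hDc : ∀ h ∈ D, h ≠ 0 ∧ c < (ω / h).re)
    (hVκ : ∀ z ∈ V, ∀ t : ℝ, 0 ≤ t → z + t * κ ∈ V)
    {f : ℂ × ℂ → E} (hf : ContinuousOn f (V ×ˢ D)) {B : ℝ} (hB : ∀ x ∈ V ×ˢ D, ‖f x‖ ≤ B)
    {x : ℂ × ℂ} (hx : x ∈ V ×ˢ D) :
    IntegrableOn (fun t : ℝ => Complex.exp (-(t * (ω / x.2))) • f (x.1 + t * κ, x.2)) (Ioi 0) := by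
  refine (integrableOn_const_mul_exp hc B).mono' ?_
    (ae_restrict_of_forall_mem measurableSet_Ioi fun t (ht : 0 < t) =>
      norm_laplaceRay_integrand_le hDc hVκ hB hx ht.le)
  refine ContinuousOn.aestronglyMeasurable ?_ measurableSet_Ioi
  refine ContinuousOn.smul (by fun_prop) ?_
  exact hf.comp (by fun_prop) fun t (ht : 0 < t) => ⟨hVκ _ hx.1 t ht.le, hx.2⟩

theorem norm_laplaceRay_sub_le {ω κ : ℂ} {V D : Set ℂ} {c : ℝ} (hc : 0 < c)
    (hDc : ∀ h ∈ D, h ≠ 0 ∧ c < (ω / h).re)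
    (hVκ : ∀ z ∈ V, ∀ t : ℝ, 0 ≤ t → z + t * κ ∈ V)
    {f g : ℂ × ℂ → E} (hf : ContinuousOn f (V ×ˢ D)) (hg : ContinuousOn g (V ×ˢ D)) {B B' : ℝ}
    (hB : ∀ x ∈ V ×ˢ D, ‖f x‖ ≤ B) (hB' : ∀ x ∈ V ×ˢ D, ‖g x‖ ≤ B) (hfg : ∀ x ∈ V ×ˢ D, ‖f x - g x‖ ≤ B')
    {x : ℂ × ℂ} (hx : x ∈ V ×ˢ D) : ‖laplaceRay ω κ f x - laplaceRay ω κ g x‖ ≤ B' / c := by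
  have h1 := norm_laplaceRay_le hc hDc hVκ (f := fun x => f x - g x) hfg hx
  convert h1 using 2
  unfold laplaceRay
  rw [← integral_sub (integrableOn_laplaceRay hc hDc hVκ hf hB hx)
    (integrableOn_laplaceRay hc hDc hVκ hg hB' hx)]
  simp only [smul_sub]

/-- The quadratic expression `A(w, w) + B w + C`. -/
noncomputable def quadEval (A : E →L[ℂ] E →L[ℂ] E) (B : E →L[ℂ] E) (C w : E) : E := A w w + B w + C

theorem norm_quadEval_le {A : E →L[ℂ] E →L[ℂ] E} {B : E →L[ℂ] E} {C w : E} {K : ℝ}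
    (hA : ‖A‖ ≤ K) (hB : ‖B‖ ≤ K) (hC : ‖C‖ ≤ K) (hw : ‖w‖ ≤ 1) : ‖quadEval A B C w‖ ≤ 3 * K := by
  have hK : 0 ≤ K := (norm_nonneg A).trans hA
  have h1 : ‖A w w‖ ≤ K := (A.le_opNorm₂ w w).trans (by
    have : ‖A‖ * ‖w‖ ≤ K := by nlinarith [norm_nonneg A, norm_nonneg w]
    nlinarith [norm_nonneg w, norm_nonneg A, mul_nonneg (norm_nonneg A) (norm_nonneg w)])
  have h2 : ‖B w‖ ≤ K := (B.le_opNorm w).trans (by nlinarith [norm_nonneg B, norm_nonneg w])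
  unfold quadEval
  refine norm_add₃_le.trans ?_
  linarith

theorem norm_quadEval_sub_le {A : E →L[ℂ] E →L[ℂ] E} {B : E →L[ℂ] E} {C w v : E} {K : ℝ}
    (hA : ‖A‖ ≤ K) (hB : ‖B‖ ≤ K) (hw : ‖w‖ ≤ 1) (hv : ‖v‖ ≤ 1) :
    ‖quadEval A B C w - quadEval A B C v‖ ≤ 3 * K * ‖w - v‖ := by
  have hK : 0 ≤ K := (norm_nonneg A).trans hA
  have h0 : quadEval A B C w - quadEval A B C v = A (w - v) w + A v (w - v) + B (w - v) := by
    unfold quadEval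
    simp only [map_sub, sub_apply]
    abel
  have h1 : ‖A (w - v) w‖ ≤ K * ‖w - v‖ := (A.le_opNorm₂ _ _).trans (by
    calc _ ≤ K * ‖w - v‖ * 1 := by gcongr
      _ = _ := mul_one _)
  have h2 : ‖A v (w - v)‖ ≤ K * ‖w - v‖ := (A.le_opNorm₂ _ _).trans (by
    calc _ ≤ K * 1 * ‖w - v‖ := by gcongr
      _ = _ := by ring)
  have h3 : ‖B (w - v)‖ ≤ K * ‖w - v‖ := (B.le_opNorm _).trans (by gcongr)
  rw [h0]
  refine norm_add₃_le.trans ?_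
  linarith

/-- Picard iteration along the rays `z + κ ℝ₊`: a bounded holomorphic solution of
`∂_z w = (p / κ) w + A(w, w) + B w + C` exists as soon as `Re p` is large. -/
theorem exists_bounded_solution [CompleteSpace E] {ω κ : ℂ} (hκ : ‖κ‖ = 1) {V D : Set ℂ}
    (hV : IsOpen V) (hD : IsOpen D) {c K : ℝ} (hc : 0 < c) (hKc : 6 * K ≤ c)
    (hDc : ∀ h ∈ D, h ≠ 0 ∧ c < (ω / h).re)
    (hVκ : ∀ z ∈ V, ∀ t : ℝ, 0 ≤ t → z + t * κ ∈ V)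
    {A : ℂ × ℂ → E →L[ℂ] E →L[ℂ] E} {B : ℂ × ℂ → E →L[ℂ] E} {C : ℂ × ℂ → E}
    (hA : DifferentiableOn ℂ A (V ×ˢ D)) (hB : DifferentiableOn ℂ B (V ×ˢ D))
    (hC : DifferentiableOn ℂ C (V ×ˢ D)) (hAK : ∀ x ∈ V ×ˢ D, ‖A x‖ ≤ K)
    (hBK : ∀ x ∈ V ×ˢ D, ‖B x‖ ≤ K) (hCK : ∀ x ∈ V ×ˢ D, ‖C x‖ ≤ K) :
    ∃ w : ℂ × ℂ → E, DifferentiableOn ℂ w (V ×ˢ D) ∧ (∀ x ∈ V ×ˢ D, ‖w x‖ ≤ 1) ∧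
      ∀ z ∈ V, ∀ h ∈ D, HasDerivAt (fun z => w (z, h))
        ((ω / h / κ) • w (z, h) + quadEval (A (z, h)) (B (z, h)) (C (z, h)) (w (z, h))) z := by
  have hO : IsOpen (V ×ˢ D) := hV.prod hD
  have hκ0 : κ ≠ 0 := by
    rintro rfl
    simp at hκ
  set Q : (ℂ × ℂ → E) → ℂ × ℂ → E := fun w x => quadEval (A x) (B x) (C x) (w x) with hQ
  set T : (ℂ × ℂ → E) → ℂ × ℂ → E := fun w x => -(κ • laplaceRay ω κ (Q w) x) with hT
  have hQd : ∀ w, DifferentiableOn ℂ w (V ×ˢ D) → DifferentiableOn ℂ (Q w) (V ×ˢ D) := fun w hw =>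
    (((hA.clm_apply hw).clm_apply hw).add (hB.clm_apply hw)).add hC
  have hQb : ∀ w : ℂ × ℂ → E, (∀ x ∈ V ×ˢ D, ‖w x‖ ≤ 1) → ∀ x ∈ V ×ˢ D, ‖Q w x‖ ≤ 3 * K :=
    fun w hw x hx => norm_quadEval_le (hAK x hx) (hBK x hx) (hCK x hx) (hw x hx)
  have hTd : ∀ w, DifferentiableOn ℂ w (V ×ˢ D) → (∀ x ∈ V ×ˢ D, ‖w x‖ ≤ 1) →
      DifferentiableOn ℂ (T w) (V ×ˢ D) := by
    intro w hw hw1 x hx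
    obtain ⟨L, hL, -⟩ := exists_hasFDerivAt_laplaceRay hV hD hc hDc hVκ (hQd w hw) (hQb w hw1) hx
    exact (hL.differentiableAt.const_smul κ).neg.differentiableWithinAt
  have hTb : ∀ w : ℂ × ℂ → E, (∀ x ∈ V ×ˢ D, ‖w x‖ ≤ 1) → ∀ x ∈ V ×ˢ D, ‖T w x‖ ≤ 1 := by
    intro w hw x hx
    have h1 := norm_laplaceRay_le hc hDc hVκ (hQb w hw) hx
    simp only [hT, norm_neg, norm_smul, hκ, one_mul]
    refine h1.trans ((div_le_one hc).2 ?_)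
    linarith
  have hTl : ∀ w v : ℂ × ℂ → E, DifferentiableOn ℂ w (V ×ˢ D) → DifferentiableOn ℂ v (V ×ˢ D) →
      (∀ x ∈ V ×ˢ D, ‖w x‖ ≤ 1) → (∀ x ∈ V ×ˢ D, ‖v x‖ ≤ 1) → ∀ b, 0 ≤ b →
      (∀ x ∈ V ×ˢ D, ‖w x - v x‖ ≤ b) → ∀ x ∈ V ×ˢ D, ‖T w x - T v x‖ ≤ b / 2 := by
    intro w v hw hv hw1 hv1 b hb hwv x hx
    have h1 := norm_laplaceRay_sub_le hc hDc hVκ (hQd w hw).continuousOn (hQd v hv).continuousOn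
      (hQb w hw1) (hQb v hv1) (B' := 3 * K * b) (fun y hy =>
        (norm_quadEval_sub_le (hAK y hy) (hBK y hy) (hw1 y hy) (hv1 y hy)).trans (by
          have := hwv y hy
          have hK : 0 ≤ K := (norm_nonneg (A y)).trans (hAK y hy)
          gcongr)) hx
    have h2 : T w x - T v x = -(κ • (laplaceRay ω κ (Q w) x - laplaceRay ω κ (Q v) x)) := by
      simp only [hT, smul_sub]
      abel
    rw [h2, norm_neg, norm_smul, hκ, one_mul]
    refine h1.trans ?_
    rw [div_le_iff₀ hc]
    nlinarith
  set F : ℕ → ℂ × ℂ → E := fun n => T^[n] 0 with hF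
  have hFs : ∀ n, F (n + 1) = T (F n) := fun n => Function.iterate_succ_apply' T n 0
  have hFp : ∀ n, DifferentiableOn ℂ (F n) (V ×ˢ D) ∧ ∀ x ∈ V ×ˢ D, ‖F n x‖ ≤ 1 := by
    intro n
    induction n with
    | zero => exact ⟨differentiableOn_const 0, fun x _ => by simp [hF]⟩
    | succ n ih =>
      rw [hFs]
      exact ⟨hTd _ ih.1 ih.2, hTb _ ih.2⟩
  have hFdist : ∀ n, ∀ x ∈ V ×ˢ D, ‖F n x - F (n + 1) x‖ ≤ 1 / 2 / 2 ^ n * 2 := by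
    intro n
    induction n with
    | zero =>
      intro x hx
      have := (hFp 1).2 x hx
      have h0 : F 0 x = 0 := by simp [hF]
      rw [h0, zero_sub, norm_neg]
      norm_num
      exact this
    | succ n ih =>
      intro x hx
      have h1 := hTl _ _ (hFp n).1 (hFp (n + 1)).1 (hFp n).2 (hFp (n + 1)).2 _ (by positivity) ih x hx
      rw [← hFs, ← hFs] at h1
      refine h1.trans (le_of_eq ?_)
      rw [pow_succ]
      field_simp
  have hlim : ∀ x ∈ V ×ˢ D, ∃ y, Tendsto (fun n => F n x) atTop (𝓝 y) := fun x hx =>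
    cauchySeq_tendsto_of_complete (cauchySeq_of_le_geometric_two (C := 2) fun n => by
      rw [dist_eq_norm]
      exact (hFdist n x hx).trans (le_of_eq (by ring)))
  choose! w hw using hlim
  have hFw : ∀ n, ∀ x ∈ V ×ˢ D, ‖F n x - w x‖ ≤ 2 / 2 ^ n := by
    intro n x hx
    rw [← dist_eq_norm]
    exact dist_le_of_le_geometric_two_of_tendsto (C := 2) (fun n => by
      rw [dist_eq_norm]
      exact (hFdist n x hx).trans (le_of_eq (by ring))) (hw x hx) n
  have hb0 : Tendsto (fun n : ℕ => (2 : ℝ) / 2 ^ n) atTop (𝓝 0) := by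
    have := (tendsto_pow_atTop_nhds_zero_of_lt_one (r := (1 / 2 : ℝ)) (by norm_num)
      (by norm_num)).const_mul 2
    simp only [one_div, inv_pow, mul_zero] at this
    simpa [div_eq_mul_inv] using this
  have hwd : DifferentiableOn ℂ w (V ×ˢ D) :=
    differentiableOn_of_uniform_limit hO (fun n => (hFp n).1) hb0 hFw
  have hw1 : ∀ x ∈ V ×ˢ D, ‖w x‖ ≤ 1 := fun x hx =>
    le_of_tendsto (hw x hx).norm (Eventually.of_forall fun n => (hFp n).2 x hx)
  have hfix : ∀ x ∈ V ×ˢ D, T w x = w x := by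
    intro x hx
    have h1 : Tendsto (fun n => F (n + 1) x) atTop (𝓝 (w x)) :=
      (hw x hx).comp (tendsto_add_atTop_nat 1)
    have h2 : Tendsto (fun n => F (n + 1) x) atTop (𝓝 (T w x)) := by
      rw [tendsto_iff_norm_sub_tendsto_zero]
      refine squeeze_zero (fun _ => norm_nonneg _) (fun n => ?_) (by simpa using hb0.div_const 2)
      rw [hFs]
      exact hTl _ _ (hFp n).1 hwd (hFp n).2 hw1 _ (by positivity) (hFw n) x hx
    exact tendsto_nhds_unique h2 h1
  refine ⟨w, hwd, hw1, fun z hz h hh => ?_⟩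
  have hx : (z, h) ∈ V ×ˢ D := ⟨hz, hh⟩
  obtain ⟨L, hL, hLκ⟩ := exists_hasFDerivAt_laplaceRay hV hD hc hDc hVκ (hQd w hwd) (hQb w hw1) hx
  have h1 : HasFDerivAt w (-(κ • L)) (z, h) := by
    refine (hL.const_smul κ).neg.congr_of_eventuallyEq ?_
    filter_upwards [hO.mem_nhds hx] with y hy using (hfix y hy).symm
  have hl : HasDerivAt (fun y : ℂ => (y, h)) ((1 : ℂ), (0 : ℂ)) z :=
    (hasDerivAt_id z).prodMk (hasDerivAt_const _ _)
  refine (h1.comp_hasDerivAt z hl).congr_deriv ?_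
  have h2 : L (κ, 0) = κ • L (1, 0) := by
    rw [← map_smul]
    simp
  have h3 : (-(κ • L)) ((1 : ℂ), (0 : ℂ)) = -L (κ, 0) := by
    rw [h2]; rfl
  have h4 : w (z, h) = -(κ • laplaceRay ω κ (Q w) (z, h)) := (hfix _ hx).symm
  rw [h3, hLκ]
  conv_rhs => arg 1; rw [h4, smul_neg, smul_smul, div_mul_cancel₀ _ hκ0]
  simp only [hQ]
  abel

end Picard

/-! ### Gevrey estimates for the exact solutions -/

section GevreyBound

variable {E : Type*} [NormedAddCommGroup E] [NormedSpace ℂ E]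

/-- The remainder of `A(w, w) + B w + C`. Because `w₀ = 0`, the remainder of `w` of top order `n`
enters only with the factor `2 K`; the others are of lower order. -/
theorem norm_rem_quad_le {A : E →L[ℂ] E →L[ℂ] E} {B : E →L[ℂ] E} {C w : E}
    {Ak : ℕ → E →L[ℂ] E →L[ℂ] E} {Bk : ℕ → E →L[ℂ] E} {Ck wk : ℕ → E} {h : ℂ} {n : ℕ}
    {K L T X : ℝ} (hL : 0 ≤ L) (hT : 0 ≤ T)
    (hA : ∀ n, ‖rem A Ak h n‖ ≤ K * gev L n * ‖h‖ ^ n)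
    (hB : ∀ n, ‖rem B Bk h n‖ ≤ K * gev L n * ‖h‖ ^ n)
    (hC : ∀ n, ‖rem C Ck h n‖ ≤ K * gev L n * ‖h‖ ^ n) (hw1 : ‖w‖ ≤ 1) (h0 : wk 0 = 0)
    (hwk : ∀ k, ‖wk k‖ ≤ 1 * gev L k)
    (ih : ∀ i < n, ‖rem w wk h i‖ ≤ T * gev L i * ‖h‖ ^ i) (hX : ‖rem w wk h n‖ ≤ X) :
    ‖rem (quadEval A B C w) (quadCoeff Ak Bk Ck wk) h n‖ ≤
      2 * K * X + (3 * K * T + 13 * K) * (gev L n * ‖h‖ ^ n) := by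
  have hX0 : 0 ≤ X := (norm_nonneg _).trans hX
  have hAK : ‖A‖ ≤ K := by simpa using hA 0
  have hBK : ‖B‖ ≤ K := by simpa using hB 0
  have hK : 0 ≤ K := (norm_nonneg A).trans hAK
  have hAw : ∀ i < n, ‖rem (evalPairing E (E →L[ℂ] E) A w)
      (conv (evalPairing E (E →L[ℂ] E)) Ak wk) h i‖ ≤ (K * T + 3 * K) * gev L i * ‖h‖ ^ i := by
    intro i hi
    refine (norm_rem_conv_le (β := evalPairing E (E →L[ℂ] E))
      (norm_evalPairing_le (E := E) (F := E →L[ℂ] E)) hL hK zero_le_one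
      (fun j _ _ => hA j) (fun j _ => hwk j)).trans ?_
    have h1 : ‖A‖ * ‖rem w wk h i‖ ≤ K * (T * gev L i * ‖h‖ ^ i) :=
      mul_le_mul hAK (ih i hi) (norm_nonneg _) hK
    refine (add_le_add_left h1 _).trans (le_of_eq ?_)
    ring
  have h1 := norm_rem_conv_le (β := evalPairing E E) (norm_evalPairing_le (E := E) (F := E))
    (f := evalPairing E (E →L[ℂ] E) A w) (g := w) (fk := conv (evalPairing E (E →L[ℂ] E)) Ak wk)
    (gk := wk) (n := n) (h := h) hL (C₁ := K * T + 3 * K) (by positivity) zero_le_one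
    (fun i _ hi => hAw i (hi h0)) (fun i _ => hwk i)
  have h2 := norm_rem_conv_le (β := evalPairing E E) (norm_evalPairing_le (E := E) (F := E))
    (f := B) (g := w) (fk := Bk) (gk := wk) (n := n) (h := h) hL hK zero_le_one
    (fun i _ _ => hB i) (fun i _ => hwk i)
  have h3 := hC n
  have hAw0 : ‖evalPairing E (E →L[ℂ] E) A w‖ ≤ K := by
    refine (norm_evalPairing_le A w).trans ?_
    have := mul_le_mul hAK hw1 (norm_nonneg _) hK
    linarith
  have h4 : ‖evalPairing E (E →L[ℂ] E) A w‖ * ‖rem w wk h n‖ ≤ K * X :=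
    mul_le_mul hAw0 hX (norm_nonneg _) hK
  have h5 : ‖B‖ * ‖rem w wk h n‖ ≤ K * X := mul_le_mul hBK hX (norm_nonneg _) hK
  have h6 : rem (quadEval A B C w) (quadCoeff Ak Bk Ck wk) h n =
      rem (evalPairing E E (evalPairing E (E →L[ℂ] E) A w) w)
        (conv (evalPairing E E) (conv (evalPairing E (E →L[ℂ] E)) Ak wk) wk) h n +
      rem (evalPairing E E B w) (conv (evalPairing E E) Bk wk) h n + rem C Ck h n := by
    simp only [rem, quadEval, quadCoeff, evalPairing_apply, smul_add, Finset.sum_add_distrib]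
    abel
  rw [h6]
  refine norm_add₃_le.trans ?_
  linarith

/-- The remainder of order `n + 1` of an exact solution satisfies the linear equation, with a forcing
term that involves only the remainder of order `n` of the nonlinear part. -/
theorem hasDerivAt_rem_succ {ε : ℂ} {h z : ℂ} (hε : ε * ε = 1) (hh : h ≠ 0)
    {w : ℂ → E} {wk : ℕ → ℂ → E} {Q : E} {Qk : ℕ → E} (h0 : wk 0 = 0)
    (hwk : ∀ k, wk (k + 1) z = ε • (deriv (wk k) z - Qk k))
    (hd : ∀ k, DifferentiableAt ℂ (wk k) z) (hw : HasDerivAt w ((ε / h) • w z + Q) z) (n : ℕ) :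
    HasDerivAt (fun z => rem (w z) (fun k => wk k z) h (n + 1))
      ((ε / h) • rem (w z) (fun k => wk k z) h (n + 1) +
        (rem Q Qk h n - h ^ n • deriv (wk n) z)) z := by
  have h1 : HasDerivAt (fun z => rem (w z) (fun k => wk k z) h (n + 1))
      (((ε / h) • w z + Q) - ∑ k ∈ Finset.range (n + 1), h ^ k • deriv (wk k) z) z :=
    hw.sub (HasDerivAt.fun_sum fun k _ => (hd k).hasDerivAt.const_smul (h ^ k))
  refine h1.congr_deriv ?_
  have h2 : (ε / h) • ∑ k ∈ Finset.range (n + 1), h ^ k • wk k z =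
      ∑ k ∈ Finset.range n, h ^ k • (deriv (wk k) z - Qk k) := by
    rw [Finset.sum_range_succ', h0]
    simp only [Pi.zero_apply, smul_zero, add_zero, Finset.smul_sum]
    refine Finset.sum_congr rfl fun k _ => ?_
    rw [hwk k, smul_smul, smul_smul]
    congr 1
    rw [pow_succ]
    field_simp
    linear_combination hε
  simp only [rem, smul_sub, h2]
  rw [Finset.sum_range_succ]
  simp only [Finset.sum_sub_distrib]
  abel

/-- A bounded exact solution inherits the Gevrey estimates of the coefficients of the equation: the
remainder `R_{n+1}(w)` solves the linear equation along the ray with forcing term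
`R_n(A(w, w) + B w + C) - hⁿ w_n'`, whose dependence on `R_n(w)` is absorbed for large `Re p`. -/
theorem norm_rem_solution_le {θ ε : ℝ} (hε : ε = 1 ∨ ε = -1) {V D : Set ℂ} (hV : IsOpen V)
    (hVκ : ∀ z ∈ V, ∀ t : ℝ, 0 ≤ t → z + t * (ε * Complex.exp (θ * Complex.I)) ∈ V)
    {c K L : ℝ} (hK : 0 ≤ K) (hL : 0 ≤ L) (hKc : 25 * K + 1 ≤ c)
    (hDc : ∀ h ∈ D, h ≠ 0 ∧ c < (Complex.exp (θ * Complex.I) / h).re)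
    {A : ℂ → ℂ → E →L[ℂ] E →L[ℂ] E} {B : ℂ → ℂ → E →L[ℂ] E} {C w : ℂ → ℂ → E}
    {Ak : ℕ → ℂ → E →L[ℂ] E →L[ℂ] E} {Bk : ℕ → ℂ → E →L[ℂ] E} {Ck wk : ℕ → ℂ → E}
    (hA : ∀ n, ∀ z ∈ V, ∀ h ∈ D, ‖rem (A z h) (fun k => Ak k z) h n‖ ≤ K * gev L n * ‖h‖ ^ n)
    (hB : ∀ n, ∀ z ∈ V, ∀ h ∈ D, ‖rem (B z h) (fun k => Bk k z) h n‖ ≤ K * gev L n * ‖h‖ ^ n)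
    (hC : ∀ n, ∀ z ∈ V, ∀ h ∈ D, ‖rem (C z h) (fun k => Ck k z) h n‖ ≤ K * gev L n * ‖h‖ ^ n)
    (h0 : wk 0 = 0) (hwk : ∀ k z, wk (k + 1) z = (ε : ℂ) • (deriv (wk k) z -
      quadCoeff (fun i => Ak i z) (fun i => Bk i z) (fun i => Ck i z) (fun i => wk i z) k))
    (hd : ∀ k, DifferentiableOn ℂ (wk k) V) (hwkL : ∀ k, ∀ z ∈ V, ‖wk k z‖ ≤ gev L k)
    (hwkL' : ∀ k, ∀ z ∈ V, ‖deriv (wk k) z‖ ≤ gev L k)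
    (hw1 : ∀ z ∈ V, ∀ h ∈ D, ‖w z h‖ ≤ 1)
    (hw : ∀ z ∈ V, ∀ h ∈ D, HasDerivAt (fun z => w z h) (((ε : ℂ) / h) • w z h +
      quadEval (A z h) (B z h) (C z h) (w z h)) z) (n : ℕ) :
    ∀ z ∈ V, ∀ h ∈ D, ‖rem (w z h) (fun k => wk k z) h n‖ ≤ 4 * gev L n * ‖h‖ ^ n := by
  induction n using Nat.strong_induction_on with
  | _ n ih =>
  intro z₀ hz₀ h hh
  have hh0 := (hDc h hh).1
  have hc : 0 < c := by linarith
  have hεε : (ε : ℂ) * ε = 1 := by rcases hε with rfl | rfl <;> simp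
  have hεn : ‖(ε : ℂ)‖ = 1 := by rcases hε with rfl | rfl <;> simp
  set g : ℝ := gev L n * ‖h‖ ^ n with hg
  have hg0 : 0 ≤ g := mul_nonneg (gev_nonneg hL n) (by positivity)
  have hdiff : ∀ n z, z ∈ V → HasDerivAt (fun z => rem (w z h) (fun k => wk k z) h (n + 1))
      (((ε : ℂ) / h) • rem (w z h) (fun k => wk k z) h (n + 1) +
        (rem (quadEval (A z h) (B z h) (C z h) (w z h)) (quadCoeff (fun i => Ak i z)
          (fun i => Bk i z) (fun i => Ck i z) (fun i => wk i z)) h n - h ^ n • deriv (wk n) z)) z :=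
    fun n z hz => hasDerivAt_rem_succ hεε hh0 h0 (fun k => hwk k z)
      (fun k => (hd k).differentiableAt (hV.mem_nhds hz)) (hw z hz h hh) n
  -- any bound `X` for the remainder improves to `X / 2 + 2 g`
  have himp : ∀ X, (∀ z ∈ V, ‖rem (w z h) (fun k => wk k z) h n‖ ≤ X) →
      ∀ z ∈ V, ‖rem (w z h) (fun k => wk k z) h n‖ ≤ X / 2 + 2 * g := by
    intro X hX z hz
    have hX0 : 0 ≤ X := (norm_nonneg _).trans (hX z hz)
    set κ : ℂ := ε * Complex.exp (θ * Complex.I) with hκ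
    have hκn : ‖κ‖ = 1 := by rw [hκ, norm_mul, hεn, norm_exp_mul_I, one_mul]
    have hray : ‖rem (w z h) (fun k => wk k z) h (n + 1)‖ ≤
        (2 * K * X + (15 * K + 10 * K + 1) * g) / (Complex.exp (θ * Complex.I) / h).re := by
      have := norm_le_of_ray_ode (u := fun t : ℝ => rem (w (z + t * κ) h)
        (fun k => wk k (z + t * κ)) h (n + 1)) (p := Complex.exp (θ * Complex.I) / h)
        (r := fun t : ℝ => κ • (rem (quadEval (A (z + t * κ) h) (B (z + t * κ) h) (C (z + t * κ) h)
          (w (z + t * κ) h)) (quadCoeff (fun i => Ak i (z + t * κ)) (fun i => Bk i (z + t * κ))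
          (fun i => Ck i (z + t * κ)) (fun i => wk i (z + t * κ))) h n -
          h ^ n • deriv (wk n) (z + t * κ)))
        (B := 1 + ∑ k ∈ Finset.range (n + 1), ‖h‖ ^ k * gev L k)
        (R := 2 * K * X + (15 * K + 10 * K + 1) * g)
        (hc.trans (hDc h hh).2) (fun t ht => ?_) (fun t ht => ?_) (fun t ht => ?_)
      · simpa using this
      · have h1 := hdiff n _ (hVκ z hz t ht)
        have hl : HasDerivAt (fun s : ℝ => z + s * κ) κ t := by
          simpa using ((hasDerivAt_id t).ofReal_comp.mul_const κ).const_add z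
        refine (HasDerivAt.scomp t h1 hl).congr_deriv ?_
        rw [smul_add, smul_smul]
        congr 2
        rw [hκ]
        field_simp
        linear_combination hεε
      · refine (norm_sub_le _ _).trans (add_le_add (hw1 _ (hVκ z hz t ht) h hh) ?_)
        refine norm_sum_le_of_le _ fun k _ => ?_
        rw [norm_smul, norm_pow]
        exact mul_le_mul_of_nonneg_left (hwkL k _ (hVκ z hz t ht)) (by positivity)
      · have hzt := hVκ z hz t ht
        rw [norm_smul, hκn, one_mul]
        have h1 := norm_rem_quad_le (T := 4) (X := X) (n := n) (K := K) hL (by norm_num)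
          (fun n => hA n _ hzt h hh) (fun n => hB n _ hzt h hh) (fun n => hC n _ hzt h hh)
          (hw1 _ hzt h hh) (congrFun h0 _) (fun k => by rw [one_mul]; exact hwkL k _ hzt)
          (fun i hi => ih i hi _ hzt h hh) (hX _ hzt)
        have h2 : ‖h ^ n • deriv (wk n) (z + t * κ)‖ ≤ g := by
          rw [norm_smul, norm_pow, hg, mul_comm]
          exact mul_le_mul_of_nonneg_right (hwkL' n _ hzt) (by positivity)
        refine (norm_sub_le _ _).trans ((add_le_add h1 h2).trans (le_of_eq ?_))
        ring
    have hray' : ‖rem (w z h) (fun k => wk k z) h (n + 1)‖ ≤ X / 2 + g := by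
      refine hray.trans ((div_le_iff₀ (hc.trans (hDc h hh).2)).2 ?_)
      have h1 : 25 * K + 1 ≤ (Complex.exp (θ * Complex.I) / h).re := hKc.trans (hDc h hh).2.le
      have h2 : (25 * K + 1) * (X / 2 + g) ≤
        (Complex.exp (θ * Complex.I) / h).re * (X / 2 + g) := by gcongr
      nlinarith [mul_nonneg hK hX0]
    have h3 : rem (w z h) (fun k => wk k z) h n =
        rem (w z h) (fun k => wk k z) h (n + 1) + h ^ n • wk n z := by rw [rem_succ]; abel
    rw [h3]
    refine (norm_add_le _ _).trans ?_
    have h4 : ‖h ^ n • wk n z‖ ≤ g := by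
      rw [norm_smul, norm_pow, hg, mul_comm]
      exact mul_le_mul_of_nonneg_right (hwkL n z hz) (by positivity)
    linarith
  -- for fixed `h` the remainder is bounded in `z`, so its supremum `X` satisfies `X ≤ X / 2 + 2 g`
  have hbdd : BddAbove ((fun z => ‖rem (w z h) (fun k => wk k z) h n‖) '' V) := by
    refine ⟨1 + ∑ k ∈ Finset.range n, ‖h‖ ^ k * gev L k, ?_⟩
    rintro _ ⟨z, hz, rfl⟩
    refine (norm_sub_le _ _).trans (add_le_add (hw1 _ hz h hh) ?_)
    refine norm_sum_le_of_le _ fun k _ => ?_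
    rw [norm_smul, norm_pow]
    exact mul_le_mul_of_nonneg_left (hwkL k _ hz) (by positivity)
  set X := sSup ((fun z => ‖rem (w z h) (fun k => wk k z) h n‖) '' V) with hX
  have hle : ∀ z ∈ V, ‖rem (w z h) (fun k => wk k z) h n‖ ≤ X := fun z hz =>
    le_csSup hbdd ⟨z, hz, rfl⟩
  have hX4 : X ≤ X / 2 + 2 * g := csSup_le ⟨_, z₀, hz₀, rfl⟩ (by
    rintro _ ⟨z, hz, rfl⟩
    exact himp X hle z hz)
  have := hle z₀ hz₀
  calc _ ≤ X := this
    _ ≤ 4 * g := by linarith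
    _ = _ := by rw [hg]; ring

/-- Exact solutions of `h ∂_z w = ε w + h (A(w, w) + B w + C)` with uniform Gevrey asymptotics on
a smaller halfstrip and a smaller Borel disc. -/
theorem exists_gevrey_solution [CompleteSpace E] {θ ε : ℝ} (hε : ε = 1 ∨ ε = -1) {z₁ : ℂ}
    {r r' d : ℝ} (hr' : 0 < r') (hr : r' < r) (hd : 0 < d)
    {A : ℂ → ℂ → E →L[ℂ] E →L[ℂ] E} {B : ℂ → ℂ → E →L[ℂ] E} {C : ℂ → ℂ → E}
    {Ak : ℕ → ℂ → E →L[ℂ] E →L[ℂ] E} {Bk : ℕ → ℂ → E →L[ℂ] E} {Ck : ℕ → ℂ → E}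
    (hA : IsGevrey (halfstrip θ ε z₁ r) (borelDisc θ d) A Ak)
    (hB : IsGevrey (halfstrip θ ε z₁ r) (borelDisc θ d) B Bk)
    (hC : IsGevrey (halfstrip θ ε z₁ r) (borelDisc θ d) C Ck) :
    ∃ d', 0 < d' ∧ d' ≤ d ∧ ∃ (w : ℂ → ℂ → E) (wk : ℕ → ℂ → E),
      IsGevrey (halfstrip θ ε z₁ r') (borelDisc θ d') w wk ∧ wk 0 = 0 ∧
      ∀ z ∈ halfstrip θ ε z₁ r', ∀ h ∈ borelDisc θ d', HasDerivAt (fun z => w z h)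
        (((ε : ℂ) / h) • w z h + quadEval (A z h) (B z h) (C z h) (w z h)) z := by
  have hεn : ‖(ε : ℂ)‖ = 1 := by rcases hε with rfl | rfl <;> simp
  have hεε : (ε : ℂ) * ε = 1 := by rcases hε with rfl | rfl <;> simp
  obtain ⟨CA, MA, hCA, hMA, hAr, hAc⟩ := hA.exists_bounds hd
  obtain ⟨CB, MB, hCB, hMB, hBr, hBc⟩ := hB.exists_bounds hd
  obtain ⟨CC, MC, hCC, hMC, hCr, hCc⟩ := hC.exists_bounds hd
  set K := CA + CB + CC with hK
  set M := MA + MB + MC with hM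
  have hK0 : 0 < K := by positivity
  have hM0 : 0 < M := by positivity
  have hup : ∀ {c m : ℝ} (k : ℕ), 0 < c → 0 < m → c ≤ K → m ≤ M → c * gev m k ≤ K * gev M k :=
    fun k hc hm hcK hmM => mul_le_mul hcK (gev_mono hm.le hmM k) (gev_nonneg hm.le k) hK0.le
  obtain ⟨wk, h0, hwk⟩ := exists_formal_quad Ak Bk Ck (ε : ℂ)
  -- `N` is as needed for `norm_formal_quad_le`
  set N := M * r + (3 + 13 * K * r) with hN
  have hr0 : 0 < r := hr'.trans hr
  have hN0 : 0 ≤ N := by positivity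
  set r₂ := (r' + r) / 2 with hr₂
  have hform := norm_formal_quad_le (N := N) hεn hA.coeff_holo hB.coeff_holo hC.coeff_holo hK0.le
    hM0.le (fun k z hz => (hAc k z hz).trans (hup k hCA hMA (by linarith) (by linarith)))
    (fun k z hz => (hBc k z hz).trans (hup k hCB hMB (by linarith) (by linarith)))
    (fun k z hz => (hCc k z hz).trans (hup k hCC hMC (by linarith) (by linarith))) h0 hwk
    (by rw [hN]; nlinarith [mul_pos hK0 hr0]) (by rw [hN]; nlinarith [mul_pos hM0 hr0]) hr0
  have hwd := differentiableOn_formal_quad isOpen_halfstrip hA.coeff_holo hB.coeff_holo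
    hC.coeff_holo h0 hwk
  set L₀ := M + N / (r - r₂) with hL₀
  have hr₂r : 0 < r - r₂ := by rw [hr₂]; linarith
  have hL₀N : N / (r - r₂) ≤ L₀ := by linarith
  have hL₀0 : 0 ≤ L₀ := by positivity
  set σ := r₂ - r' with hσ
  have hσ0 : 0 < σ := by rw [hσ, hr₂]; linarith
  -- the factor `1 / σ` in the bound for `w_k'` is absorbed for `k ≥ 1`; `w₀' = 0`
  set L := L₀ * (1 + 1 / σ) with hL
  have hL0 : 0 ≤ L := by positivity
  have hLL₀ : L₀ ≤ L := by
    rw [hL]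
    have : 0 ≤ 1 / σ := by positivity
    nlinarith
  have hwk₂ : ∀ k, ∀ z ∈ halfstrip θ ε z₁ r₂, ‖wk k z‖ ≤ gev L₀ k := fun k z hz =>
    (hform k r₂ (by rw [hr₂]; linarith) (by linarith) z hz).trans
      (gev_mono (by positivity) hL₀N k)
  have hsub : halfstrip θ ε z₁ r' ⊆ halfstrip θ ε z₁ r₂ := halfstrip_mono (by rw [hr₂]; linarith)
  have hsub' : halfstrip θ ε z₁ r' ⊆ halfstrip θ ε z₁ r := halfstrip_mono hr.le
  have hwkL : ∀ k, ∀ z ∈ halfstrip θ ε z₁ r', ‖wk k z‖ ≤ gev L k := fun k z hz =>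
    (hwk₂ k z (hsub hz)).trans (gev_mono hL₀0 hLL₀ k)
  have hwkL' : ∀ k, ∀ z ∈ halfstrip θ ε z₁ r', ‖deriv (wk k) z‖ ≤ gev L k := by
    intro k z hz
    rcases k with _ | k
    · rw [h0]
      simp [Pi.zero_def]
    have hcl : Metric.closedBall z σ ⊆ halfstrip θ ε z₁ r₂ := fun y hy => by
      have := mem_halfstrip_of_dist_le hz (Metric.mem_closedBall.1 hy)
      rwa [hσ, add_sub_cancel] at this
    have hcau := Complex.norm_deriv_le_of_forall_mem_sphere_norm_le (f := wk (k + 1)) hσ0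
      (DifferentiableOn.diffContOnCl (by
        rw [closure_ball z hσ0.ne']
        exact (hwd (k + 1)).mono (hcl.trans (halfstrip_mono (by linarith)))))
      (fun y hy => hwk₂ (k + 1) y (hcl (Metric.sphere_subset_closedBall hy)))
    refine hcau.trans ?_
    rw [hL, mul_comm L₀, mul_gev, div_eq_mul_one_div, mul_comm]
    refine mul_le_mul_of_nonneg_right ?_ (gev_nonneg hL₀0 _)
    have h1 : 1 ≤ 1 + 1 / σ := by
      have : 0 ≤ 1 / σ := by positivity
      linarith
    have h2 := le_self_pow₀ h1 (Nat.succ_ne_zero k)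
    exact le_trans (by linarith) h2
  -- on this Borel disc `25 K + 1 < Re p`, as required by `norm_rem_solution_le`
  set d' := min d (1 / (25 * K + 1)) with hd'
  have hd'0 : 0 < d' := lt_min hd (by positivity)
  have hKd : 25 * K + 1 ≤ 1 / d' := by
    rw [le_div_iff₀ hd'0]
    have := min_le_right d (1 / (25 * K + 1))
    rw [le_div_iff₀ (by positivity)] at this
    linarith
  have hDsub : borelDisc θ d' ⊆ borelDisc θ d := borelDisc_mono hd'0 (min_le_left _ _)
  have hDc : ∀ h ∈ borelDisc θ d', h ≠ 0 ∧ 1 / d' < (Complex.exp (θ * Complex.I) / h).re :=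
    fun h hh => hh
  have hrem : ∀ {F : Type _} [NormedAddCommGroup F] [NormedSpace ℂ F] {f : ℂ → ℂ → F}
      {fk : ℕ → ℂ → F} {c m : ℝ}, 0 < c → 0 < m → c ≤ K → m ≤ M →
      (∀ n, ∀ z ∈ halfstrip θ ε z₁ r, ∀ h ∈ borelDisc θ d,
        ‖rem (f z h) (fun k => fk k z) h n‖ ≤ c * gev m n * ‖h‖ ^ n) →
      ∀ n, ∀ z ∈ halfstrip θ ε z₁ r', ∀ h ∈ borelDisc θ d',
        ‖rem (f z h) (fun k => fk k z) h n‖ ≤ K * gev L n * ‖h‖ ^ n := by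
    intro F _ _ f fk c m hc hm hcK hmM hf n z hz h hh
    refine (hf n z (hsub' hz) h (hDsub hh)).trans ?_
    refine mul_le_mul_of_nonneg_right ?_ (by positivity)
    refine (hup n hc hm hcK hmM).trans (mul_le_mul_of_nonneg_left (gev_mono hM0.le ?_ n) hK0.le)
    refine le_trans ?_ hLL₀
    rw [hL₀]
    have : 0 ≤ N / (r - r₂) := by positivity
    linarith
  have hAL := hrem hCA hMA (by linarith) (by linarith) hAr
  have hBL := hrem hCB hMB (by linarith) (by linarith) hBr
  have hCL := hrem hCC hMC (by linarith) (by linarith) hCr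
  have hVκ : ∀ z ∈ halfstrip θ ε z₁ r', ∀ t : ℝ, 0 ≤ t →
      z + t * (ε * Complex.exp (θ * Complex.I)) ∈ halfstrip θ ε z₁ r' := fun z hz t ht =>
    add_mem_halfstrip hz ht
  have hprod := prod_mono hsub' hDsub
  obtain ⟨w, hwdiff, hw1, hwode⟩ := exists_bounded_solution (E := E)
    (ω := Complex.exp (θ * Complex.I)) (κ := ε * Complex.exp (θ * Complex.I)) (K := K)
    (by rw [norm_mul, hεn, norm_exp_mul_I, one_mul])
    isOpen_halfstrip isOpen_borelDisc (by positivity) (by linarith) hDc hVκ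
    (hA.holo.mono hprod) (hB.holo.mono hprod) (hC.holo.mono hprod)
    (fun x hx => by simpa [Function.uncurry] using hAL 0 x.1 hx.1 x.2 hx.2)
    (fun x hx => by simpa [Function.uncurry] using hBL 0 x.1 hx.1 x.2 hx.2)
    (fun x hx => by simpa [Function.uncurry] using hCL 0 x.1 hx.1 x.2 hx.2)
  have hode : ∀ z ∈ halfstrip θ ε z₁ r', ∀ h ∈ borelDisc θ d', HasDerivAt (fun z => w (z, h))
        (((ε : ℂ) / h) • w (z, h) + quadEval (A z h) (B z h) (C z h) (w (z, h))) z := by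
    intro z hz h hh
    refine (hwode z hz h hh).congr_deriv ?_
    have hε0 : (ε : ℂ) ≠ 0 := left_ne_zero_of_mul_eq_one hεε
    have hh0 := hh.1
    have : Complex.exp (θ * Complex.I) / h / (ε * Complex.exp (θ * Complex.I)) = ε / h := by
      have := Complex.exp_ne_zero (θ * Complex.I)
      field_simp
      linear_combination -hεε
    rw [this]
    rfl
  refine ⟨d', hd'0, min_le_left _ _, fun z h => w (z, h), wk, ⟨hwdiff, fun k => (hwd k).mono hsub',
    4, L + 1, by norm_num, by positivity, fun n z hz h hh => ?_⟩, h0, hode⟩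
  refine (norm_rem_solution_le hε isOpen_halfstrip hVκ hK0.le hL0 hKd hDc hAL hBL hCL h0 hwk
    (fun k => (hwd k).mono hsub') hwkL hwkL' (fun z hz h hh => hw1 (z, h) ⟨hz, hh⟩) hode n z hz h
      hh).trans ?_
  have := gev_mono hL0 (by linarith : L ≤ L + 1) n
  gcongr

end GevreyBound

/-! ### Algebra of Gevrey expansions and of invariant graphs -/

section HasGevrey

variable {E F G : Type*} [NormedAddCommGroup E] [NormedSpace ℂ E] [NormedAddCommGroup F]
  [NormedSpace ℂ F] [NormedAddCommGroup G] [NormedSpace ℂ G] {U : Set ℂ} {θ d : ℝ}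

/-- A bounded holomorphic function of `z` alone is its own Gevrey expansion. -/
theorem isGevrey_const {D : Set ℂ} {g : ℂ → E} (hg : DifferentiableOn ℂ g U)
    {K : ℝ} (hK : ∀ z ∈ U, ‖g z‖ ≤ K) :
    IsGevrey U D (fun z _ => g z) (fun k => if k = 0 then g else 0) := by
  refine ⟨hg.comp differentiableOn_fst fun x hx => hx.1, fun k => ?_, |K| + 1, 1, by positivity,
    one_pos, fun n z hz h _ => ?_⟩
  · split_ifs
    · exact hg
    · exact differentiableOn_const 0
  rcases n with _ | n
  · simp only [rem_zero, gev_zero, pow_zero, mul_one]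
    linarith [hK z hz, le_abs_self K]
  · have : rem (g z) (fun k => (if k = 0 then g else 0) z) h (n + 1) = 0 := by
      simp [rem, Finset.sum_range_succ']
    rw [this, norm_zero]
    have := gev_nonneg (zero_le_one (α := ℝ)) (n + 1)
    positivity

theorem IsGevrey.add {D : Set ℂ} {f g : ℂ → ℂ → E} {fk gk : ℕ → ℂ → E} (hf : IsGevrey U D f fk)
    (hg : IsGevrey U D g gk) :
    IsGevrey U D (fun z h => f z h + g z h) (fun k z => fk k z + gk k z) := by
  obtain ⟨C, M, hC, hM, hb⟩ := hf.bound
  obtain ⟨C', M', hC', hM', hb'⟩ := hg.bound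
  refine ⟨hf.holo.add hg.holo, fun k => (hf.coeff_holo k).add (hg.coeff_holo k), C + C', M + M',
    by positivity, by positivity, fun n z hz h hh => ?_⟩
  have h1 : rem (f z h + g z h) (fun k => fk k z + gk k z) h n =
      rem (f z h) (fun k => fk k z) h n + rem (g z h) (fun k => gk k z) h n := by
    simp only [rem, smul_add, Finset.sum_add_distrib]
    abel
  rw [h1]
  refine (norm_add_le _ _).trans ((add_le_add (hb n z hz h hh) (hb' n z hz h hh)).trans ?_)
  rw [add_mul, add_mul]
  have h2 := gev_mono hM.le (by linarith : M ≤ M + M') n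
  have h3 := gev_mono hM'.le (by linarith : M' ≤ M + M') n
  gcongr

theorem IsGevrey.clm {D : Set ℂ} {f : ℂ → ℂ → E} {fk : ℕ → ℂ → E} (hf : IsGevrey U D f fk)
    (L : E →L[ℂ] F) : IsGevrey U D (fun z h => L (f z h)) (fun k z => L (fk k z)) := by
  obtain ⟨C, M, hC, hM, hb⟩ := hf.bound
  refine ⟨L.differentiable.comp_differentiableOn hf.holo,
    fun k => L.differentiable.comp_differentiableOn (hf.coeff_holo k), (‖L‖ + 1) * C, M,
    by positivity, hM, fun n z hz h hh => ?_⟩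
  have h1 : rem (L (f z h)) (fun k => L (fk k z)) h n = L (rem (f z h) (fun k => fk k z) h n) := by
    simp only [rem, map_sub, map_sum, map_smul]
  rw [h1]
  refine (L.le_opNorm _).trans ?_
  calc ‖L‖ * ‖rem (f z h) (fun k => fk k z) h n‖ ≤ (‖L‖ + 1) * (C * gev M n * ‖h‖ ^ n) :=
        mul_le_mul (by linarith) (hb n z hz h hh) (norm_nonneg _) (by positivity)
    _ = _ := by ring

theorem IsGevrey.neg {D : Set ℂ} {f : ℂ → ℂ → E} {fk : ℕ → ℂ → E} (hf : IsGevrey U D f fk) :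
    IsGevrey U D (fun z h => -f z h) (fun k z => -fk k z) :=
  hf.clm (-ContinuousLinearMap.id ℂ E)

theorem IsGevrey.sub {D : Set ℂ} {f g : ℂ → ℂ → E} {fk gk : ℕ → ℂ → E} (hf : IsGevrey U D f fk)
    (hg : IsGevrey U D g gk) :
    IsGevrey U D (fun z h => f z h - g z h) (fun k z => fk k z + -gk k z) := by
  simpa only [sub_eq_add_neg] using hf.add hg.neg

/-- Gevrey expansions can be multiplied along a bilinear map. -/
theorem IsGevrey.bilin (hd : 0 < d) {f : ℂ → ℂ → E} {fk : ℕ → ℂ → E} {g : ℂ → ℂ → F}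
    {gk : ℕ → ℂ → F} (hf : IsGevrey U (borelDisc θ d) f fk) (hg : IsGevrey U (borelDisc θ d) g gk)
    (β : E →L[ℂ] F →L[ℂ] G) (hβ : ∀ x y, ‖β x y‖ ≤ ‖x‖ * ‖y‖) :
    IsGevrey U (borelDisc θ d) (fun z h => β (f z h) (g z h))
      (fun n z => conv β (fun k => fk k z) (fun k => gk k z) n) := by
  obtain ⟨C, M, hC, hM, hb⟩ := hf.bound
  obtain ⟨C', M', hC', hM', hb', hc'⟩ := hg.exists_bounds hd
  refine ⟨(β.differentiable.comp_differentiableOn hf.holo).clm_apply hg.holo,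
    fun n => differentiableOn_conv (fun i _ => hf.coeff_holo i) fun i _ => hg.coeff_holo i,
    4 * C * C', M + M', by positivity, by positivity, fun n z hz h hh => ?_⟩
  have hM2 : ∀ n, gev M n ≤ gev (M + M') n := fun n => gev_mono hM.le (by linarith) n
  have hM2' : ∀ n, gev M' n ≤ gev (M + M') n := fun n => gev_mono hM'.le (by linarith) n
  have h1 := norm_rem_conv_le hβ (f := f z h) (g := g z h) (fk := fun k => fk k z)
    (gk := fun k => gk k z) (h := h) (n := n) (M := M + M') (by positivity) hC.le hC'.le
    (fun i _ _ => (hb i z hz h hh).trans (by have := hM2 i; gcongr))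
    (fun i _ => (hc' i z hz).trans (by have := hM2' i; gcongr))
  have h2 : ‖f z h‖ ≤ C := by simpa using hb 0 z hz h hh
  have h3 : ‖rem (g z h) (fun k => gk k z) h n‖ ≤ C' * gev (M + M') n * ‖h‖ ^ n :=
    (hb' n z hz h hh).trans (by have := hM2' n; gcongr)
  have h4 := mul_le_mul h2 h3 (norm_nonneg _) hC.le
  refine h1.trans ?_
  linarith

theorem IsGevrey.mul {𝔄 : Type*} [NormedRing 𝔄] [NormedAlgebra ℂ 𝔄] (hd : 0 < d)
    {f g : ℂ → ℂ → 𝔄} {fk gk : ℕ → ℂ → 𝔄} (hf : IsGevrey U (borelDisc θ d) f fk)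
    (hg : IsGevrey U (borelDisc θ d) g gk) :
    IsGevrey U (borelDisc θ d) (fun z h => f z h * g z h)
      (fun n z => conv (ContinuousLinearMap.mul ℂ 𝔄) (fun k => fk k z) (fun k => gk k z) n) :=
  hf.bilin hd hg (ContinuousLinearMap.mul ℂ 𝔄) fun x y => norm_mul_le x y

end HasGevrey

section GraphAlgebra

variable {R : Type*} [Ring R]

/-- The nonlinearity in the equation of a graph `Y = P + w` over the range of a projection `P`,
invariant under the connection `h ∂_z - M`; here `P'` is the derivative of `P` and `N` the
perturbation of `M`. -/
def graphNonlinearity (P P' N w : R) : R :=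
  (P + w) * P' * (1 - P - w) - P' + (1 - P - w) * N * (P + w)

/-- The derivative of a projection has no diagonal block on the range: the hypotheses are
`P² = P` and its derivative. -/
theorem mul_deriv_mul_eq_zero {P P' : R} (hP : P * P = P) (hP' : P' * P + P * P' = P') :
    P * P' * P = 0 := by
  have := congrArg (· * P) hP'
  simp only [add_mul, mul_assoc, hP] at this
  rw [mul_assoc]
  exact left_eq_add.1 this.symm

/-- The defect `P w` of the graph condition satisfies a linear homogeneous equation. -/
theorem graph_left_identity {P P' N w : R} (hP : P * P = P) (hP' : P' * P + P * P' = P') :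
    P' * w + P * graphNonlinearity P P' N w =
      P' * (P * w) + (P * w) * (P' * (1 - P - w) - N * (P + w)) := by
  have h0 := mul_deriv_mul_eq_zero hP hP'
  have h1 : P' * w + P * graphNonlinearity P P' N w =
      (P' - (P' * P + P * P')) * w + (P' * P * w) + P * P' * w +
      ((P * P + P * w) * P' * (1 - P - w) - P * P' + (P - P * P - P * w) * N * (P + w)) := by
    unfold graphNonlinearity
    noncomm_ring
  rw [h1, hP, hP']
  have h2 : (P' - P') * w + P' * P * w + P * P' * w + ((P + P * w) * P' * (1 - P - w) - P * P' +
      (P - P - P * w) * N * (P + w)) = P' * (P * w) + P * w * (P' * (1 - P - w) - N * (P + w))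
      - P * P' * P := by
    noncomm_ring
  rw [h2, h0, sub_zero]

/-- The defect `w (1 - P)` of the graph condition satisfies a linear homogeneous equation. -/
theorem graph_right_identity {P P' N w : R} (hP : P * P = P) (hP' : P' * P + P * P' = P') :
    graphNonlinearity P P' N w * (1 - P) - w * P' =
      -(w * (1 - P) * P') + (-((P + w) * P') + (1 - P - w) * N) * (w * (1 - P)) := by
  have h1 : graphNonlinearity P P' N w * (1 - P) - w * P' =
      (P + w) * (P' - P' * P) * (1 - P) - (P' - P' * P)
      - (P + w) * P' * (w * (1 - P)) + (1 - P - w) * N * (P - P * P + w * (1 - P)) - w * P' := by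
    unfold graphNonlinearity
    noncomm_ring
  have h2 : P' - P' * P = P * P' := by
    nth_rewrite 1 [← hP']
    abel
  have h3 : P * P' * (1 - P) = P * P' := by
    have := mul_deriv_mul_eq_zero hP hP'
    rw [mul_sub, this]
    simp
  have h4 : (P + w) * (P * P') * (1 - P) = P * P' + w * (P * P') := by
    rw [mul_assoc, h3, add_mul, ← mul_assoc P P P', hP]
  rw [h1, h2, h4, hP]
  noncomm_ring

end GraphAlgebra

section Graph

variable {𝔄 : Type*} [NormedRing 𝔄] [NormedAlgebra ℂ 𝔄]

/-- On halfstrips, a bounded solution of a linear homogeneous equation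
`∂_z f = (ε / h) f + O(f)` vanishes when `Re p` is large. -/
theorem eq_zero_of_ray_ode {E : Type*} [NormedAddCommGroup E] [NormedSpace ℂ E] {θ ε : ℝ}
    (hε : ε = 1 ∨ ε = -1) {V : Set ℂ}
    (hVκ : ∀ z ∈ V, ∀ t : ℝ, 0 ≤ t → z + t * (ε * Complex.exp (θ * Complex.I)) ∈ V)
    {h : ℂ} {c : ℝ} (hc : 0 ≤ c) (hh0 : h ≠ 0)
    (hh : c < (Complex.exp (θ * Complex.I) / h).re) {f r : ℂ → E}
    (hf : ∀ z ∈ V, HasDerivAt f (((ε : ℂ) / h) • f z + r z) z) {B : ℝ} (hB : ∀ z ∈ V, ‖f z‖ ≤ B)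
    (hr : ∀ z ∈ V, ‖r z‖ ≤ c * ‖f z‖) : ∀ z ∈ V, f z = 0 := by
  intro z₀ hz₀
  have hεε : (ε : ℂ) * ε = 1 := by rcases hε with rfl | rfl <;> simp
  have hεn : ‖(ε : ℂ)‖ = 1 := by rcases hε with rfl | rfl <;> simp
  have hp : 0 < (Complex.exp (θ * Complex.I) / h).re := hc.trans_lt hh
  have himp : ∀ X, (∀ z ∈ V, ‖f z‖ ≤ X) → ∀ z ∈ V,
      ‖f z‖ ≤ c * X / (Complex.exp (θ * Complex.I) / h).re := by
    intro X hX z hz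
    set κ : ℂ := ε * Complex.exp (θ * Complex.I) with hκ
    have hκn : ‖κ‖ = 1 := by rw [hκ, norm_mul, hεn, norm_exp_mul_I, one_mul]
    have := norm_le_of_ray_ode (u := fun t : ℝ => f (z + t * κ))
      (p := Complex.exp (θ * Complex.I) / h) (r := fun t : ℝ => κ • r (z + t * κ)) (B := B)
      (R := c * X) hp (fun t ht => ?_) (fun t ht => hB _ (hVκ z hz t ht)) (fun t ht => ?_)
    · simpa using this
    · have hl : HasDerivAt (fun s : ℝ => z + s * κ) κ t := by
        simpa using ((hasDerivAt_id t).ofReal_comp.mul_const κ).const_add z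
      refine (HasDerivAt.scomp t (hf _ (hVκ z hz t ht)) hl).congr_deriv ?_
      rw [smul_add, smul_smul]
      congr 2
      rw [hκ]
      field_simp
      linear_combination hεε
    · rw [norm_smul, hκn, one_mul]
      exact (hr _ (hVκ z hz t ht)).trans (mul_le_mul_of_nonneg_left (hX _ (hVκ z hz t ht)) hc)
  -- the supremum `X` of `‖f‖` satisfies `X ≤ (c / Re p) X` with `c / Re p < 1`
  have hbdd : BddAbove ((fun z => ‖f z‖) '' V) := ⟨B, by
    rintro _ ⟨z, hz, rfl⟩
    exact hB z hz⟩
  set X := sSup ((fun z => ‖f z‖) '' V) with hX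
  have hle : ∀ z ∈ V, ‖f z‖ ≤ X := fun z hz => le_csSup hbdd ⟨z, hz, rfl⟩
  have hX0 : 0 ≤ X := (norm_nonneg _).trans (hle z₀ hz₀)
  have hX' : X ≤ c * X / (Complex.exp (θ * Complex.I) / h).re := csSup_le ⟨_, z₀, hz₀, rfl⟩ (by
    rintro _ ⟨z, hz, rfl⟩
    exact himp X hle z hz)
  rw [le_div_iff₀ hp] at hX'
  have h0 : X = 0 := by nlinarith
  have := hle z₀ hz₀
  rw [h0] at this
  exact norm_le_zero_iff.1 this

/-- The trilinear product `(X, u, v) ↦ u X v`. -/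
noncomputable def sandwich (𝔄 : Type*) [NormedRing 𝔄] [NormedAlgebra ℂ 𝔄] :
    𝔄 →L[ℂ] 𝔄 →L[ℂ] 𝔄 →L[ℂ] 𝔄 :=
  (ContinuousLinearMap.compL ℂ 𝔄 𝔄 (𝔄 →L[ℂ] 𝔄) (ContinuousLinearMap.mul ℂ 𝔄)).comp
    (ContinuousLinearMap.mul ℂ 𝔄).flip

/-- The nonlinearity is a quadratic polynomial in `w`. -/
theorem graphNonlinearity_eq (P P' N w : 𝔄) : graphNonlinearity P P' N w =
    quadEval (-sandwich 𝔄 (P' + N))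
      ((ContinuousLinearMap.mul ℂ 𝔄).flip (P' * (1 - P) - N * P) +
        ContinuousLinearMap.mul ℂ 𝔄 ((1 - P) * N - P * P'))
      (P * P' * (1 - P) - P' + (1 - P) * N * P) w := by
  have h1 : (-sandwich 𝔄 (P' + N)) w w = -(w * (P' + N) * w) := rfl
  have h2 : ((ContinuousLinearMap.mul ℂ 𝔄).flip (P' * (1 - P) - N * P) +
        ContinuousLinearMap.mul ℂ 𝔄 ((1 - P) * N - P * P')) w =
      w * (P' * (1 - P) - N * P) + ((1 - P) * N - P * P') * w := rfl
  rw [quadEval, h1, h2, graphNonlinearity]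
  noncomm_ring

end Graph

/-! ### Exact invariant graphs over a projection -/

section GraphSolution

variable {𝔄 : Type*} [NormedRing 𝔄] [NormedAlgebra ℂ 𝔄] [CompleteSpace 𝔄]

/-- Bounded holomorphic functions have bounded derivatives on smaller halfstrips. -/
theorem norm_deriv_halfstrip_le {E : Type*} [NormedAddCommGroup E] [NormedSpace ℂ E] {θ ε : ℝ}
    {z₁ : ℂ} {r r' K : ℝ} (hr : r' < r) {f : ℂ → E}
    (hf : DifferentiableOn ℂ f (halfstrip θ ε z₁ r)) (hK : ∀ z ∈ halfstrip θ ε z₁ r, ‖f z‖ ≤ K) :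
    ∀ z ∈ halfstrip θ ε z₁ r', ‖deriv f z‖ ≤ K / (r - r') := by
  intro z hz
  have hσ : 0 < r - r' := by linarith
  have hcl : Metric.closedBall z (r - r') ⊆ halfstrip θ ε z₁ r := fun y hy => by
    have := mem_halfstrip_of_dist_le hz (Metric.mem_closedBall.1 hy)
    rwa [add_sub_cancel] at this
  exact Complex.norm_deriv_le_of_forall_mem_sphere_norm_le hσ
    (DifferentiableOn.diffContOnCl (by
      rw [closure_ball z hσ.ne']
      exact hf.mono hcl))
    fun y hy => hK y (hcl (Metric.sphere_subset_closedBall hy))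

/-- Existence of an exact invariant graph `Y = P + w` over the range of a bounded holomorphic
projection, with `w : range P → ker P`. The constraints `P w = 0` and `w P = w` are not imposed but
follow from uniqueness for linear equations. -/
theorem exists_invariant_graph {θ ε : ℝ} (hε : ε = 1 ∨ ε = -1) {z₁ : ℂ}
    {r r' d : ℝ} (hr' : 0 < r') (hr : r' < r) (hd : 0 < d) {P : ℂ → 𝔄}
    (hP : DifferentiableOn ℂ P (halfstrip θ ε z₁ r)) {K : ℝ}
    (hPK : ∀ z ∈ halfstrip θ ε z₁ r, ‖P z‖ ≤ K) (hPP : ∀ z ∈ halfstrip θ ε z₁ r, P z * P z = P z)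
    {N : ℂ → ℂ → 𝔄} {Nk : ℕ → ℂ → 𝔄}
    (hN : IsGevrey (halfstrip θ ε z₁ r) (borelDisc θ d) N Nk) :
    ∃ d', 0 < d' ∧ d' ≤ d ∧ ∃ (w : ℂ → ℂ → 𝔄) (wk : ℕ → ℂ → 𝔄),
      IsGevrey (halfstrip θ ε z₁ r') (borelDisc θ d') w wk ∧ wk 0 = 0 ∧
      ∀ z ∈ halfstrip θ ε z₁ r', ∀ h ∈ borelDisc θ d', P z * w z h = 0 ∧ w z h * P z = w z h ∧
        HasDerivAt (fun z => w z h) (((ε : ℂ) / h) • w z h +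
          graphNonlinearity (P z) (deriv P z) (N z h) (w z h)) z := by
  set r₂ := (r' + r) / 2 with hr₂
  have hr₂' : r' < r₂ := by rw [hr₂]; linarith
  have hr₂r : r₂ < r := by rw [hr₂]; linarith
  have hsub : halfstrip θ ε z₁ r₂ ⊆ halfstrip θ ε z₁ r := halfstrip_mono hr₂r.le
  have hsub' : halfstrip θ ε z₁ r' ⊆ halfstrip θ ε z₁ r := halfstrip_mono (hr₂'.trans hr₂r).le
  have hP'K := norm_deriv_halfstrip_le hr₂r hP hPK
  have gP := isGevrey_const (D := borelDisc θ d) (hP.mono hsub) (fun z hz => hPK z (hsub hz))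
  have gP' := isGevrey_const (D := borelDisc θ d) ((hP.deriv isOpen_halfstrip).mono hsub) hP'K
  have g1 := isGevrey_const (U := halfstrip θ ε z₁ r₂) (D := borelDisc θ d) (g := fun _ => (1 : 𝔄))
    (differentiableOn_const 1) (fun _ _ => le_rfl)
  have gN := hN.mono hsub subset_rfl
  have gQ := g1.sub gP
  have gA := ((gP'.add gN).clm (F := 𝔄 →L[ℂ] 𝔄 →L[ℂ] 𝔄) (sandwich 𝔄)).neg
  have gB := (((gP'.mul hd gQ).sub (gN.mul hd gP)).clm (F := 𝔄 →L[ℂ] 𝔄)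
    (ContinuousLinearMap.mul ℂ 𝔄).flip).add
      (((gQ.mul hd gN).sub (gP.mul hd gP')).clm (F := 𝔄 →L[ℂ] 𝔄) (ContinuousLinearMap.mul ℂ 𝔄))
  have gC := (((gP.mul hd gP').mul hd gQ).sub gP').add ((gQ.mul hd gN).mul hd gP)
  obtain ⟨d₁, hd₁, hd₁d, w, wk, hw, hw0, hode⟩ := exists_gevrey_solution hε hr' hr₂' hd gA gB gC
  simp only [← graphNonlinearity_eq] at hode
  obtain ⟨b, _, hb0, -, hwb, -⟩ := hw.exists_bounds hd₁
  obtain ⟨n, _, hn0, -, hNb, -⟩ := hN.exists_bounds hd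
  have hwb : ∀ z ∈ halfstrip θ ε z₁ r', ∀ h ∈ borelDisc θ d₁, ‖w z h‖ ≤ b := fun z hz h hh => by
    simpa using hwb 0 z hz h hh
  have hNb : ∀ z ∈ halfstrip θ ε z₁ r, ∀ h ∈ borelDisc θ d, ‖N z h‖ ≤ n := fun z hz h hh => by
    simpa using hNb 0 z hz h hh
  set q := |K| / (r - r₂) with hq
  have hq0 : 0 ≤ q := div_nonneg (abs_nonneg _) (by linarith)
  have hP'q : ∀ z ∈ halfstrip θ ε z₁ r₂, ‖deriv P z‖ ≤ q := fun z hz =>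
    (hP'K z hz).trans (div_le_div_of_nonneg_right (le_abs_self K) (by linarith))
  have hPK' : ∀ z ∈ halfstrip θ ε z₁ r, ‖P z‖ ≤ |K| := fun z hz =>
    (hPK z hz).trans (le_abs_self K)
  -- `u` bounds `P + w` and `1 - P - w`, and `c` is the Lipschitz constant in the linear equations
  -- for the defects `P w` and `w (1 - P)`
  set u := ‖(1 : 𝔄)‖ + |K| + b with hu
  have hu0 : 0 ≤ u := by positivity
  set c := q + q * u + n * u with hc
  have hc0 : 0 ≤ c := by positivity
  set d' := min d₁ (1 / (c + 1)) with hd'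
  have hd'0 : 0 < d' := lt_min hd₁ (by positivity)
  have hcd : c < 1 / d' := by
    rw [lt_div_iff₀ hd'0]
    have := min_le_right d₁ (1 / (c + 1))
    rw [le_div_iff₀ (by positivity)] at this
    linarith
  have hDsub : borelDisc θ d' ⊆ borelDisc θ d₁ := borelDisc_mono hd'0 (min_le_left _ _)
  have hVκ : ∀ z ∈ halfstrip θ ε z₁ r', ∀ t : ℝ, 0 ≤ t →
      z + t * (ε * Complex.exp (θ * Complex.I)) ∈ halfstrip θ ε z₁ r' := fun z hz t ht =>
    add_mem_halfstrip hz ht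
  have hPd : ∀ z ∈ halfstrip θ ε z₁ r, HasDerivAt P (deriv P z) z := fun z hz =>
    (hP.differentiableAt (isOpen_halfstrip.mem_nhds hz)).hasDerivAt
  have hPP' : ∀ z ∈ halfstrip θ ε z₁ r, deriv P z * P z + P z * deriv P z = deriv P z := by
    intro z hz
    refine HasDerivAt.unique (((hPd z hz).fun_mul (hPd z hz)).congr_of_eventuallyEq ?_) (hPd z hz)
    filter_upwards [isOpen_halfstrip.mem_nhds hz] with y hy using (hPP y hy).symm
  have hbounds : ∀ z ∈ halfstrip θ ε z₁ r', ∀ h ∈ borelDisc θ d',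
      ‖1 - P z - w z h‖ ≤ u ∧ ‖P z + w z h‖ ≤ u ∧ ‖deriv P z‖ ≤ q ∧ ‖N z h‖ ≤ n := by
    intro z hz h hh
    have h1 := hPK' z (hsub' hz)
    have h2 := hwb z hz h (hDsub hh)
    refine ⟨?_, ?_, hP'q z (halfstrip_mono hr₂'.le hz),
      hNb z (hsub' hz) h (borelDisc_mono hd₁ hd₁d (hDsub hh))⟩
    · refine (norm_sub_le _ _).trans (add_le_add ((norm_sub_le _ _).trans ?_) h2)
      linarith
    · refine (norm_add_le _ _).trans ((add_le_add h1 h2).trans ?_)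
      linarith [norm_nonneg (1 : 𝔄)]
  refine ⟨d', hd'0, (min_le_left _ _).trans hd₁d, w, wk, hw.mono subset_rfl hDsub, hw0,
    fun z hz h hh => ⟨?_, ?_, hode z hz h (hDsub hh)⟩⟩
  -- the defects `P w` and `w (1 - P)` solve linear homogeneous equations, hence vanish
  · refine eq_zero_of_ray_ode hε hVκ (f := fun z => P z * w z h) (r := fun z =>
      deriv P z * (P z * w z h) + (P z * w z h) * (deriv P z * (1 - P z - w z h) -
        N z h * (P z + w z h))) hc0 hh.1 (hcd.trans hh.2) (fun z hz => ?_) (B := |K| * b)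
      (fun z hz => ?_) (fun z hz => ?_) z hz
    · refine ((hPd z (hsub' hz)).fun_mul (hode z hz h (hDsub hh))).congr_deriv ?_
      rw [← graph_left_identity (hPP z (hsub' hz)) (hPP' z (hsub' hz)), mul_add, mul_smul_comm]
      abel
    · exact (norm_mul_le _ _).trans (mul_le_mul (hPK' z (hsub' hz)) (hwb z hz h (hDsub hh))
        (norm_nonneg _) (abs_nonneg _))
    · obtain ⟨b1, b2, b3, b4⟩ := hbounds z hz h hh
      have e1 : ‖deriv P z * (P z * w z h)‖ ≤ q * ‖P z * w z h‖ :=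
        (norm_mul_le _ _).trans (by gcongr)
      have e2 : ‖(P z * w z h) * (deriv P z * (1 - P z - w z h) - N z h * (P z + w z h))‖ ≤
          ‖P z * w z h‖ * (q * u + n * u) := by
        refine (norm_mul_le _ _).trans (mul_le_mul_of_nonneg_left ?_ (norm_nonneg _))
        refine (norm_sub_le _ _).trans (add_le_add ?_ ?_) <;>
        · refine (norm_mul_le _ _).trans ?_
          gcongr
      refine (norm_add_le _ _).trans ((add_le_add e1 e2).trans (le_of_eq ?_))
      rw [hc]
      ring
  · have hzero : w z h * (1 - P z) = 0 := by
      refine eq_zero_of_ray_ode hε hVκ (f := fun z => w z h * (1 - P z)) (r := fun z =>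
        -(w z h * (1 - P z) * deriv P z) + (-((P z + w z h) * deriv P z) +
          (1 - P z - w z h) * N z h) * (w z h * (1 - P z))) hc0 hh.1 (hcd.trans hh.2)
        (fun z hz => ?_) (B := b * (‖(1 : 𝔄)‖ + |K|)) (fun z hz => ?_) (fun z hz => ?_) z hz
      · refine ((hode z hz h (hDsub hh)).fun_mul ((hPd z (hsub' hz)).const_sub 1)).congr_deriv ?_
        rw [← graph_right_identity (hPP z (hsub' hz)) (hPP' z (hsub' hz)), add_mul, smul_mul_assoc,
          mul_neg]
        abel
      · exact (norm_mul_le _ _).trans (mul_le_mul (hwb z hz h (hDsub hh))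
          ((norm_sub_le _ _).trans (add_le_add_right (hPK' z (hsub' hz)) _)) (norm_nonneg _) hb0.le)
      · obtain ⟨b1, b2, b3, b4⟩ := hbounds z hz h hh
        have e1 : ‖-(w z h * (1 - P z) * deriv P z)‖ ≤ ‖w z h * (1 - P z)‖ * q := by
          rw [norm_neg]
          exact (norm_mul_le _ _).trans (by gcongr)
        have e2 : ‖(-((P z + w z h) * deriv P z) + (1 - P z - w z h) * N z h) *
            (w z h * (1 - P z))‖ ≤ (u * q + u * n) * ‖w z h * (1 - P z)‖ := by
          refine (norm_mul_le _ _).trans (mul_le_mul_of_nonneg_right ?_ (norm_nonneg _))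
          refine (norm_add_le _ _).trans (add_le_add ?_ ?_)
          · rw [norm_neg]
            refine (norm_mul_le _ _).trans ?_
            gcongr
          · refine (norm_mul_le _ _).trans ?_
            gcongr
        refine (norm_add_le _ _).trans ((add_le_add e1 e2).trans (le_of_eq ?_))
        rw [hc]
        ring
    rw [mul_sub, mul_one, sub_eq_zero] at hzero
    exact hzero.symm

end GraphSolution

/-! ### Quotients of Gevrey expansions -/

section Quotient

variable {E : Type*} [NormedAddCommGroup E] [NormedSpace ℂ E] {U : Set ℂ} {θ d : ℝ}

/-- Removing the constant term of a Gevrey expansion and dividing by `h`. The shift of the factorial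
is absorbed by doubling the rate `M`. -/
theorem IsGevrey.shift {f : ℂ → ℂ → E} {fk : ℕ → ℂ → E}
    (hf : IsGevrey U (borelDisc θ d) f fk) :
    IsGevrey U (borelDisc θ d) (fun z h => h⁻¹ • (f z h - fk 0 z)) (fun k => fk (k + 1)) := by
  obtain ⟨C, M, hC, hM, hb⟩ := hf.bound
  refine ⟨?_, fun k => hf.coeff_holo _, C * M, 2 * M, by positivity, by positivity,
    fun n z hz h hh => ?_⟩
  · refine DifferentiableOn.smul (f := fun x : ℂ × ℂ => f x.1 x.2 - fk 0 x.1)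
      (c := fun x : ℂ × ℂ => x.2⁻¹) ?_ ?_
    · exact differentiableOn_snd.inv fun x hx => hx.2.1
    · exact hf.holo.sub ((hf.coeff_holo 0).comp differentiableOn_fst fun x hx => hx.1)
  · have hh0 : h ≠ 0 := hh.1
    have h1 : rem (h⁻¹ • (f z h - fk 0 z)) (fun k => fk (k + 1) z) h n =
        h⁻¹ • rem (f z h) (fun k => fk k z) h (n + 1) := by
      simp only [rem, Finset.sum_range_succ', smul_sub, smul_add, Finset.smul_sum, smul_smul,
        pow_zero, mul_one]
      have h2 : ∀ k : ℕ, h⁻¹ * h ^ (k + 1) = h ^ k := fun k => by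
        rw [pow_succ]; field_simp
      simp only [h2]
      abel
    rw [h1, norm_smul, norm_inv]
    have h3 := hb (n + 1) z hz h hh
    have h4 := gev_succ_le hM.le n
    have h5 : 0 < ‖h‖ := norm_pos_iff.2 hh0
    rw [inv_mul_le_iff₀ h5]
    refine h3.trans ?_
    calc C * gev M (n + 1) * ‖h‖ ^ (n + 1) ≤ C * (M * gev (2 * M) n) * ‖h‖ ^ (n + 1) := by gcongr
      _ = _ := by ring

/-- Raising the rate from `M` to `L` gains a factor `M / L` in all positive orders. -/
theorem gev_le_div_mul_gev {M L : ℝ} (hM : 0 < M) (hL : M ≤ L) {i : ℕ} (hi : i ≠ 0) :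
    gev M i ≤ M / L * gev L i := by
  have hL0 : 0 < L := hM.trans_le hL
  have h1 : gev M i = (M / L) ^ i * gev L i := by
    rw [← mul_gev, div_mul_cancel₀ _ hL0.ne']
  rw [h1]
  refine mul_le_mul_of_nonneg_right ?_ (gev_nonneg hL0.le i)
  exact pow_le_of_le_one (by positivity) ((div_le_one hL0).2 hL) hi

/-- Gevrey expansions can be divided by those with constant term `1`. The coefficients of the quotient
are given by the recursion `q_n = f_n - ∑_{i ≥ 1} g_i q_{n - i}`. -/
theorem IsGevrey.exists_div (hd : 0 < d) {f g : ℂ → ℂ → ℂ} {fk gk : ℕ → ℂ → ℂ}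
    (hf : IsGevrey U (borelDisc θ d) f fk) (hg : IsGevrey U (borelDisc θ d) g gk)
    (hg0 : ∀ z ∈ U, gk 0 z = 1) (hg2 : ∀ z ∈ U, ∀ h ∈ borelDisc θ d, 1 / 2 ≤ ‖g z h‖) :
    ∃ qk : ℕ → ℂ → ℂ, qk 0 = fk 0 ∧ IsGevrey U (borelDisc θ d) (fun z h => f z h / g z h) qk := by
  obtain ⟨C, M, hC, hM, hfb, hfc⟩ := hf.exists_bounds hd
  obtain ⟨C', M', hC', hM', hgb, hgc⟩ := hg.exists_bounds hd
  set μ := ContinuousLinearMap.mul ℂ ℂ with hμ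
  have hμn : ∀ x y, ‖μ x y‖ ≤ ‖x‖ * ‖y‖ := fun x y => norm_mul_le x y
  obtain ⟨q, hq⟩ := exists_seq_of_step (X := ℂ → ℂ) fun n u => fun z =>
    fk n z - conv μ (fun k => gk k z) (fun k => u k z) n
  have hq0 : q 0 = fk 0 := by
    funext z
    rw [hq 0]
    simp [conv]
  have htr : ∀ n k z, (if k < n then q k else 0) z = if k < n then q k z else 0 := fun n k z => by
    split_ifs <;> rfl
  have hqd : ∀ n, DifferentiableOn ℂ (q n) U := by
    intro n
    induction n using Nat.strong_induction_on with
    | _ n ih =>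
      rw [hq n]
      refine (hf.coeff_holo n).fun_sub
        (differentiableOn_conv (g := fun k => if k < n then q k else 0) (fun i _ => hg.coeff_holo i)
          fun i _ => ?_)
      split_ifs with hi
      · exact ih i hi
      · exact differentiableOn_const 0
  have hconv : ∀ n, ∀ z ∈ U, conv μ (fun k => gk k z) (fun k => q k z) n = fk n z := by
    intro n z hz
    have h1 : conv μ (fun k => gk k z) (fun k => q k z) n =
        conv μ (fun k => gk k z) (fun k => if k < n then q k z else 0) n + q n z := by
      simp only [conv]
      rw [Finset.Nat.sum_antidiagonal_eq_sum_range_succ_mk,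
        Finset.Nat.sum_antidiagonal_eq_sum_range_succ_mk, Finset.sum_range_succ', Finset.sum_range_succ']
      simp only [Nat.sub_zero, lt_irrefl, if_false, map_zero, add_zero]
      congr 1
      · refine Finset.sum_congr rfl fun k hk => ?_
        have := Finset.mem_range.1 hk
        rw [if_pos (by omega)]
      · simp [hμ, hg0 z hz]
    rw [h1]
    conv_lhs => rw [hq n]
    simp only [htr]
    ring
  set K := C + C' with hK
  set m := M + M' with hm
  have hK0 : 0 < K := by positivity
  have hm0 : 0 < m := by positivity
  -- with this rate, `6 K (m / L) ≤ 1` makes the convolution in the recursion contribute at most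
  -- half of the claimed bound
  set L := m * (1 + 6 * K) with hL
  have hmL : m ≤ L := by rw [hL]; nlinarith [mul_pos hm0 hK0]
  have hL0 : 0 < L := hm0.trans_le hmL
  have hup : ∀ {c x : ℝ} (k : ℕ), 0 < c → 0 < x → c ≤ K → x ≤ m → c * gev x k ≤ K * gev m k :=
    fun k hc hx hcK hxm => mul_le_mul hcK (gev_mono hx.le hxm k) (gev_nonneg hx.le k) hK0.le
  have hfK : ∀ k, C * gev M k ≤ K * gev m k := fun k =>
    hup k hC hM (by linarith) (by linarith)
  have hgK : ∀ k, C' * gev M' k ≤ K * gev m k := fun k =>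
    hup k hC' hM' (by linarith) (by linarith)
  have hKL : ∀ k, K * gev m k ≤ K * gev L k := fun k =>
    mul_le_mul_of_nonneg_left (gev_mono hm0.le hmL k) hK0.le
  have hqb : ∀ n, ∀ z ∈ U, ‖q n z‖ ≤ 2 * K * gev L n := by
    intro n
    induction n using Nat.strong_induction_on with
    | _ n ih =>
      intro z hz
      have h1 : ‖conv μ (fun k => gk k z) (fun k => if k < n then q k z else 0) n‖ ≤
          ∑ p ∈ Finset.HasAntidiagonal.antidiagonal n,
            (K * (m / L)) * (2 * K) * (gev L p.1 * gev L p.2) := by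
        refine norm_sum_le_of_le _ fun p hp => (hμn _ _).trans ?_
        have hp' := Finset.HasAntidiagonal.mem_antidiagonal.1 hp
        have hL1 := gev_nonneg hL0.le p.1
        have hL2 := gev_nonneg hL0.le p.2
        by_cases hlt : p.2 < n
        · simp only [if_pos hlt]
          have e1 : ‖gk p.1 z‖ ≤ K * (m / L * gev L p.1) :=
            ((hgc p.1 z hz).trans (hgK p.1)).trans (mul_le_mul_of_nonneg_left
              (gev_le_div_mul_gev hm0 hmL (by omega)) hK0.le)
          refine (mul_le_mul e1 (ih p.2 hlt z hz) (norm_nonneg _) (by positivity)).trans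
            (le_of_eq (by ring))
        · simp only [if_neg hlt, norm_zero, mul_zero]
          positivity
      rw [← Finset.mul_sum] at h1
      have h2 := mul_le_mul_of_nonneg_left (sum_gev_mul_gev_le hL0.le n)
        (by positivity : 0 ≤ (K * (m / L)) * (2 * K))
      have h3 : 6 * K * (m / L) ≤ 1 := by
        rw [mul_div_assoc', div_le_one hL0, hL]
        nlinarith
      have h4 : ‖fk n z‖ ≤ K * gev L n := ((hfc n z hz).trans (hfK n)).trans (hKL n)
      rw [hq n]
      simp only [htr]
      refine (norm_sub_le _ _).trans ?_
      have h5 : (K * (m / L)) * (2 * K) * (3 * gev L n) ≤ K * gev L n := by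
        have : 0 ≤ K * gev L n := mul_nonneg hK0.le (gev_nonneg hL0.le n)
        nlinarith
      linarith
  have hdiv : DifferentiableOn ℂ (Function.uncurry fun z h => f z h / g z h)
      (U ×ˢ borelDisc θ d) := by
    have h1 : DifferentiableOn ℂ (Function.uncurry g)⁻¹ (U ×ˢ borelDisc θ d) :=
      hg.holo.inv fun x hx h0 => by
        have := hg2 x.1 hx.1 x.2 hx.2
        rw [show g x.1 x.2 = 0 from h0, norm_zero] at this
        norm_num at this
    exact (hf.holo.mul h1).congr fun x _ => div_eq_mul_inv _ _
  refine ⟨q, hq0, hdiv, hqd, 2 * (K + 3 * K * (2 * K)), L,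
    by positivity, hL0, fun n z hz h hh => ?_⟩
  have hg0' : g z h ≠ 0 := by
    intro h0
    have := hg2 z hz h hh
    rw [h0, norm_zero] at this
    norm_num at this
  -- the remainder of `f = g (f / g)` is `g` times that of the quotient, plus controlled terms
  have h1 := rem_conv μ (g z h) (f z h / g z h) (fun k => gk k z) (fun k => q k z) h n
  have h2 : μ (g z h) (f z h / g z h) = f z h := by
    simp only [hμ, ContinuousLinearMap.mul_apply']
    field_simp
  rw [h2, show conv μ (fun k => gk k z) (fun k => q k z) = fun k => fk k z from
    funext fun n => hconv n z hz] at h1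
  have h3 := norm_sum_rem_le hμn (f := g z h) (fk := fun k => gk k z) (gk := fun k => q k z) (h := h)
    (n := n) hL0.le hK0.le (by positivity : 0 ≤ 2 * K)
    (fun i _ _ => (hgb i z hz h hh).trans (by
      have := (hgK i).trans (hKL i)
      gcongr)) (fun i _ => hqb i z hz)
  have h4 : ‖rem (f z h) (fun k => fk k z) h n‖ ≤ K * gev L n * ‖h‖ ^ n :=
    (hfb n z hz h hh).trans (by
      have := (hfK n).trans (hKL n)
      gcongr)
  have h5 : ‖g z h‖ * ‖rem (f z h / g z h) (fun k => q k z) h n‖ ≤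
      (K + 3 * K * (2 * K)) * gev L n * ‖h‖ ^ n := by
    rw [← norm_mul, show g z h * rem (f z h / g z h) (fun k => q k z) h n =
      rem (f z h) (fun k => fk k z) h n - ∑ k ∈ Finset.range n,
        h ^ k • μ (rem (g z h) (fun k => gk k z) h (n - k)) (q k z) by rw [h1]; simp [hμ]]
    refine (norm_sub_le _ _).trans ((add_le_add h4 h3).trans (le_of_eq ?_))
    ring
  have h6 := hg2 z hz h hh
  nlinarith [norm_nonneg (rem (f z h / g z h) (fun k => q k z) h n)]

end Quotient

/-! ### From invariant graphs to solutions of the Riccati equation -/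

section GraphLine

variable {𝔄 : Type*} [Ring 𝔄] [Algebra ℂ 𝔄]

/-- If `Y = P + w` is an invariant graph, `h Y'` differs from `M Y` by a right multiple of `Y`:
the range of `Y` is transported by the linear system `h y' = M y`. -/
theorem graph_transport {ε h : ℂ} (hh : h ≠ 0) {P P' M w : 𝔄}
    (hP : P * P = P) (hPw : P * w = 0) (hwP : w * P = w) :
    h • (P' + ((ε / h) • w + graphNonlinearity P P'
      (h⁻¹ • (M - ε • ((1 / 2 : ℂ) • (1 : 𝔄) - P))) w)) =
      (P + w) * (h • (P' * (1 - (P + w))) - M * (P + w)) + M * (P + w) := by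
  have hww : w * w = 0 := by
    nth_rw 1 [← hwP]
    rw [mul_assoc, hPw, mul_zero]
  have h1 : (1 - (P + w)) * (P + w) = 0 := by
    simp only [sub_mul, add_mul, mul_add, one_mul, hP, hPw, hwP, hww]; abel
  have h2 : (1 - (P + w)) * (ε • ((1 / 2 : ℂ) • (1 : 𝔄) - P)) * (P + w) = ε • w := by
    have : (1 - (P + w)) * (ε • ((1 / 2 : ℂ) • (1 : 𝔄) - P)) * (P + w) =
      ε • ((1 / 2 : ℂ) • ((1 - (P + w)) * (P + w)) - (1 - (P + w)) * (P * (P + w))) := by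
      simp only [mul_smul_comm, smul_mul_assoc, mul_sub, sub_mul, mul_one, mul_assoc]
    rw [this, h1, mul_add, hP, hPw, add_zero, sub_mul, add_mul, hP, hwP]
    congr 1
    simp
  unfold graphNonlinearity
  have h3 : h • ((1 - P - w) * (h⁻¹ • (M - ε • ((1 / 2 : ℂ) • (1 : 𝔄) - P))) * (P + w)) =
      (1 - (P + w)) * M * (P + w) - ε • w := by
    rw [← h2, mul_smul_comm, smul_mul_assoc, smul_smul, mul_inv_cancel₀ hh, one_smul, mul_sub,
      sub_mul, sub_sub]
  have h4 : h • ((ε / h) • w) = ε • w := by rw [smul_smul, mul_div_cancel₀ _ hh]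
  generalize h⁻¹ • (M - ε • ((1 / 2 : ℂ) • (1 : 𝔄) - P)) = N at h3 ⊢
  rw [smul_add, smul_add, h4, smul_add, h3]
  simp only [mul_sub, sub_mul, mul_add, add_mul, mul_smul_comm, one_mul, mul_one,
    smul_add, smul_sub, mul_assoc]
  abel

end GraphLine

/-- A Gevrey family is uniformly close to its constant term for small `h`. -/
theorem IsGevrey.exists_norm_sub_le {E : Type*} [NormedAddCommGroup E] [NormedSpace ℂ E] {U : Set ℂ}
    {θ d : ℝ} (hd : 0 < d) {f : ℂ → ℂ → E} {fk : ℕ → ℂ → E}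
    (hf : IsGevrey U (borelDisc θ d) f fk) {η : ℝ} (hη : 0 < η) :
    ∃ d', 0 < d' ∧ d' ≤ d ∧ ∀ z ∈ U, ∀ h ∈ borelDisc θ d', ‖f z h - fk 0 z‖ ≤ η := by
  obtain ⟨C, M, hC, hM, hb⟩ := hf.bound
  refine ⟨min d (η / (C * M)), lt_min hd (by positivity), min_le_left _ _, fun z hz h hh => ?_⟩
  have hd' : 0 < min d (η / (C * M)) := lt_min hd (by positivity)
  have h1 := hb 1 z hz h (borelDisc_mono hd' (min_le_left _ _) hh)
  have h2 := (norm_lt_of_mem_borelDisc hd' hh).le.trans (min_le_right _ _)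
  rw [le_div_iff₀ (by positivity)] at h2
  simp only [rem, Finset.sum_range_one, pow_zero, one_smul, pow_one, gev, Nat.factorial_one,
    Nat.cast_one, mul_one] at h1
  linarith

section Projective

/-- The ratio of the components of a vector moving, up to a scalar factor, by the linear system
`h y' = [[b/2, c], [-a, -b/2]] y` satisfies the Riccati equation `h f' = a f² + b f + c`. -/
theorem hasDerivAt_ratio {y₁ y₂ : ℂ → ℂ} {z a b c h l p q : ℂ} (hh : h ≠ 0) (hy : y₂ z ≠ 0)
    (h₁ : HasDerivAt y₁ p z) (h₂ : HasDerivAt y₂ q z)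
    (e₁ : h * p = b / 2 * y₁ z + c * y₂ z + l * y₁ z)
    (e₂ : h * q = -a * y₁ z - b / 2 * y₂ z + l * y₂ z) :
    HasDerivAt (fun z => y₁ z / y₂ z)
      ((a * (y₁ z / y₂ z) ^ 2 + b * (y₁ z / y₂ z) + c) / h) z := by
  refine (h₁.fun_div h₂ hy).congr_deriv ?_
  rw [div_eq_div_iff (pow_ne_zero 2 hy) hh]
  have : (a * (y₁ z / y₂ z) ^ 2 + b * (y₁ z / y₂ z) + c) * y₂ z ^ 2 =
      a * y₁ z ^ 2 + b * y₁ z * y₂ z + c * y₂ z ^ 2 := by field_simp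
  rw [this]
  linear_combination y₂ z * e₁ - y₁ z * e₂

end Projective

/-! ### The Riccati equation on a halfstrip -/

section Scalar

attribute [local instance] Matrix.linftyOpNormedRing Matrix.linftyOpNormedAlgebra

/-- The trace-free matrix of the linear system associated with a Riccati equation: if `h y' = M y`
then `y₁ / y₂` is a solution of `h f' = a f² + b f + c`. -/
noncomputable def riccatiMatrix (a b c : ℂ) : Matrix (Fin 2) (Fin 2) ℂ :=
  !![b / 2, c; -a, -(b / 2)]

theorem riccatiMatrix_eq (a b c : ℂ) : riccatiMatrix a b c =
    ContinuousLinearMap.toSpanSingleton ℂ (!![0, 0; -1, 0] : Matrix (Fin 2) (Fin 2) ℂ) a +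
    ContinuousLinearMap.toSpanSingleton ℂ (!![1 / 2, 0; 0, -(1 / 2)] : Matrix (Fin 2) (Fin 2) ℂ) b +
    ContinuousLinearMap.toSpanSingleton ℂ (!![0, 1; 0, 0] : Matrix (Fin 2) (Fin 2) ℂ) c := by
  simp only [ContinuousLinearMap.toSpanSingleton_apply, riccatiMatrix]
  ext i j
  fin_cases i <;> fin_cases j <;> simp [div_eq_mul_inv]

/-- When the discriminant `b² - 4 a c` is `1`, this is the projection onto the eigenline of
`riccatiMatrix a b c` for the eigenvalue `-ε / 2`. -/
noncomputable def riccatiProj (ε : ℂ) (a b c : ℂ) : Matrix (Fin 2) (Fin 2) ℂ :=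
  (1 / 2 : ℂ) • 1 - ε • riccatiMatrix a b c

theorem riccatiProj_eq (ε a b c : ℂ) : riccatiProj ε a b c =
    !![1 / 2 - ε * b / 2, -(ε * c); ε * a, 1 / 2 + ε * b / 2] := by
  unfold riccatiProj riccatiMatrix
  ext i j
  fin_cases i <;> fin_cases j <;> simp <;> ring

theorem riccatiProj_mul_self {ε a b c : ℂ} (hε : ε * ε = 1) (hD : b ^ 2 - 4 * a * c = 1) :
    riccatiProj ε a b c * riccatiProj ε a b c = riccatiProj ε a b c := by
  rw [riccatiProj_eq, Matrix.mul_fin_two]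
  congr 1
  ext i j
  fin_cases i <;> fin_cases j <;> simp
  · linear_combination (b ^ 2 / 4 - a * c) * hε + hD / 4
  · ring
  · ring
  · linear_combination (b ^ 2 / 4 - a * c) * hε + hD / 4

/-- A matrix entry as a continuous linear functional. -/
noncomputable def entryCLM (i j : Fin 2) : Matrix (Fin 2) (Fin 2) ℂ →L[ℂ] ℂ :=
  LinearMap.toContinuousLinearMap (Matrix.entryLinearMap ℂ ℂ i j)

variable {U : Set ℂ} {θ d : ℝ}

theorem isGevrey_riccatiMatrix {D : Set ℂ} {A B C : ℂ → ℂ → ℂ} {Ak Bk Ck : ℕ → ℂ → ℂ}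
    (hA : IsGevrey U D A Ak) (hB : IsGevrey U D B Bk) (hC : IsGevrey U D C Ck) :
    IsGevrey U D (fun z h => riccatiMatrix (A z h) (B z h) (C z h))
      (fun k z => riccatiMatrix (Ak k z) (Bk k z) (Ck k z)) := by
  simp only [riccatiMatrix_eq]
  exact ((hA.clm _).add (hB.clm _)).add (hC.clm _)

/-- The Gevrey expansion of `f + (p v + q)`, where `(p, q)` is a row of a matrix family without
constant term, applied to the vector `(v, 1)`. -/
theorem isGevrey_component (hd : 0 < d) {f v : ℂ → ℂ} (hv : DifferentiableOn ℂ v U) {K : ℝ}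
    (hK : ∀ z ∈ U, ‖v z‖ ≤ K) (hf : DifferentiableOn ℂ f U) (hfK : ∀ z ∈ U, ‖f z‖ ≤ K)
    {p q : ℂ → ℂ → ℂ} {pk qk : ℕ → ℂ → ℂ}
    (hp : IsGevrey U (borelDisc θ d) p pk) (hq : IsGevrey U (borelDisc θ d) q qk)
    (hp0 : pk 0 = 0) (hq0 : qk 0 = 0) :
    ∃ gk : ℕ → ℂ → ℂ, gk 0 = f ∧
      IsGevrey U (borelDisc θ d) (fun z h => f z + (p z h * v z + q z h)) gk := by
  refine ⟨_, ?_, (isGevrey_const hf hfK).add ((hp.mul hd (isGevrey_const hv hK)).add hq)⟩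
  funext z
  simp [conv, hp0, hq0]

/-- A Riccati equation on a halfstrip whose leading-order discriminant is `1`: there is an exact
solution with a uniform Gevrey expansion wherever the leading-order solution `F₀` is bounded. It is
the ratio of the components of `Y (F₀, 1)`, where `Y = P + w` is the exact invariant graph and
`(F₀, 1)` spans the range of `P`. -/
theorem exists_gevrey_riccati {ε : ℝ} (hε : ε = 1 ∨ ε = -1) {z₁ : ℂ} {r r' : ℝ} (hr' : 0 < r')
    (hr : r' < r) (hd : 0 < d) {A B C : ℂ → ℂ → ℂ} {Ak Bk Ck : ℕ → ℂ → ℂ}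
    (hA : IsGevrey (halfstrip θ ε z₁ r) (borelDisc θ d) A Ak)
    (hB : IsGevrey (halfstrip θ ε z₁ r) (borelDisc θ d) B Bk)
    (hC : IsGevrey (halfstrip θ ε z₁ r) (borelDisc θ d) C Ck) {F₀ : ℂ → ℂ}
    (hF : DifferentiableOn ℂ F₀ (halfstrip θ ε z₁ r))
    (hD : ∀ z ∈ halfstrip θ ε z₁ r, Bk 0 z ^ 2 - 4 * Ak 0 z * Ck 0 z = 1)
    (hF₀ : ∀ z ∈ halfstrip θ ε z₁ r, Ak 0 z * F₀ z ^ 2 + Bk 0 z * F₀ z + Ck 0 z = 0)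
    (hF₁ : ∀ z ∈ halfstrip θ ε z₁ r, 2 * Ak 0 z * F₀ z + Bk 0 z = ε) (R : ℝ) :
    ∃ d', 0 < d' ∧ d' ≤ d ∧ ∃ (f : ℂ → ℂ → ℂ) (fk : ℕ → ℂ → ℂ), fk 0 = F₀ ∧
      IsGevrey (halfstrip θ ε z₁ r' ∩ {z | ‖F₀ z‖ < R}) (borelDisc θ d') f fk ∧
      ∀ z ∈ halfstrip θ ε z₁ r' ∩ {z | ‖F₀ z‖ < R}, ∀ h ∈ borelDisc θ d',
        HasDerivAt (fun z => f z h) ((A z h * f z h ^ 2 + B z h * f z h + C z h) / h) z := by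
  have hεε : (ε : ℂ) * ε = 1 := by rcases hε with rfl | rfl <;> simp
  set H := halfstrip θ ε z₁ r with hH
  set P : ℂ → Matrix (Fin 2) (Fin 2) ℂ := fun z => riccatiProj ε (Ak 0 z) (Bk 0 z) (Ck 0 z) with hPdef
  have gM := isGevrey_riccatiMatrix hA hB hC
  obtain ⟨K, _, hK, -, -, hMK⟩ := gM.exists_bounds hd
  have hPd : DifferentiableOn ℂ P H := by
    refine (differentiableOn_const _).fun_sub ((gM.coeff_holo 0).fun_const_smul _)
  have hPK : ∀ z ∈ H, ‖P z‖ ≤ ‖(1 / 2 : ℂ) • (1 : Matrix (Fin 2) (Fin 2) ℂ)‖ + K := fun z hz => by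
    refine (norm_sub_le _ _).trans (add_le_add le_rfl ?_)
    rw [norm_smul, show ‖(ε : ℂ)‖ = 1 by rcases hε with rfl | rfl <;> simp, one_mul]
    simpa using hMK 0 z hz
  have hPP : ∀ z ∈ H, P z * P z = P z := fun z hz => riccatiProj_mul_self hεε (hD z hz)
  obtain ⟨d₁, hd₁, hd₁d, w, wk, hw, hw0, hgraph⟩ :=
    exists_invariant_graph hε hr' hr hd hPd hPK hPP gM.shift
  have hsub : halfstrip θ ε z₁ r' ⊆ H := halfstrip_mono hr.le
  set O := halfstrip θ ε z₁ r' ∩ {z | ‖F₀ z‖ < R} with hO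
  have hOF : DifferentiableOn ℂ F₀ O := hF.mono (inter_subset_left.trans hsub)
  have hOR : ∀ z ∈ O, ‖F₀ z‖ ≤ max R 1 := fun z hz => (le_of_lt hz.2).trans (le_max_left _ _)
  have gw : ∀ i j, IsGevrey O (borelDisc θ d₁) (fun z h => w z h i j) (fun k z => wk k z i j) :=
    fun i j => (hw.clm (entryCLM i j)).mono inter_subset_left subset_rfl
  have gw0 : ∀ i j, (fun z => wk 0 z i j) = 0 := fun i j => by rw [hw0]; rfl
  obtain ⟨yk, hyk, gy⟩ := isGevrey_component hd₁ hOF hOR hOF hOR (gw 0 0) (gw 0 1) (gw0 0 0) (gw0 0 1)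
  obtain ⟨xk, hxk, gx⟩ := isGevrey_component hd₁ hOF hOR (f := fun _ => 1) (differentiableOn_const 1)
    (fun z _ => by simp) (gw 1 0) (gw 1 1) (gw0 1 0) (gw0 1 1)
  obtain ⟨d₂, hd₂, hd₂d, hx2⟩ := gx.exists_norm_sub_le hd₁ (η := 1 / 2) (by norm_num)
  have hx3 : ∀ z ∈ O, ∀ h ∈ borelDisc θ d₂, 1 / 2 ≤ ‖1 + (w z h 1 0 * F₀ z + w z h 1 1)‖ := by
    intro z hz h hh
    have h1 := hx2 z hz h hh
    rw [hxk] at h1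
    have h2 := norm_sub_norm_le (1 : ℂ) (1 + (w z h 1 0 * F₀ z + w z h 1 1))
    rw [norm_sub_rev, norm_one] at h2
    linarith
  have hdd := borelDisc_mono (θ := θ) hd₂ hd₂d
  obtain ⟨fk, hfk, gf⟩ := (gy.mono subset_rfl hdd).exists_div hd₂ (gx.mono subset_rfl hdd)
    (fun z _ => by rw [hxk]) hx3
  refine ⟨d₂, hd₂, hd₂d.trans hd₁d, _, fk, hfk.trans hyk, gf, fun z hz h hh => ?_⟩
  have hh0 : h ≠ 0 := hh.1
  have hzH : z ∈ H := hsub hz.1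
  obtain ⟨hPw, hwP, hder⟩ := hgraph z hz.1 h (hdd hh)
  have hdF : HasDerivAt F₀ (deriv F₀ z) z :=
    (hF.differentiableAt (isOpen_halfstrip.mem_nhds hzH)).hasDerivAt
  have hdP : HasDerivAt P (deriv P z) z :=
    (hPd.differentiableAt (isOpen_halfstrip.mem_nhds hzH)).hasDerivAt
  have htr := graph_transport (ε := (ε : ℂ)) hh0 (P' := deriv P z)
    (M := riccatiMatrix (A z h) (B z h) (C z h)) (hPP z hzH) hPw hwP
  have hM0 : (ε : ℂ) • ((1 / 2 : ℂ) • (1 : Matrix (Fin 2) (Fin 2) ℂ) - P z) =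
      riccatiMatrix (Ak 0 z) (Bk 0 z) (Ck 0 z) := by
    rw [hPdef]
    simp only [riccatiProj, sub_sub_cancel, smul_smul, hεε, one_smul]
  rw [hM0] at htr
  have hdY := hdP.fun_add hder
  set G := deriv P z + (((ε : ℂ) / h) • w z h + graphNonlinearity (P z) (deriv P z)
    (h⁻¹ • (riccatiMatrix (A z h) (B z h) (C z h) -
      riccatiMatrix (Ak 0 z) (Bk 0 z) (Ck 0 z))) (w z h)) with hG
  set Y := P z + w z h with hY
  set Z := h • (deriv P z * (1 - Y)) - riccatiMatrix (A z h) (B z h) (C z h) * Y with hZ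
  have hYP : Y * P z = Y := by rw [hY, add_mul, hPP z hzH, hwP]
  -- the columns of `Y` are multiples of `Y (F₀, 1)`
  have hrank : ∀ i, Y i 0 = (Y i 0 * F₀ z + Y i 1) * (ε * Ak 0 z) ∧
      Y i 1 = (Y i 0 * F₀ z + Y i 1) * (1 / 2 + ε * Bk 0 z / 2) := by
    intro i
    have h0 := congrFun (congrFun hYP i) 0
    have h1 := congrFun (congrFun hYP i) 1
    rw [Matrix.mul_apply, Fin.sum_univ_two] at h0 h1
    simp only [hPdef, riccatiProj_eq, Matrix.of_apply, Matrix.cons_val', Matrix.cons_val_zero,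
      Matrix.cons_val_one, Matrix.cons_val_fin_one] at h0 h1
    have e1 := hF₁ z hzH
    have e2 := hF₀ z hzH
    constructor
    · linear_combination -h0 - Y i 0 * ε / 2 * e1 - Y i 0 / 2 * hεε
    · linear_combination -h1 + Y i 0 * F₀ z * ε / 2 * e1 + Y i 0 * F₀ z / 2 * hεε - Y i 0 * ε * e2
  -- near `z`, the vector `Y (F₀, 1)` is `(F₀, 1) + w (F₀, 1)`, since `P` fixes `(F₀, 1)`
  have hcomp : ∀ i, HasDerivAt (fun z => (P z + w z h) i 0 * F₀ z + (P z + w z h) i 1)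
      (G i 0 * F₀ z + Y i 0 * deriv F₀ z + G i 1) z := fun i =>
    (((entryCLM i 0).hasFDerivAt.comp_hasDerivAt z hdY).fun_mul hdF).fun_add
      ((entryCLM i 1).hasFDerivAt.comp_hasDerivAt z hdY)
  have hPv : ∀ z ∈ H, P z 0 0 * F₀ z + P z 0 1 = F₀ z ∧ P z 1 0 * F₀ z + P z 1 1 = 1 := by
    intro z hz
    have e1 := hF₁ z hz
    have e2 := hF₀ z hz
    simp only [hPdef, riccatiProj_eq, Matrix.of_apply, Matrix.cons_val', Matrix.cons_val_zero,
      Matrix.cons_val_one, Matrix.cons_val_fin_one]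
    constructor
    · linear_combination -ε * e2 + ε * F₀ z / 2 * e1 + F₀ z / 2 * hεε
    · linear_combination ε / 2 * e1 + hεε / 2
  have hev : ∀ᶠ z' in 𝓝 z, z' ∈ H := isOpen_halfstrip.mem_nhds hzH
  have hy₁ := (hcomp 0).congr_of_eventuallyEq (f₁ := fun z => F₀ z + (w z h 0 0 * F₀ z + w z h 0 1))
    (hev.mono fun z' hz' => by
      have := (hPv z' hz').1
      simp only [Matrix.add_apply]
      linear_combination -this)
  have hy₂ := (hcomp 1).congr_of_eventuallyEq (f₁ := fun z => 1 + (w z h 1 0 * F₀ z + w z h 1 1))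
    (hev.mono fun z' hz' => by
      have := (hPv z' hz').2
      simp only [Matrix.add_apply]
      linear_combination -this)
  have hyz₁ : F₀ z + (w z h 0 0 * F₀ z + w z h 0 1) = Y 0 0 * F₀ z + Y 0 1 := by
    have := (hPv z hzH).1
    simp only [hY, Matrix.add_apply]
    linear_combination -this
  have hyz₂ : 1 + (w z h 1 0 * F₀ z + w z h 1 1) = Y 1 0 * F₀ z + Y 1 1 := by
    have := (hPv z hzH).2
    simp only [hY, Matrix.add_apply]
    linear_combination -this
  have hy0 : 1 + (w z h 1 0 * F₀ z + w z h 1 1) ≠ 0 := fun h0 => by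
    have := hx3 z hz h hh
    rw [h0, norm_zero] at this
    norm_num at this
  -- hence `y = Y (F₀, 1)` satisfies `h y' = M y + l y` for a scalar `l`
  have hent : ∀ i j, h * G i j = Y i 0 * Z 0 j + Y i 1 * Z 1 j +
      (riccatiMatrix (A z h) (B z h) (C z h) i 0 * Y 0 j +
        riccatiMatrix (A z h) (B z h) (C z h) i 1 * Y 1 j) := by
    intro i j
    have := congrFun (congrFun htr i) j
    rwa [Matrix.smul_apply, Matrix.add_apply, Matrix.mul_apply, Matrix.mul_apply,
      Fin.sum_univ_two, Fin.sum_univ_two] at this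
  have hent' : ∀ i, h * (G i 0 * F₀ z + Y i 0 * deriv F₀ z + G i 1) =
      riccatiMatrix (A z h) (B z h) (C z h) i 0 * (Y 0 0 * F₀ z + Y 0 1) +
      riccatiMatrix (A z h) (B z h) (C z h) i 1 * (Y 1 0 * F₀ z + Y 1 1) +
      (ε * Ak 0 z * (Z 0 0 * F₀ z + Z 0 1 + h * deriv F₀ z) +
        (1 / 2 + ε * Bk 0 z / 2) * (Z 1 0 * F₀ z + Z 1 1)) * (Y i 0 * F₀ z + Y i 1) := by
    intro i
    obtain ⟨e0, e1⟩ := hrank i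
    linear_combination F₀ z * hent i 0 + hent i 1 +
      (Z 0 0 * F₀ z + Z 0 1 + h * deriv F₀ z) * e0 + (Z 1 0 * F₀ z + Z 1 1) * e1
  refine hasDerivAt_ratio (l := ε * Ak 0 z * (Z 0 0 * F₀ z + Z 0 1 + h * deriv F₀ z) +
    (1 / 2 + ε * Bk 0 z / 2) * (Z 1 0 * F₀ z + Z 1 1)) hh0 hy0 hy₁ hy₂ ?_ ?_
  · rw [hent' 0, hyz₁, hyz₂]
    simp [riccatiMatrix]
  · rw [hent' 1, hyz₁, hyz₂]
    simp [riccatiMatrix]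
    ring

end Scalar

/-! ### Formal solutions and their relation to exact ones -/

section Formal

open PowerSeries

/-- The right-hand side of the formal Riccati equation, as a power series in `h`. -/
noncomputable def formalRhs (a b c f : ℕ → ℂ) : PowerSeries ℂ :=
  mk a * mk f ^ 2 + mk b * mk f + mk c

/-- The coefficient of index `m` of the formal right-hand side is affine in `f m`, with slope the
linearisation `2 a₀ f₀ + b₀`. -/
theorem coeff_formalRhs (a b c f : ℕ → ℂ) {m : ℕ} (hm : m ≠ 0) :
    coeff m (formalRhs a b c f) = (2 * a 0 * f 0 + b 0) * f m +
      coeff m (formalRhs a b c fun k => if k < m then f k else 0) := by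
  set g : PowerSeries ℂ := mk fun k => if k < m then f k else 0 with hg
  set v : PowerSeries ℂ := mk fun k => f (k + m) with hv
  have hf : mk f = g + X ^ m * v := by
    ext n
    rw [map_add, coeff_X_pow_mul', coeff_mk, coeff_mk]
    by_cases h : n < m
    · rw [if_pos h, if_neg (by omega), add_zero]
    · rw [if_neg h, if_pos (by omega), zero_add, hv, coeff_mk, Nat.sub_add_cancel (by omega)]
  have h1 : formalRhs a b c f = X ^ m * (v * (2 * mk a * g + mk a * (X ^ m * v) + mk b)) +
      formalRhs a b c fun k => if k < m then f k else 0 := by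
    simp only [formalRhs, ← hg, hf]
    ring
  rw [h1, map_add, coeff_X_pow_mul', if_pos le_rfl, Nat.sub_self, coeff_zero_eq_constantCoeff_apply]
  have h2 : constantCoeff g = f 0 := by
    rw [← coeff_zero_eq_constantCoeff_apply, hg, coeff_mk, if_pos (Nat.pos_of_ne_zero hm)]
  have h3 : ∀ u : ℕ → ℂ, constantCoeff (mk u) = u 0 := fun u => by
    rw [← coeff_zero_eq_constantCoeff_apply, coeff_mk]
  simp only [map_mul, map_add, h2, h3, hv, map_pow, constantCoeff_X, zero_pow hm, zero_mul,
    mul_zero, add_zero, zero_add, map_ofNat]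
  ring

theorem coeff_zero_formalRhs (a b c f : ℕ → ℂ) :
    coeff 0 (formalRhs a b c f) = a 0 * f 0 ^ 2 + b 0 * f 0 + c 0 := by
  have h3 : ∀ u : ℕ → ℂ, constantCoeff (mk u) = u 0 := fun u => by
    rw [← coeff_zero_eq_constantCoeff_apply, coeff_mk]
  simp [formalRhs, h3]

theorem differentiableOn_coeff_mul {W : Set ℂ} {p q : ℂ → PowerSeries ℂ}
    (hp : ∀ k, DifferentiableOn ℂ (fun x => coeff k (p x)) W)
    (hq : ∀ k, DifferentiableOn ℂ (fun x => coeff k (q x)) W) (k : ℕ) :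
    DifferentiableOn ℂ (fun x => coeff k (p x * q x)) W := by
  simp only [coeff_mul]
  exact DifferentiableOn.fun_sum fun i _ => (hp i.1).fun_mul (hq i.2)

theorem differentiableOn_coeff_formalRhs {W : Set ℂ} {a b c f : ℕ → ℂ → ℂ}
    (ha : ∀ k, DifferentiableOn ℂ (a k) W) (hb : ∀ k, DifferentiableOn ℂ (b k) W)
    (hc : ∀ k, DifferentiableOn ℂ (c k) W) (hf : ∀ k, DifferentiableOn ℂ (f k) W) (k : ℕ) :
    DifferentiableOn ℂ (fun x => coeff k
      (formalRhs (fun k => a k x) (fun k => b k x) (fun k => c k x) fun k => f k x)) W := by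
  have hmk : ∀ {u : ℕ → ℂ → ℂ}, (∀ k, DifferentiableOn ℂ (u k) W) →
      ∀ k, DifferentiableOn ℂ (fun x => coeff k (mk fun k => u k x)) W := fun hu k => by
    simpa only [coeff_mk] using hu k
  simp only [formalRhs, map_add, pow_two]
  exact ((differentiableOn_coeff_mul (hmk ha) (differentiableOn_coeff_mul (hmk hf) (hmk hf)) k).fun_add
    (differentiableOn_coeff_mul (hmk hb) (hmk hf) k)).fun_add (hmk hc k)

variable {W : Set ℂ} {ahat bhat chat : ℕ → ℂ → ℂ}

/-- A simple root of the leading-order equation extends to a formal solution: each coefficient is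
obtained from the preceding ones upon dividing by `2 a₀ f₀ + b₀`. -/
theorem exists_isFormalSolution (hW : IsOpen W)
    (ha : ∀ k, DifferentiableOn ℂ (ahat k) W) (hb : ∀ k, DifferentiableOn ℂ (bhat k) W)
    (hc : ∀ k, DifferentiableOn ℂ (chat k) W) {f₀ : ℂ → ℂ} (hf : DifferentiableOn ℂ f₀ W)
    (hf₀ : ∀ x ∈ W, ahat 0 x * f₀ x ^ 2 + bhat 0 x * f₀ x + chat 0 x = 0)
    (hf₁ : ∀ x ∈ W, 2 * ahat 0 x * f₀ x + bhat 0 x ≠ 0) :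
    ∃ fhat : ℕ → ℂ → ℂ, IsFormalSolution W ahat bhat chat fhat ∧ fhat 0 = f₀ := by
  obtain ⟨u, hu⟩ := exists_seq_of_step (X := ℂ → ℂ) fun n u => if n = 0 then f₀ else fun x =>
    (2 * ahat 0 x * f₀ x + bhat 0 x)⁻¹ * (deriv (u (n - 1)) x - coeff n
      (formalRhs (fun k => ahat k x) (fun k => bhat k x) (fun k => chat k x) fun k => u k x))
  have hu0 : u 0 = f₀ := by rw [hu 0, if_pos rfl]
  have hu1 : ∀ n, u (n + 1) = fun x => (2 * ahat 0 x * f₀ x + bhat 0 x)⁻¹ * (deriv (u n) x -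
      coeff (n + 1) (formalRhs (fun k => ahat k x) (fun k => bhat k x) (fun k => chat k x)
        fun k => if k < n + 1 then u k x else 0)) := by
    intro n
    rw [hu (n + 1), if_neg (by omega)]
    funext x
    have : ∀ k, (if k < n + 1 then u k else 0) x = if k < n + 1 then u k x else 0 := fun k => by
      split_ifs <;> rfl
    simp only [this, Nat.add_sub_cancel, if_pos (Nat.lt_succ_self n)]
  have hd : ∀ n, DifferentiableOn ℂ (u n) W := by
    intro n
    induction n using Nat.strong_induction_on with
    | _ n ih =>
      rcases n with _ | n
      · rwa [hu0]
      · rw [hu1 n]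
        refine DifferentiableOn.fun_mul (DifferentiableOn.fun_inv ?_ hf₁)
          (((ih n (by omega)).deriv hW).fun_sub ?_)
        · exact (((differentiableOn_const 2).fun_mul (ha 0)).fun_mul hf).fun_add (hb 0)
        · refine differentiableOn_coeff_formalRhs (f := fun k x => if k < n + 1 then u k x else 0)
            ha hb hc (fun k => ?_) (n + 1)
          by_cases hk : k < n + 1
          · simpa only [if_pos hk] using ih k hk
          · simpa only [if_neg hk] using differentiableOn_const 0
  refine ⟨u, ⟨hd, fun x hx => ?_⟩, hu0⟩
  change _ = formalRhs _ _ _ _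
  ext n
  rcases n with _ | n
  · rw [coeff_zero_formalRhs, hu0, hf₀ x hx]
    simp
  · rw [coeff_succ_X_mul, coeff_mk, coeff_formalRhs _ _ _ _ (Nat.succ_ne_zero n), hu0, hu1 n]
    have := hf₁ x hx
    field_simp
    ring

/-- A formal solution is determined by its leading term, if that is a simple root of the
leading-order equation. -/
theorem IsFormalSolution.unique (hW : IsOpen W) {fhat ghat : ℕ → ℂ → ℂ}
    (hf : IsFormalSolution W ahat bhat chat fhat) (hg : IsFormalSolution W ahat bhat chat ghat)
    (h0 : EqOn (ghat 0) (fhat 0) W) (hf₁ : ∀ x ∈ W, 2 * ahat 0 x * fhat 0 x + bhat 0 x ≠ 0) (k : ℕ) :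
    EqOn (ghat k) (fhat k) W := by
  induction k using Nat.strong_induction_on with
  | _ k ih =>
    rcases k with _ | n
    · exact h0
    intro x hx
    have e1 := congrArg (coeff (n + 1)) (hf.equation x hx)
    have e2 := congrArg (coeff (n + 1)) (hg.equation x hx)
    change _ = coeff _ (formalRhs _ _ _ _) at e1 e2
    rw [coeff_succ_X_mul, coeff_mk, coeff_formalRhs _ _ _ _ (Nat.succ_ne_zero n)] at e1 e2
    have h1 : deriv (ghat n) x = deriv (fhat n) x :=
      Filter.EventuallyEq.deriv_eq ((ih n (by omega)).eventuallyEq_of_mem (hW.mem_nhds hx))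
    have h2 : (fun k => if k < n + 1 then ghat k x else 0) =
        fun k => if k < n + 1 then fhat k x else 0 := by
      funext k
      by_cases hk : k < n + 1
      · simp only [if_pos hk, ih k hk hx]
      · simp only [if_neg hk]
    rw [h1, h2, h0 hx, e1] at e2
    exact mul_left_cancel₀ (hf₁ x hx) (add_right_cancel e2).symm

theorem IsFormalSolution.mono {W' : Set ℂ} {fhat : ℕ → ℂ → ℂ}
    (hf : IsFormalSolution W ahat bhat chat fhat) (h : W' ⊆ W) :
    IsFormalSolution W' ahat bhat chat fhat :=
  ⟨fun k => (hf.differentiableOn k).mono h, fun x hx => hf.equation x (h hx)⟩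

/-- Formal solutions are natural under a change of variable `x = ψ z` with `ψ' = 1 / s ∘ ψ`. -/
theorem IsFormalSolution.comp {H : Set ℂ} {fhat : ℕ → ℂ → ℂ}
    (hf : IsFormalSolution W ahat bhat chat fhat) (hW : IsOpen W) (hH : IsOpen H) {ψ s : ℂ → ℂ}
    (hψ : DifferentiableOn ℂ ψ H) (hψW : MapsTo ψ H W) (hs : ∀ z ∈ H, s (ψ z) * deriv ψ z = 1) :
    IsFormalSolution H (fun k z => ahat k (ψ z) / s (ψ z)) (fun k z => bhat k (ψ z) / s (ψ z))
      (fun k z => chat k (ψ z) / s (ψ z)) (fun k z => fhat k (ψ z)) := by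
  refine ⟨fun k => (hf.differentiableOn k).comp hψ hψW, fun z hz => ?_⟩
  have h1 : ∀ u : ℕ → ℂ, PowerSeries.mk (fun k => u k / s (ψ z)) =
      C (s (ψ z))⁻¹ * PowerSeries.mk u := fun u => by
    ext n
    simp [div_eq_inv_mul]
  have h2 : ∀ k, deriv (fun z => fhat k (ψ z)) z = deriv (fhat k) (ψ z) / s (ψ z) := by
    intro k
    have hd := ((hf.differentiableOn k).differentiableAt (hW.mem_nhds (hψW hz))).hasDerivAt.comp z
      (hψ.differentiableAt (hH.mem_nhds hz)).hasDerivAt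
    rw [show (fun z => fhat k (ψ z)) = fhat k ∘ ψ from rfl, hd.deriv, eq_div_iff
      (left_ne_zero_of_mul_eq_one (hs z hz)), mul_assoc, mul_comm (deriv ψ z), hs z hz, mul_one]
  simp only [h2, h1 fun k => deriv (fhat k) (ψ z), h1 fun k => ahat k (ψ z),
    h1 fun k => bhat k (ψ z), h1 fun k => chat k (ψ z)]
  linear_combination C (s (ψ z))⁻¹ * hf.equation (ψ z) (hψW hz)

end Formal

section Matching

variable {E : Type*} [NormedAddCommGroup E] [NormedSpace ℂ E] {θ d : ℝ}

/-- The coefficients of an asymptotic expansion on a Borel disc are unique. -/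
theorem coeff_unique (hd : 0 < d) {f : ℂ → E} {fk gk : ℕ → E} {K L : ℕ → ℝ}
    (hf : ∀ n, ∀ h ∈ borelDisc θ d, ‖rem (f h) fk h n‖ ≤ K n * ‖h‖ ^ n)
    (hg : ∀ n, ∀ h ∈ borelDisc θ d, ‖rem (f h) gk h n‖ ≤ L n * ‖h‖ ^ n) : fk = gk := by
  have hdiff : ∀ n, ∀ h ∈ borelDisc θ d, ‖rem (0 : E) (fk - gk) h n‖ ≤ (K n + L n) * ‖h‖ ^ n := by
    intro n h hh
    have : rem (0 : E) (fk - gk) h n = rem (f h) fk h n - rem (f h) gk h n := by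
      simp only [rem, Pi.sub_apply, smul_sub, Finset.sum_sub_distrib]
      abel
    rw [this, add_mul]
    exact (norm_sub_le _ _).trans (add_le_add (hf n h hh) (hg n h hh))
  suffices h : ∀ n, (fk - gk) n = 0 from funext fun n => sub_eq_zero.1 (h n)
  intro n
  induction n using Nat.strong_induction_on with
  | _ n ih =>
    have hne := neBot_borelDisc (θ := θ) hd
    refine norm_le_zero_iff.1 (norm_coeff_le_of_rem (tendsto_norm_borelDisc (θ := θ) (d := d)) (f := fun _ => (0 : E))
      (a := 0) (b := K (n + 1) + L (n + 1)) (n := n) ?_ ?_)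
    · refine Eventually.of_forall fun h => ?_
      have : rem (0 : E) (fk - gk) h n = 0 := by
        rw [rem, Finset.sum_eq_zero fun k hk => by rw [ih k (Finset.mem_range.1 hk), smul_zero], sub_zero]
      rw [this, norm_zero, zero_mul]
    · filter_upwards [self_mem_nhdsWithin] with h hh
      exact hdiff (n + 1) h hh

/-- The expansion of an exact solution is a formal solution: both sides of the equation have
asymptotic expansions, that of `h ∂_z f` by Cauchy's estimate, and these are unique. -/
theorem IsGevrey.isFormalSolution (hd : 0 < d) {U : Set ℂ} (hU : IsOpen U)
    {A B C f : ℂ → ℂ → ℂ} {Ak Bk Ck fk : ℕ → ℂ → ℂ}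
    (hA : IsGevrey U (borelDisc θ d) A Ak) (hB : IsGevrey U (borelDisc θ d) B Bk)
    (hC : IsGevrey U (borelDisc θ d) C Ck) (hf : IsGevrey U (borelDisc θ d) f fk)
    (hode : ∀ z ∈ U, ∀ h ∈ borelDisc θ d,
      HasDerivAt (fun z => f z h) ((A z h * f z h ^ 2 + B z h * f z h + C z h) / h) z) :
    IsFormalSolution U Ak Bk Ck fk := by
  refine ⟨hf.coeff_holo, fun z hz => ?_⟩
  have hQ := ((hA.mul hd (hf.mul hd hf)).add (hB.mul hd hf)).add hC
  obtain ⟨C₁, M₁, hC₁, hM₁, hb₁⟩ := hQ.bound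
  obtain ⟨C₂, M₂, hC₂, hM₂, hb₂⟩ := hf.bound
  obtain ⟨ρ, hρ, hball⟩ := Metric.nhds_basis_closedBall.mem_iff.1 (hU.mem_nhds hz)
  set dk : ℕ → ℂ := fun n => PowerSeries.coeff n
    (PowerSeries.X * PowerSeries.mk fun k => deriv (fk k) z : PowerSeries ℂ) with hdk
  -- Cauchy's estimate on a small disc around `z` bounds the remainders of `∂f`
  have hder : ∀ n, ∀ h ∈ borelDisc θ d,
      ‖rem (deriv (fun z => f z h) z) (fun k => deriv (fk k) z) h n‖ ≤ C₂ * gev M₂ n * ‖h‖ ^ n / ρ := by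
    intro n h hh
    have hd1 : DifferentiableOn ℂ (fun z => f z h) U := fun y hy =>
      (hode y hy h hh).differentiableAt.differentiableWithinAt
    have hd2 : DifferentiableOn ℂ (fun z => rem (f z h) (fun k => fk k z) h n) U :=
      hd1.fun_sub (DifferentiableOn.fun_sum fun k _ => (hf.coeff_holo k).fun_const_smul _)
    have hd3 : deriv (fun z => rem (f z h) (fun k => fk k z) h n) z =
        rem (deriv (fun z => f z h) z) (fun k => deriv (fk k) z) h n :=
      ((hd1.differentiableAt (hU.mem_nhds hz)).hasDerivAt.fun_sub
        (HasDerivAt.fun_sum fun k _ =>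
          (((hf.coeff_holo k).differentiableAt (hU.mem_nhds hz)).hasDerivAt.fun_const_smul _))).deriv
    rw [← hd3]
    refine Complex.norm_deriv_le_of_forall_mem_sphere_norm_le hρ
      (DifferentiableOn.diffContOnCl ?_) fun y hy =>
        hb₂ n y (hball (Metric.sphere_subset_closedBall hy)) h hh
    rw [closure_ball z hρ.ne']
    exact hd2.mono hball
  have hleft : ∀ n, ∀ h ∈ borelDisc θ d, ‖rem (h * deriv (fun z => f z h) z) dk h n‖ ≤
      (d * (C₂ / ρ) + C₂ * gev M₂ (n - 1) / ρ) * ‖h‖ ^ n := by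
    intro n h hh
    rcases n with _ | n
    · have h1 := hder 0 h hh
      simp only [rem_zero, gev_zero, pow_zero, mul_one] at h1 ⊢
      rw [norm_mul]
      refine (mul_le_mul (norm_lt_of_mem_borelDisc hd hh).le h1 (norm_nonneg _) hd.le).trans ?_
      have := gev_nonneg hM₂.le (0 - 1)
      exact le_add_of_nonneg_right (by positivity)
    · have h1 : rem (h * deriv (fun z => f z h) z) dk h (n + 1) =
          h * rem (deriv (fun z => f z h) z) (fun k => deriv (fk k) z) h n := by
        simp only [rem, Finset.sum_range_succ', hdk, PowerSeries.coeff_succ_X_mul,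
          PowerSeries.coeff_mk, PowerSeries.coeff_zero_X_mul, smul_eq_mul, mul_zero, add_zero, mul_sub,
          Finset.mul_sum, pow_succ']
        congr 1
        exact Finset.sum_congr rfl fun k _ => by ring
      rw [h1, norm_mul, Nat.add_sub_cancel, add_mul]
      refine (mul_le_mul_of_nonneg_left (hder n h hh) (norm_nonneg _)).trans ?_
      refine le_trans (le_of_eq ?_) (le_add_of_nonneg_left (by positivity))
      ring
  have hright : ∀ h ∈ borelDisc θ d, A z h * (f z h * f z h) + B z h * f z h + C z h =
      h * deriv (fun z => f z h) z := by
    intro h hh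
    rw [(hode z hz h hh).deriv, mul_div_cancel₀ _ hh.1]
    ring
  have hmain := coeff_unique hd (f := fun h => h * deriv (fun z => f z h) z) hleft
    (fun n h hh => (congrArg (fun x => ‖rem x _ h n‖) (hright h hh)).symm.trans_le
      (hb₁ n z hz h hh))
  ext n
  have := congrFun hmain n
  rw [hdk] at this
  refine this.trans ?_
  simp [pow_two, PowerSeries.coeff_mul, conv, Finset.mul_sum]

end Matching

/-! ### Nevanlinna's uniqueness theorem -/

section Nevanlinna

/-- Summing the estimates of all orders with weights `(2 M)⁻ⁿ / n!` turns them into exponential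
decay. -/
theorem exp_mul_le_of_forall_gev {a C M g : ℝ} (hM : 0 < M)
    (hg : ∀ n, a ^ n * g ≤ C * gev M n) : Real.exp (a / (2 * M)) * g ≤ 2 * C := by
  have h1 : HasSum (fun n : ℕ => (a / (2 * M)) ^ n / n.factorial * g) (Real.exp (a / (2 * M)) * g) := by
    rw [Real.exp_eq_exp_ℝ]
    exact (NormedSpace.expSeries_div_hasSum_exp (a / (2 * M))).mul_right g
  have h2 : HasSum (fun n : ℕ => (1 / 2 : ℝ) ^ n * C) (2 * C) := hasSum_geometric_two.mul_right C
  refine hasSum_le (fun n => ?_) h1 h2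
  have h3 := hg n
  have hf : (0 : ℝ) < n.factorial := by exact_mod_cast n.factorial_pos
  have h4 : (a / (2 * M)) ^ n / n.factorial * g = (1 / 2 : ℝ) ^ n * (a ^ n * g / gev M n) := by
    rw [gev, div_pow, mul_pow, one_div, inv_pow]
    field_simp
  rw [h4]
  refine mul_le_mul_of_nonneg_left ?_ (by positivity)
  rwa [div_le_iff₀ (gev_pos hM n)]

/-- On the right half-plane `log |q + 1| ≥ 0` and `|arg (q + 1)| ≤ π / 2`, so that only
`-(Im q) arg (q + 1)` can make the real part of `(q + 1) log (q + 1)` negative. -/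
theorem neg_le_re_mul_log {q : ℂ} (hq : 0 ≤ q.re) :
    -(Real.pi / 2 * ‖q‖) ≤ ((q + 1) * Complex.log (q + 1)).re := by
  have h1 : 1 ≤ ‖q + 1‖ := by
    refine le_trans ?_ (Complex.re_le_norm _)
    simp [hq]
  rw [Complex.mul_re, Complex.log_re, Complex.log_im]
  have h2 : 0 ≤ (q + 1).re * Real.log ‖q + 1‖ :=
    mul_nonneg (by simp; linarith) (Real.log_nonneg h1)
  have h3 : |(q + 1).arg| ≤ Real.pi / 2 := Complex.abs_arg_le_pi_div_two_iff.2 (by simp; linarith)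
  have h4 : (q + 1).im * (q + 1).arg ≤ Real.pi / 2 * ‖q‖ := by
    refine (le_abs_self _).trans ?_
    rw [abs_mul, mul_comm]
    refine mul_le_mul h3 ?_ (abs_nonneg _) (by positivity)
    simpa using Complex.abs_im_le_norm q
  linarith

/-- A bounded multiple of `exp (-a |q|)` that is holomorphic on the closed right half-plane
vanishes: multiplied by `exp (-(2a/π) (q + 1) log (q + 1))` it stays bounded but decays
superexponentially on the real axis, so the Phragmén-Lindelöf principle applies. -/
theorem eq_zero_of_exp_decay {G : ℂ → ℂ} {a C : ℝ} (ha : 0 < a)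
    (hG : DiffContOnCl ℂ G {q | 0 < q.re})
    (hb : ∀ q : ℂ, 0 ≤ q.re → ‖G q‖ ≤ C * Real.exp (-a * ‖q‖)) : ∀ q : ℂ, 0 ≤ q.re → G q = 0 := by
  set b := 2 * a / Real.pi with hbdef
  have hb0 : 0 < b := div_pos (by positivity) Real.pi_pos
  set E : ℂ → ℂ := fun q => Complex.exp (-b * ((q + 1) * Complex.log (q + 1))) with hE
  have hEn : ∀ q, ‖E q‖ = Real.exp (-b * ((q + 1) * Complex.log (q + 1)).re) := by
    intro q
    rw [hE, Complex.norm_exp, ← Complex.ofReal_neg, Complex.re_ofReal_mul]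
  have hC : 0 ≤ C := by
    have := (norm_nonneg _).trans (hb 0 (by simp))
    simpa using this
  have hEa : ∀ q : ℂ, 0 ≤ q.re → ‖E q‖ ≤ Real.exp (a * ‖q‖) := by
    intro q hq
    rw [hEn, Real.exp_le_exp]
    have h1 := mul_le_mul_of_nonneg_left (neg_le_re_mul_log hq) hb0.le
    have h2 : b * (Real.pi / 2 * ‖q‖) = a * ‖q‖ := by
      rw [hbdef]; field_simp [Real.pi_ne_zero]
    linarith
  have hbd : ∀ q : ℂ, 0 ≤ q.re → ‖E q * G q‖ ≤ C := by
    intro q hq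
    rw [norm_mul]
    calc _ ≤ Real.exp (a * ‖q‖) * (C * Real.exp (-a * ‖q‖)) :=
          mul_le_mul (hEa q hq) (hb q hq) (norm_nonneg _) (Real.exp_pos _).le
      _ = C * (Real.exp (a * ‖q‖ + -a * ‖q‖)) := by rw [Real.exp_add]; ring
      _ = C := by simp
  have hEd : ∀ q : ℂ, 0 ≤ q.re → DifferentiableAt ℂ E q := by
    intro q hq
    have h1 : q + 1 ∈ Complex.slitPlane := Or.inl (by simp; linarith)
    have h2 : DifferentiableAt ℂ (fun q : ℂ => q + 1) q := by fun_prop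
    exact ((h2.mul (h2.clog h1)).const_mul _).cexp
  have hcl : closure {q : ℂ | 0 < q.re} = {q | 0 ≤ q.re} := Complex.closure_setOfPred_lt_re 0
  have hED : DiffContOnCl ℂ E {q | 0 < q.re} := DifferentiableOn.diffContOnCl fun q hq => by
    rw [hcl] at hq
    exact (hEd q hq).differentiableWithinAt
  have hkey := PhragmenLindelof.eq_zero_on_right_half_plane_of_superexponential_decay
    (f := fun q => E q * G q) (hED.smul hG) ⟨0, by norm_num, 0, ?_⟩ ?_ ⟨C, fun y => ?_⟩
  · intro q hq
    exact (mul_eq_zero.1 (hkey hq)).resolve_left (Complex.exp_ne_zero _)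
  · refine Asymptotics.IsBigO.of_bound C ?_
    refine eventually_of_mem (mem_inf_of_right (mem_principal_self _)) fun q hq => ?_
    simpa using hbd q (le_of_lt hq)
  · intro n
    have hlog : Tendsto (fun x : ℝ => b * Real.log (x + 1)) atTop atTop :=
      (Real.tendsto_log_atTop.comp (tendsto_atTop_add_const_right _ _ tendsto_id)).const_mul_atTop hb0
    have hdec : Tendsto (fun x : ℝ => C * Real.exp (-x)) atTop (𝓝 0) := by
      simpa using (Real.tendsto_exp_neg_atTop_nhds_zero).const_mul C
    refine squeeze_zero_norm' ?_ hdec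
    filter_upwards [hlog.eventually_ge_atTop (n + 1 : ℝ), eventually_ge_atTop 0] with x hx hx0
    rw [norm_mul, norm_pow, norm_norm, norm_mul, hEn]
    have e1 : (((x : ℂ) + 1) * Complex.log (x + 1)).re = (x + 1) * Real.log (x + 1) := by
      rw [show (x : ℂ) + 1 = ((x + 1 : ℝ) : ℂ) by push_cast; rfl, ← Complex.ofReal_log (by linarith),
        ← Complex.ofReal_mul, Complex.ofReal_re]
    have e2 : ‖G x‖ ≤ C := (hb x (by simpa using hx0)).trans
      (mul_le_of_le_one_right hC (Real.exp_le_one_iff.2 (by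
        have := mul_nonneg ha.le (norm_nonneg (x : ℂ)); linarith)))
    rw [e1, Real.norm_eq_abs, Real.abs_exp, ← Real.exp_nat_mul]
    calc _ ≤ Real.exp (n * x) * (Real.exp (-b * ((x + 1) * Real.log (x + 1))) * C) := by gcongr
      _ = C * Real.exp (n * x + -b * ((x + 1) * Real.log (x + 1))) := by rw [Real.exp_add]; ring
      _ ≤ C * Real.exp (-x) := by
        refine mul_le_mul_of_nonneg_left (Real.exp_le_exp.2 ?_) hC
        have := mul_le_mul_of_nonneg_right hx (by linarith : 0 ≤ x + 1)
        nlinarith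
  · exact hbd _ (by simp)

/-- **Nevanlinna's uniqueness theorem**: a holomorphic function on a Borel disc with vanishing
Gevrey expansion is zero. In the variable `p = e^{iθ} / h` the disc is a half-plane, on which the
function decays exponentially. -/
theorem eq_zero_of_gevrey_flat {θ d : ℝ} (hd : 0 < d) {F : ℂ → ℂ}
    (hF : DifferentiableOn ℂ F (borelDisc θ d)) {C M : ℝ} (hM : 0 < M)
    (hb : ∀ n, ∀ h ∈ borelDisc θ d, ‖F h‖ ≤ C * gev M n * ‖h‖ ^ n) :
    ∀ h ∈ borelDisc θ d, F h = 0 := by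
  intro h₀ hh₀
  have hω : ‖Complex.exp (θ * Complex.I)‖ = 1 := norm_exp_mul_I θ
  have hω0 : Complex.exp (θ * Complex.I) ≠ 0 := Complex.exp_ne_zero _
  set ω := Complex.exp (θ * Complex.I) with hωdef
  set R := (ω / h₀).re with hR
  have hRd : 1 / d < R := hh₀.2
  have hR0 : 0 < R := (by positivity : 0 < 1 / d).trans hRd
  have hne : ∀ q : ℂ, 0 ≤ q.re → q + R ≠ 0 := fun q hq h0 => by
    have := congrArg Complex.re h0
    simp at this
    linarith
  have hmem : ∀ q : ℂ, 0 ≤ q.re → ω / (q + R) ∈ borelDisc θ d := fun q hq => by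
    refine ⟨div_ne_zero hω0 (hne q hq), ?_⟩
    rw [← hωdef, div_div_cancel₀ hω0]
    simp
    simp at hRd
    linarith
  have hGd : DiffContOnCl ℂ (fun q : ℂ => F (ω / (q + R))) {q | 0 < q.re} := by
    refine DifferentiableOn.diffContOnCl ?_
    rw [Complex.closure_setOfPred_lt_re]
    refine hF.comp (fun q hq => ?_) fun q hq => hmem q hq
    have h1 : DifferentiableAt ℂ (fun q : ℂ => q + R) q := by fun_prop
    exact ((differentiableAt_const ω).div h1 (hne q hq)).differentiableWithinAt
  have hGb : ∀ q : ℂ, 0 ≤ q.re →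
      ‖F (ω / (q + R))‖ ≤ 2 * C * Real.exp (-(1 / (2 * M)) * ‖q‖) := by
    intro q hq
    have hn : ‖ω / (q + R)‖ = 1 / ‖q + R‖ := by rw [norm_div, hω]
    have hpos : 0 < ‖q + R‖ := norm_pos_iff.2 (hne q hq)
    have h1 := exp_mul_le_of_forall_gev hM (g := ‖F (ω / (q + R))‖) (C := C) fun n => by
      have h2 := hb n _ (hmem q hq)
      rw [hn, one_div, inv_pow, ← div_eq_mul_inv, le_div_iff₀ (by positivity)] at h2
      linarith
    have h3 : ‖q‖ ≤ ‖q + R‖ := by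
      rw [← sq_le_sq₀ (norm_nonneg _) (norm_nonneg _), Complex.sq_norm, Complex.sq_norm,
        Complex.normSq_apply, Complex.normSq_apply]
      simp
      nlinarith
    have h4 : Real.exp (1 / (2 * M) * ‖q‖) ≤ Real.exp (‖q + R‖ / (2 * M)) := by
      rw [Real.exp_le_exp, one_div_mul_eq_div]
      gcongr
    have h5 := (mul_le_mul_of_nonneg_right h4 (norm_nonneg (F (ω / (q + R))))).trans h1
    rw [neg_mul, Real.exp_neg, ← div_eq_mul_inv, le_div_iff₀ (Real.exp_pos _)]
    linarith
  have h1 := eq_zero_of_exp_decay (by positivity) hGd hGb (ω / h₀ - R) (by simp [hR])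
  simpa [div_div_cancel₀ hω0] using h1

end Nevanlinna

/-! ### Borel discs are sectorial domains -/

section Sectorial

theorem mem_borelDisc_iff {θ d : ℝ} (hd : 0 < d) {h : ℂ} :
    h ∈ borelDisc θ d ↔ ‖h‖ ^ 2 < d * (h * Complex.exp (-(θ * Complex.I))).re := by
  have hre : (h * Complex.exp (-(θ * Complex.I))).re = h.re * Real.cos θ + h.im * Real.sin θ := by
    rw [← neg_mul, ← Complex.ofReal_neg, Complex.mul_re, Complex.exp_ofReal_mul_I_re,
      Complex.exp_ofReal_mul_I_im, Real.cos_neg, Real.sin_neg]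
    ring
  have hre' : (Complex.exp (θ * Complex.I) / h).re = (h.re * Real.cos θ + h.im * Real.sin θ) / ‖h‖ ^ 2 := by
    rw [Complex.div_re, Complex.exp_ofReal_mul_I_re, Complex.exp_ofReal_mul_I_im,
      ← Complex.sq_norm]
    ring
  rw [borelDisc, mem_ofPred_eq, hre, hre']
  rcases eq_or_ne h 0 with rfl | h0
  · simp
  have hp : 0 < ‖h‖ ^ 2 := by positivity
  rw [div_lt_div_iff₀ hd hp, one_mul, mul_comm d]
  exact and_iff_right h0

/-- Borel discs are Euclidean discs, tangent at the origin to the line orthogonal to their axis. -/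
theorem borelDisc_eq_ball {θ d : ℝ} (hd : 0 < d) :
    borelDisc θ d = Metric.ball ((d / 2 : ℝ) * Complex.exp (θ * Complex.I)) (d / 2) := by
  ext h
  rw [mem_borelDisc_iff hd, Metric.mem_ball, dist_eq_norm,
    ← sq_lt_sq₀ (norm_nonneg _) (by positivity)]
  have hre : (h * Complex.exp (-(θ * Complex.I))).re = h.re * Real.cos θ + h.im * Real.sin θ := by
    rw [← neg_mul, ← Complex.ofReal_neg, Complex.mul_re, Complex.exp_ofReal_mul_I_re,
      Complex.exp_ofReal_mul_I_im, Real.cos_neg, Real.sin_neg]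
    ring
  rw [hre, Complex.sq_norm, Complex.sq_norm, Complex.normSq_apply, Complex.normSq_apply,
    Complex.sub_re, Complex.sub_im, Complex.re_ofReal_mul, Complex.im_ofReal_mul,
    Complex.exp_ofReal_mul_I_re, Complex.exp_ofReal_mul_I_im]
  have := Real.sin_sq_add_cos_sq θ
  constructor <;> intro h1 <;> nlinarith

theorem directionsAtZero_borelDisc {θ d : ℝ} (hd : 0 < d) : directionsAtZero (borelDisc θ d) =
    {u : ℂ | ‖u‖ = 1 ∧ 0 ≤ (u * Complex.exp (-(θ * Complex.I))).re} := by
  have hK : IsClosed {u : ℂ | ‖u‖ = 1 ∧ 0 ≤ (u * Complex.exp (-(θ * Complex.I))).re} :=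
    (isClosed_eq continuous_norm continuous_const).inter
      (isClosed_le continuous_const (Complex.continuous_re.comp (by fun_prop)))
  apply subset_antisymm
  · intro u hu
    refine hK.closure_subset (mem_closure_iff_clusterPt.2 (ClusterPt.mono hu ?_))
    rw [le_principal_iff, mem_map]
    filter_upwards [self_mem_nhdsWithin] with h hh
    have h0 : 0 < ‖h‖ := norm_pos_iff.2 hh.1.1
    have h1 := (mem_borelDisc_iff hd).1 hh.1
    refine ⟨by simp [h0.ne'], ?_⟩
    rw [div_mul_eq_mul_div, Complex.div_ofReal_re]
    have : 0 < d * (h * Complex.exp (-(θ * Complex.I))).re := lt_of_le_of_lt (by positivity) h1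
    exact div_nonneg (pos_of_mul_pos_right this hd.le).le h0.le
  · rintro u ⟨hu, hre⟩
    -- the curve `s ↦ s² (u + s e^{iθ})` enters the disc in the direction `u`
    set ω := Complex.exp (θ * Complex.I) with hω
    have hωn : ‖ω‖ = 1 := norm_exp_mul_I θ
    set φ : ℝ → ℂ := fun s => ((s ^ 2 : ℝ) : ℂ) * (u + s * ω) with hφ
    have hcont : Continuous fun s : ℝ => u + s * ω := by fun_prop
    have hmem : ∀ᶠ s : ℝ in 𝓝[>] 0, φ s ∈ borelDisc θ d := by
      have hm : 0 < min 1 (d / 4) := lt_min one_pos (by positivity)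
      filter_upwards [Ioo_mem_nhdsGT hm] with s hs
      obtain ⟨hs0, hs1⟩ := hs
      obtain ⟨hs2, hs3⟩ := lt_min_iff.1 hs1
      rw [mem_borelDisc_iff hd]
      have e1 : ‖φ s‖ ≤ s ^ 2 * 2 := by
        rw [hφ, norm_mul, Complex.norm_real, Real.norm_of_nonneg (by positivity)]
        refine mul_le_mul_of_nonneg_left ((norm_add_le _ _).trans ?_) (by positivity)
        rw [norm_mul, hωn, hu, Complex.norm_real, Real.norm_of_nonneg hs0.le]
        linarith
      have e2 : (φ s * Complex.exp (-(θ * Complex.I))).re =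
          s ^ 2 * ((u * Complex.exp (-(θ * Complex.I))).re + s) := by
        have : φ s * Complex.exp (-(θ * Complex.I)) =
            ((s ^ 2 : ℝ) : ℂ) * (u * Complex.exp (-(θ * Complex.I)) + (s : ℝ)) := by
          have : ω * Complex.exp (-(θ * Complex.I)) = 1 := by
            rw [hω, ← Complex.exp_add, add_neg_cancel, Complex.exp_zero]
          rw [hφ]
          linear_combination ((s ^ 2 : ℝ) : ℂ) * s * this
        rw [this, Complex.re_ofReal_mul, Complex.add_re, Complex.ofReal_re]
      rw [e2]
      have e3 : ‖φ s‖ ^ 2 ≤ (s ^ 2 * 2) ^ 2 := pow_le_pow_left₀ (norm_nonneg _) e1 2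
      have e4 : (s ^ 2 * 2) ^ 2 < d * (s ^ 2 * s) := by
        have : 0 < s ^ 3 := by positivity
        nlinarith
      have e5 : 0 ≤ d * (s ^ 2 * (u * Complex.exp (-(θ * Complex.I))).re) := by positivity
      linarith
    have hφ0 : Tendsto φ (𝓝[>] 0) (𝓝[borelDisc θ d \ {0}] 0) := by
      refine tendsto_nhdsWithin_iff.2 ⟨?_, hmem.mono fun s hs => ⟨hs, hs.1⟩⟩
      have : Tendsto φ (𝓝 0) (𝓝 (φ 0)) := by
        apply Continuous.tendsto
        fun_prop
      simpa [hφ] using this.mono_left nhdsWithin_le_nhds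
    refine MapClusterPt.of_comp hφ0 (Tendsto.mapClusterPt ?_)
    have hlim : Tendsto (fun s : ℝ => (u + s * ω) / (‖u + s * ω‖ : ℂ)) (𝓝[>] 0) (𝓝 u) := by
      have : ContinuousAt (fun s : ℝ => (u + s * ω) / (‖u + s * ω‖ : ℂ)) 0 := by
        refine hcont.continuousAt.div ?_ (by simp [hu])
        exact (Complex.continuous_ofReal.comp hcont.norm).continuousAt
      have h2 := this.tendsto.mono_left (nhdsWithin_le_nhds (s := Ioi 0))
      simpa [hu] using h2
    refine hlim.congr' ?_
    filter_upwards [self_mem_nhdsWithin] with s hs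
    have hs0 : 0 < s := hs
    have hs2 : ((s ^ 2 : ℝ) : ℂ) ≠ 0 := by
      exact_mod_cast (by positivity : s ^ 2 ≠ 0)
    simp only [Function.comp, hφ, norm_mul, Complex.norm_real]
    rw [Real.norm_of_nonneg (by positivity), Complex.ofReal_mul, mul_div_mul_left _ _ hs2]

/-- Borel discs are sectorial domains. -/
theorem isSectorialDomain_borelDisc {θ d : ℝ} (hd : 0 < d) :
    IsSectorialDomain θ (borelDisc θ d) where
  isOpen := isOpen_borelDisc
  simplyConnected := by
    rw [borelDisc_eq_ball hd]
    have := (convex_ball ((d / 2 : ℝ) * Complex.exp (θ * Complex.I)) (d / 2)).contractibleSpace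
      (Metric.nonempty_ball.2 (by positivity))
    exact SimplyConnectedSpace.ofContractible _
  zero_notMem := fun h => h.1 rfl
  directions := directionsAtZero_borelDisc hd
  borel := ⟨d, hd, subset_rfl⟩

theorem isPreconnected_borelDisc {θ d : ℝ} (hd : 0 < d) : IsPreconnected (borelDisc θ d) := by
  rw [borelDisc_eq_ball hd]
  exact (convex_ball _ _).isPreconnected

end Sectorial

/-! ### The leading-order solution and the Liouville coordinate -/

section Leading

variable {X W : Set ℂ} {ahat bhat chat : ℕ → ℂ → ℂ} {s : ℂ → ℂ} {ε : ℝ}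

theorem leadingSolution_spec (hε : ε = 1 ∨ ε = -1) {x : ℂ}
    (hsD : s x ^ 2 = disc₀ ahat bhat chat x) (hs : s x ≠ 0)
    (hminus : ε = -1 → ahat 0 x ≠ 0) (hplus : ε = 1 → ahat 0 x = 0 → s x = bhat 0 x) :
    2 * ahat 0 x * leadingSolution ahat bhat chat s ε x + bhat 0 x = ε * s x ∧
    ahat 0 x * leadingSolution ahat bhat chat s ε x ^ 2 +
      bhat 0 x * leadingSolution ahat bhat chat s ε x + chat 0 x = 0 := by
  have hεε : (ε : ℂ) * ε = 1 := by rcases hε with rfl | rfl <;> simp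
  unfold leadingSolution
  by_cases ha : ahat 0 x = 0
  · have hε1 : ε = 1 := hε.resolve_right fun h => hminus h ha
    have hb := hplus hε1 ha
    have hb0 : bhat 0 x ≠ 0 := hb ▸ hs
    rw [if_pos ha, ha, hε1, hb]
    constructor
    · push_cast; ring
    · field_simp
      ring
  · rw [if_neg ha]
    have h1 : 2 * ahat 0 x * ((-bhat 0 x + ε * s x) / (2 * ahat 0 x)) + bhat 0 x = ε * s x := by
      field_simp
      ring
    refine ⟨h1, ?_⟩
    generalize (-bhat 0 x + ε * s x) / (2 * ahat 0 x) = f at h1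
    rw [disc₀] at hsD
    have h4 : 4 * ahat 0 x * (ahat 0 x * f ^ 2 + bhat 0 x * f + chat 0 x) = 0 := by
      linear_combination (2 * ahat 0 x * f + bhat 0 x + ε * s x) * h1 + s x ^ 2 * hεε + hsD
    exact (mul_eq_zero.1 h4).resolve_left (by simpa using ha)

/-- Across the zeros of `a₀` the leading solution is given by the conjugate formula
`-2 c₀ / (b₀ + s)`, hence is holomorphic. -/
theorem differentiableOn_leadingSolution (hε : ε = 1 ∨ ε = -1) (hW : IsOpen W)
    (ha : DifferentiableOn ℂ (ahat 0) W) (hb : DifferentiableOn ℂ (bhat 0) W)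
    (hc : DifferentiableOn ℂ (chat 0) W) (hsd : DifferentiableOn ℂ s W)
    (hsD : ∀ x ∈ W, s x ^ 2 = disc₀ ahat bhat chat x) (hs : ∀ x ∈ W, s x ≠ 0)
    (hminus : ε = -1 → ∀ x ∈ W, ahat 0 x ≠ 0)
    (hplus : ε = 1 → ∀ x ∈ W, ahat 0 x = 0 → s x = bhat 0 x) :
    DifferentiableOn ℂ (leadingSolution ahat bhat chat s ε) W := by
  intro x hx
  have hxW := hW.mem_nhds hx
  have ha' := ha.differentiableAt hxW
  have hb' := hb.differentiableAt hxW
  have hc' := hc.differentiableAt hxW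
  have hs' := hsd.differentiableAt hxW
  refine DifferentiableAt.differentiableWithinAt ?_
  by_cases hax : ahat 0 x = 0
  · have hε1 : ε = 1 := hε.resolve_right fun h => hminus h x hx hax
    have h2 : bhat 0 x + s x ≠ 0 := by
      rw [← hplus hε1 x hx hax, ← two_mul]
      simpa using hs x hx
    have hev : ∀ᶠ y in 𝓝 x, bhat 0 y + s y ≠ 0 :=
      (hb'.continuousAt.add hs'.continuousAt).eventually_ne h2
    have h3 : DifferentiableAt ℂ (fun y => -2 * chat 0 y / (bhat 0 y + s y)) x :=
      ((differentiableAt_const _).fun_mul hc').fun_div (hb'.fun_add hs') h2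
    refine h3.congr_of_eventuallyEq ?_
    filter_upwards [hev, hxW] with y hy hyW
    obtain ⟨e1, e2⟩ := leadingSolution_spec hε (hsD y hyW) (hs y hyW) (fun h => hminus h y hyW)
      (fun h => hplus h y hyW)
    rw [eq_div_iff hy]
    rw [hε1] at e1 e2 ⊢
    push_cast at e1
    linear_combination 2 * e2 - leadingSolution ahat bhat chat s 1 y * e1
  · have h3 : DifferentiableAt ℂ (fun y => (-bhat 0 y + ε * s y) / (2 * ahat 0 y)) x :=
      (hb'.fun_neg.fun_add ((differentiableAt_const _).fun_mul hs')).fun_div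
        ((differentiableAt_const _).fun_mul ha') (by simpa using hax)
    refine h3.congr_of_eventuallyEq ?_
    filter_upwards [ha'.continuousAt.eventually_ne hax] with y hy
    rw [leadingSolution, if_neg hy]

end Leading

section Pullback

theorem remainder_eq_rem (f : ℂ → ℂ → ℂ) (fhat : ℕ → ℂ → ℂ) (n : ℕ) (x h : ℂ) :
    remainder f fhat n x h = rem (f x h) (fun k => fhat k x) h n := by
  simp only [remainder, rem, smul_eq_mul]
  congr 1
  exact Finset.sum_congr rfl fun k _ => mul_comm _ _

/-- Gevrey asymptotics with respect to the scale `s` become plain Gevrey asymptotics of the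
coefficient divided by `s`, in the Liouville coordinate `z`. -/
theorem exists_isGevrey_pullback {θ : ℝ} {X W S H : Set ℂ} {s ψ : ℂ → ℂ} {a : ℂ → ℂ → ℂ}
    {ahat : ℕ → ℂ → ℂ} (hWX : W ⊆ X) (ha : DifferentiableOn ℂ (Function.uncurry a) (X ×ˢ S))
    (hahat : ∀ k, DifferentiableOn ℂ (ahat k) X) (hsd : DifferentiableOn ℂ s W)
    (hs : ∀ x ∈ W, s x ≠ 0) (hψ : DifferentiableOn ℂ ψ H) (hψW : MapsTo ψ H W)
    (hG : UnifGevreyAsymptotic θ W S s a ahat) :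
    ∃ d, 0 < d ∧ borelDisc θ d ⊆ S ∧ IsGevrey H (borelDisc θ d)
      (fun z h => a (ψ z) h / s (ψ z)) (fun k z => ahat k (ψ z) / s (ψ z)) := by
  obtain ⟨S', hS'S, hS', C, M, hC, hM, hb⟩ := hG
  obtain ⟨d, hd, hdS'⟩ := hS'.borel
  have hsψ : DifferentiableOn ℂ (fun z => (s (ψ z))⁻¹) H :=
    (hsd.comp hψ hψW).fun_inv fun z hz => hs _ (hψW hz)
  refine ⟨d, hd, hdS'.trans hS'S, ?_, fun k => ?_, C, M, hC, hM, fun n z hz h hh => ?_⟩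
  · have h1 : DifferentiableOn ℂ (fun x : ℂ × ℂ => (ψ x.1, x.2)) (H ×ˢ borelDisc θ d) :=
      (hψ.comp differentiableOn_fst fun x hx => hx.1).prodMk differentiableOn_snd
    have h2 : DifferentiableOn ℂ (fun x : ℂ × ℂ => a (ψ x.1) x.2) (H ×ˢ borelDisc θ d) :=
      ha.comp h1 fun x hx => ⟨hWX (hψW hx.1), hS'S (hdS' hx.2)⟩
    have h3 : DifferentiableOn ℂ (fun x : ℂ × ℂ => (s (ψ x.1))⁻¹) (H ×ˢ borelDisc θ d) :=
      hsψ.comp differentiableOn_fst fun x hx => hx.1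
    exact (h2.mul h3).congr fun x _ => div_eq_mul_inv _ _
  · exact (((hahat k).mono hWX).comp hψ hψW).mul hsψ |>.congr fun x _ => div_eq_mul_inv _ _
  · have h1 := hb n (ψ z) (hψW hz) h (hdS' hh)
    have hs0 : 0 < ‖s (ψ z)‖ := norm_pos_iff.2 (hs _ (hψW hz))
    have h2 : rem (a (ψ z) h / s (ψ z)) (fun k => ahat k (ψ z) / s (ψ z)) h n =
        remainder a ahat n (ψ z) h / s (ψ z) := by
      rw [remainder_eq_rem]
      simp only [rem, smul_eq_mul, sub_div, Finset.sum_div, mul_div_assoc]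
    rw [h2, norm_div, div_le_iff₀ hs0]
    refine h1.trans (le_of_eq ?_)
    rw [gev]
    ring

end Pullback

section Param

variable {H : Set ℂ} {ψ : ℂ → ℂ}

theorem hasStrictDerivAt_of_differentiableOn (hH : IsOpen H) (hψ : DifferentiableOn ℂ ψ H) {z : ℂ}
    (hz : z ∈ H) : HasStrictDerivAt ψ (deriv ψ z) z :=
  (hψ.analyticAt (hH.mem_nhds hz)).hasStrictDerivAt

theorem isOpen_image_of_deriv_ne_zero (hH : IsOpen H) (hψ : DifferentiableOn ℂ ψ H)
    (hd : ∀ z ∈ H, deriv ψ z ≠ 0) {O : Set ℂ} (hO : IsOpen O) (hOH : O ⊆ H) : IsOpen (ψ '' O) := by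
  refine isOpen_iff_mem_nhds.2 ?_
  rintro _ ⟨z, hz, rfl⟩
  rw [← (hasStrictDerivAt_of_differentiableOn hH hψ (hOH hz)).map_nhds_eq (hd z (hOH hz))]
  exact image_mem_map (hO.mem_nhds hz)

/-- A compact subset of the image of a halfstrip is covered by the image of a smaller halfstrip,
cut down to a sublevel set of a given function. -/
theorem exists_cover_of_isCompact {θ ε : ℝ} {z₁ : ℂ} {r : ℝ} (hr : 0 < r)
    (hψ : DifferentiableOn ℂ ψ (halfstrip θ ε z₁ r)) (hd : ∀ z ∈ halfstrip θ ε z₁ r, deriv ψ z ≠ 0)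
    {F : ℂ → ℂ} (hF : ContinuousOn F (halfstrip θ ε z₁ r)) {K : Set ℂ} (hK : IsCompact K)
    (hKW : K ⊆ ψ '' halfstrip θ ε z₁ r) :
    ∃ r' R : ℝ, 0 < r' ∧ r' < r ∧ IsOpen (halfstrip θ ε z₁ r' ∩ {z | ‖F z‖ < R}) ∧
      K ⊆ ψ '' (halfstrip θ ε z₁ r' ∩ {z | ‖F z‖ < R}) := by
  set ρ : ℕ → ℝ := fun n => r * (1 - 1 / ((n : ℝ) + 2)) with hρ
  set O : ℕ → Set ℂ := fun n => halfstrip θ ε z₁ (ρ n) ∩ {z | ‖F z‖ < n} with hO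
  have hρr : ∀ n, 0 < ρ n ∧ ρ n < r := by
    intro n
    have h1 : 1 / ((n : ℝ) + 2) < 1 := by
      rw [div_lt_one (by positivity)]
      have : (0 : ℝ) ≤ n := n.cast_nonneg
      linarith
    have h2 : 0 < 1 / ((n : ℝ) + 2) := by positivity
    exact ⟨mul_pos hr (by linarith), by nlinarith [hρ]⟩
  have hmono : Monotone O := by
    intro m n hmn z hz
    have h0 : (m : ℝ) ≤ n := Nat.cast_le.2 hmn
    refine ⟨halfstrip_mono ?_ hz.1, lt_of_lt_of_le hz.2 h0⟩
    refine mul_le_mul_of_nonneg_left (sub_le_sub_left ?_ 1) hr.le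
    exact one_div_le_one_div_of_le (by positivity) (by linarith)
  have hopen : ∀ n, IsOpen (O n) := fun n =>
    (hF.mono (halfstrip_mono (hρr n).2.le)).norm.isOpen_inter_preimage isOpen_halfstrip isOpen_Iio
  have hsub : ∀ n, O n ⊆ halfstrip θ ε z₁ r := fun n =>
    inter_subset_left.trans (halfstrip_mono (hρr n).2.le)
  have hlim : Tendsto ρ atTop (𝓝 r) := by
    have h1 : Tendsto (fun n : ℕ => 1 / ((n : ℝ) + 2)) atTop (𝓝 0) := by
      simp only [one_div]
      exact tendsto_inv_atTop_zero.comp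
        (tendsto_atTop_add_const_right _ (2 : ℝ) tendsto_natCast_atTop_atTop)
    simpa only [sub_zero, mul_one] using (h1.const_sub 1).const_mul r
  obtain ⟨n, hn⟩ := hK.elim_directed_cover (fun n => ψ '' O n)
    (fun n => isOpen_image_of_deriv_ne_zero isOpen_halfstrip hψ hd (hopen n) (hsub n))
    (fun x hx => by
      obtain ⟨z, hz, rfl⟩ := hKW hx
      obtain ⟨t, ht, hzt⟩ := mem_halfstrip.1 hz
      obtain ⟨n, hn1, hn2⟩ := ((hlim.eventually_const_lt hzt).and
        (tendsto_natCast_atTop_atTop.eventually_gt_atTop ‖F z‖)).exists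
      exact mem_iUnion.2 ⟨n, z, ⟨mem_halfstrip.2 ⟨t, ht, hn1⟩, hn2⟩, rfl⟩)
    (directed_of_isDirected_le fun m n hmn => image_mono (hmono hmn))
  exact ⟨ρ n, n, (hρr n).1, (hρr n).2, hopen n, hn⟩

end Param

/-! ### Descent to the original coordinate -/

section Descent

variable {θ d : ℝ} {H O : Set ℂ} {ψ : ℂ → ℂ}

theorem gev_add_le {C C' M M' : ℝ} (hC : 0 < C) (hC' : 0 < C') (hM : 0 < M) (hM' : 0 < M') (n : ℕ) :
    C * gev M n + C' * gev M' n ≤ (C + C') * gev (M + M') n := by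
  have h1 := gev_mono hM.le (by linarith : M ≤ M + M') n
  have h2 := gev_mono hM'.le (by linarith : M' ≤ M + M') n
  rw [add_mul]
  gcongr

/-- Two holomorphic functions on a Borel disc with the same Gevrey expansion are equal. -/
theorem eq_of_gevrey (hd : 0 < d) {f g : ℂ → ℂ} {fk : ℕ → ℂ}
    (hf : DifferentiableOn ℂ f (borelDisc θ d)) (hg : DifferentiableOn ℂ g (borelDisc θ d))
    {C C' M M' : ℝ} (hC : 0 < C) (hC' : 0 < C') (hM : 0 < M) (hM' : 0 < M')
    (hfb : ∀ n, ∀ h ∈ borelDisc θ d, ‖rem (f h) fk h n‖ ≤ C * gev M n * ‖h‖ ^ n)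
    (hgb : ∀ n, ∀ h ∈ borelDisc θ d, ‖rem (g h) fk h n‖ ≤ C' * gev M' n * ‖h‖ ^ n) :
    EqOn f g (borelDisc θ d) := by
  intro h hh
  refine sub_eq_zero.1 (eq_zero_of_gevrey_flat hd (hf.fun_sub hg) (C := C + C') (M := M + M')
    (by positivity) (fun n h hh => ?_) h hh)
  have h1 : f h - g h = rem (f h) fk h n - rem (g h) fk h n := by simp only [rem]; abel
  rw [h1]
  refine (norm_sub_le _ _).trans ((add_le_add (hfb n h hh) (hgb n h hh)).trans ?_)
  rw [← add_mul]
  exact mul_le_mul_of_nonneg_right (gev_add_le hC hC' hM hM' n) (by positivity)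

theorem IsGevrey.differentiableOn_right {U D : Set ℂ} {f : ℂ → ℂ → ℂ} {fk : ℕ → ℂ → ℂ}
    (hf : IsGevrey U D f fk) {z : ℂ} (hz : z ∈ U) : DifferentiableOn ℂ (f z) D :=
  hf.holo.comp ((differentiableOn_const z).prodMk differentiableOn_id) fun _ hh => ⟨hz, hh⟩

/-- A Gevrey family whose coefficients descend along a local biholomorphism `ψ` descends itself:
its values at two points of a fibre of `ψ` have the same Gevrey expansion. -/
theorem IsGevrey.exists_descent (hd : 0 < d) {F : ℂ → ℂ → ℂ} {Fk fhat : ℕ → ℂ → ℂ}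
    (hF : IsGevrey O (borelDisc θ d) F Fk) (hFk : ∀ k, ∀ z ∈ O, Fk k z = fhat k (ψ z)) :
    ∃ f : ℂ → ℂ → ℂ, ∀ z ∈ O, ∀ h ∈ borelDisc θ d, f (ψ z) h = F z h := by
  refine ⟨fun x h => F (Function.invFunOn ψ O x) h, fun z hz h hh => ?_⟩
  have hex : ∃ y ∈ O, ψ y = ψ z := ⟨z, hz, rfl⟩
  have hmem := Function.invFunOn_mem hex
  have heq := Function.invFunOn_eq hex
  obtain ⟨C, M, hC, hM, hb⟩ := hF.bound
  have hb' : ∀ y ∈ O, ψ y = ψ z → ∀ n, ∀ h ∈ borelDisc θ d,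
      ‖rem (F y h) (fun k => fhat k (ψ z)) h n‖ ≤ C * gev M n * ‖h‖ ^ n := by
    intro y hy hyz n h hh
    have := hb n y hy h hh
    simp only [hFk _ y hy, hyz] at this
    exact this
  exact eq_of_gevrey hd (hF.differentiableOn_right hmem) (hF.differentiableOn_right hz) hC hC hM hM
    (hb' _ hmem heq) (hb' z hz rfl) hh

/-- A local inverse of `ψ` at `ψ z` with values in `O`. -/
theorem exists_local_inverse (hH : IsOpen H) (hψ : DifferentiableOn ℂ ψ H)
    (hO : IsOpen O) (hOH : O ⊆ H) {z : ℂ} (hz : z ∈ O) (hdz : deriv ψ z ≠ 0) :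
    ∃ g : ℂ → ℂ, g (ψ z) = z ∧ HasDerivAt g (deriv ψ z)⁻¹ (ψ z) ∧
      ∀ᶠ x in 𝓝 (ψ z), g x ∈ O ∧ ψ (g x) = x := by
  have hst := hasStrictDerivAt_of_differentiableOn hH hψ (hOH hz)
  have hg := hst.to_localInverse hdz
  have hgz : hst.localInverse ψ (deriv ψ z) z hdz (ψ z) = z :=
    HasStrictFDerivAt.localInverse_apply_image (hst.hasStrictFDerivAt_equiv hdz)
  have hgc := hg.hasDerivAt.continuousAt
  refine ⟨hst.localInverse ψ (deriv ψ z) z hdz, hgz, hg.hasDerivAt, ?_⟩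
  refine Eventually.and (hgc.eventually_mem (by rw [hgz]; exact hO.mem_nhds hz)) ?_
  exact HasStrictFDerivAt.eventually_right_inverse (hst.hasStrictFDerivAt_equiv hdz)

/-- Descent of an exact solution along the Liouville coordinate. -/
theorem isHolomorphicSolution_of_descent (hH : IsOpen H) (hψ : DifferentiableOn ℂ ψ H)
    (hO : IsOpen O) (hOH : O ⊆ H) {s : ℂ → ℂ} (hs : ∀ z ∈ H, s (ψ z) * deriv ψ z = 1)
    {a b c F f : ℂ → ℂ → ℂ} (hF : DifferentiableOn ℂ (Function.uncurry F) (O ×ˢ borelDisc θ d))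
    (hode : ∀ z ∈ O, ∀ h ∈ borelDisc θ d, HasDerivAt (fun z => F z h)
      ((a (ψ z) h / s (ψ z) * F z h ^ 2 + b (ψ z) h / s (ψ z) * F z h + c (ψ z) h / s (ψ z)) / h) z)
    (hf : ∀ z ∈ O, ∀ h ∈ borelDisc θ d, f (ψ z) h = F z h) {U : Set ℂ} (hU : U ⊆ ψ '' O) :
    IsHolomorphicSolution a b c U (borelDisc θ d) f := by
  constructor
  · rintro ⟨x, h⟩ ⟨hx, hh⟩
    obtain ⟨z, hz, rfl⟩ := hU hx
    obtain ⟨g, hgz, hg, hev⟩ := exists_local_inverse hH hψ hO hOH hz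
      (right_ne_zero_of_mul_eq_one (hs z (hOH hz)))
    have hFd : DifferentiableAt ℂ (Function.uncurry F) (g (ψ z), h) := by
      rw [hgz]
      exact hF.differentiableAt ((hO.prod isOpen_borelDisc).mem_nhds ⟨hz, hh⟩)
    have hgd : DifferentiableAt ℂ (fun y : ℂ × ℂ => (g y.1, y.2)) (ψ z, h) :=
      (DifferentiableAt.comp (ψ z, h) hg.differentiableAt differentiableAt_fst).prodMk
        differentiableAt_snd
    refine (DifferentiableAt.congr_of_eventuallyEq (DifferentiableAt.comp (ψ z, h) hFd hgd)
      ?_).differentiableWithinAt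
    have h1 : ∀ᶠ y : ℂ × ℂ in 𝓝 (ψ z, h), g y.1 ∈ O ∧ ψ (g y.1) = y.1 :=
      (continuous_fst.tendsto (ψ z, h)).eventually hev
    have h2 : ∀ᶠ y : ℂ × ℂ in 𝓝 (ψ z, h), y.2 ∈ borelDisc θ d :=
      continuous_snd.continuousAt.eventually (isOpen_borelDisc.mem_nhds hh)
    filter_upwards [h1, h2] with y hy1 hy2
    simp only [Function.uncurry, Function.comp]
    rw [← hf _ hy1.1 _ hy2, hy1.2]
  · intro x hx h hh
    obtain ⟨z, hz, rfl⟩ := hU hx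
    have hsz := hs z (hOH hz)
    have hd0 : deriv ψ z ≠ 0 := right_ne_zero_of_mul_eq_one hsz
    have hs0 : s (ψ z) ≠ 0 := left_ne_zero_of_mul_eq_one hsz
    obtain ⟨g, hgz, hg, hev⟩ := exists_local_inverse hH hψ hO hOH hz hd0
    have hF' := hode z hz h hh
    rw [← hgz] at hF'
    have hcomp := HasDerivAt.comp (ψ z) hF' hg
    have heq : (fun y => f y h) =ᶠ[𝓝 (ψ z)] (fun z => F z h) ∘ g := by
      filter_upwards [hev] with y hy
      simp only [Function.comp]
      rw [← hf _ hy.1 _ hh, hy.2]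
    rw [(hcomp.congr_of_eventuallyEq heq).deriv, hgz, hf z hz h hh,
      show (deriv ψ z)⁻¹ = s (ψ z) from (eq_inv_of_mul_eq_one_left hsz).symm]
    have := hh.1
    field_simp

/-- Uniqueness of the function with a given uniform Gevrey expansion along the closed arc. The two
expansions may hold on different smaller sectorial domains; both contain a small Borel disc, from
which equality propagates by the identity theorem. -/
theorem eq_of_unifGevreyAsymptotic (hd : 0 < d) {U : Set ℂ} {f g : ℂ → ℂ → ℂ} {fhat : ℕ → ℂ → ℂ}
    (hf : DifferentiableOn ℂ (Function.uncurry f) (U ×ˢ borelDisc θ d))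
    (hg : DifferentiableOn ℂ (Function.uncurry g) (U ×ˢ borelDisc θ d))
    (hfG : UnifGevreyAsymptotic θ U (borelDisc θ d) (fun _ => 1) f fhat)
    (hgG : UnifGevreyAsymptotic θ U (borelDisc θ d) (fun _ => 1) g fhat) :
    ∀ x ∈ U, ∀ h ∈ borelDisc θ d, g x h = f x h := by
  intro x hx
  obtain ⟨S₁, hS₁, hsec₁, C, M, hC, hM, hb⟩ := hfG
  obtain ⟨S₂, hS₂, hsec₂, C', M', hC', hM', hb'⟩ := hgG
  obtain ⟨d₁, hd₁, hdS₁⟩ := hsec₁.borel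
  obtain ⟨d₂, hd₂, hdS₂⟩ := hsec₂.borel
  have hd₃ : 0 < min d₁ d₂ := lt_min hd₁ hd₂
  have h1 := (borelDisc_mono (θ := θ) hd₃ (min_le_left _ _)).trans hdS₁
  have h2 := (borelDisc_mono (θ := θ) hd₃ (min_le_right _ _)).trans hdS₂
  have hslice : ∀ {f : ℂ → ℂ → ℂ},
      DifferentiableOn ℂ (Function.uncurry f) (U ×ˢ borelDisc θ d) →
      DifferentiableOn ℂ (f x) (borelDisc θ d) := fun hf =>
    hf.comp ((differentiableOn_const x).prodMk differentiableOn_id) fun _ hh => ⟨hx, hh⟩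
  have hsmall : EqOn (g x) (f x) (borelDisc θ (min d₁ d₂)) := by
    refine eq_of_gevrey hd₃ ((hslice hg).mono (h1.trans hS₁)) ((hslice hf).mono (h1.trans hS₁))
      (fk := fun k => fhat k x) hC' hC hM' hM (fun n h hh => ?_) fun n h hh => ?_
    · have := hb' n x hx h (h2 hh)
      rw [remainder_eq_rem, norm_one, one_mul] at this
      refine this.trans (le_of_eq ?_)
      rw [gev]; ring
    · have := hb n x hx h (h1 hh)
      rw [remainder_eq_rem, norm_one, one_mul] at this
      refine this.trans (le_of_eq ?_)
      rw [gev]; ring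
  obtain ⟨h₀, hh₀⟩ := (isSectorialDomain_borelDisc (θ := θ) hd₃).simplyConnected.nonempty
  exact AnalyticOnNhd.eqOn_of_preconnected_of_eventuallyEq
    ((hslice hg).analyticOnNhd isOpen_borelDisc) ((hslice hf).analyticOnNhd isOpen_borelDisc)
    (isPreconnected_borelDisc hd) (hS₁ (h1 hh₀))
    (hsmall.eventuallyEq_of_mem (isOpen_borelDisc.mem_nhds hh₀))

end Descent

end Riccati

theorem mainTheorem1
    (θ : ℝ) (X S : Set ℂ) (hX : IsOpen X) (hX' : IsConnected X)
    (hS : Riccati.IsSectorialDomain θ S)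
    -- the coefficients and their asymptotic expansions
    (a b c : ℂ → ℂ → ℂ) (ahat bhat chat : ℕ → ℂ → ℂ)
    (ha : DifferentiableOn ℂ (Function.uncurry a) (X ×ˢ S))
    (hb : DifferentiableOn ℂ (Function.uncurry b) (X ×ˢ S))
    (hc : DifferentiableOn ℂ (Function.uncurry c) (X ×ˢ S))
    (hahat : ∀ k, DifferentiableOn ℂ (ahat k) X)
    (hbhat : ∀ k, DifferentiableOn ℂ (bhat k) X)
    (hchat : ∀ k, DifferentiableOn ℂ (chat k) X)
    (haa : Riccati.LocUnifAsymptotic θ X S a ahat)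
    (hbb : Riccati.LocUnifAsymptotic θ X S b bhat)
    (hcc : Riccati.LocUnifAsymptotic θ X S c chat)
    (hD : ∃ x ∈ X, Riccati.disc₀ ahat bhat chat x ≠ 0)
    -- a regular point, a square-root branch and a sign
    (x₀ : ℂ) (hx₀ : x₀ ∈ X) (hreg : Riccati.disc₀ ahat bhat chat x₀ ≠ 0)
    (s : ℂ → ℂ) (ε : ℝ) (hε : ε = 1 ∨ ε = -1)
    -- the WKB halfstrip
    (W : Set ℂ)
    (hW : Riccati.IsWKBHalfstrip X (Riccati.disc₀ ahat bhat chat) s θ ε x₀ W)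
    (hminus : ε = -1 → ∀ x ∈ W, ahat 0 x ≠ 0)
    (hplus : ε = 1 → ∀ x ∈ W, ahat 0 x = 0 → s x = bhat 0 x)
    -- Gevrey asymptotics along the closed arc with respect to the scale `√D₀`
    (hGa : Riccati.UnifGevreyAsymptotic θ W S s a ahat)
    (hGb : Riccati.UnifGevreyAsymptotic θ W S s b bhat)
    (hGc : Riccati.UnifGevreyAsymptotic θ W S s c chat) :
    ∃ fhat : ℕ → ℂ → ℂ,
      -- `fhat` is the formal solution on `W` with the prescribed leading order, and is unique
      (Riccati.IsFormalSolution W ahat bhat chat fhat ∧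
        EqOn (fhat 0) (Riccati.leadingSolution ahat bhat chat s ε) W) ∧
      (∀ ghat : ℕ → ℂ → ℂ, Riccati.IsFormalSolution W ahat bhat chat ghat →
        EqOn (ghat 0) (Riccati.leadingSolution ahat bhat chat s ε) W →
        ∀ k, EqOn (ghat k) (fhat k) W) ∧
      -- the exact solution
      ∀ U₀ : Set ℂ, IsOpen U₀ → IsConnected U₀ → IsCompact (closure U₀) → closure U₀ ⊆ W →
        ∃ S₀ ⊆ S, Riccati.IsSectorialDomain θ S₀ ∧
          ∃ f : ℂ → ℂ → ℂ,
            (Riccati.IsHolomorphicSolution a b c U₀ S₀ f ∧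
              Riccati.UnifGevreyAsymptotic θ U₀ S₀ (fun _ => 1) f fhat) ∧
            ∀ g : ℂ → ℂ → ℂ, Riccati.IsHolomorphicSolution a b c U₀ S₀ g →
              Riccati.UnifGevreyAsymptotic θ U₀ S₀ (fun _ => 1) g fhat →
              ∀ x ∈ U₀, ∀ h ∈ S₀, g x h = f x h := by
  obtain ⟨z₁, r, ψ, hr, -, -, hψ, hsψ, hψimg⟩ := hW.exists_param
  have hH : IsOpen (Riccati.halfstrip θ ε z₁ r) := Riccati.isOpen_halfstrip
  set H := Riccati.halfstrip θ ε z₁ r with hHdef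
  have hψW : MapsTo ψ H W := fun z hz => hψimg ▸ mem_image_of_mem ψ hz
  have hψd : ∀ z ∈ H, deriv ψ z ≠ 0 := fun z hz => right_ne_zero_of_mul_eq_one (hsψ z hz)
  have hWo : IsOpen W :=
    hψimg ▸ Riccati.isOpen_image_of_deriv_ne_zero hH hψ hψd hH subset_rfl
  have hs0 : ∀ x ∈ W, s x ≠ 0 := by
    intro x hx
    obtain ⟨z, hz, rfl⟩ := hψimg.symm ▸ hx
    exact left_ne_zero_of_mul_eq_one (hsψ z hz)
  have hε0 : (ε : ℂ) ≠ 0 := by rcases hε with rfl | rfl <;> simp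
  set f₀ := Riccati.leadingSolution ahat bhat chat s ε with hf₀
  have hspec : ∀ x ∈ W, 2 * ahat 0 x * f₀ x + bhat 0 x = ε * s x ∧
      ahat 0 x * f₀ x ^ 2 + bhat 0 x * f₀ x + chat 0 x = 0 := fun x hx =>
    Riccati.leadingSolution_spec hε (hW.sq_eq x hx) (hs0 x hx) (fun h => hminus h x hx)
      fun h => hplus h x hx
  have haW : ∀ k, DifferentiableOn ℂ (ahat k) W := fun k => (hahat k).mono hW.subset
  have hbW : ∀ k, DifferentiableOn ℂ (bhat k) W := fun k => (hbhat k).mono hW.subset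
  have hcW : ∀ k, DifferentiableOn ℂ (chat k) W := fun k => (hchat k).mono hW.subset
  have hf₀d : DifferentiableOn ℂ f₀ W := Riccati.differentiableOn_leadingSolution hε hWo (haW 0)
    (hbW 0) (hcW 0) hW.differentiableOn hW.sq_eq hs0 hminus hplus
  have hne : ∀ x ∈ W, 2 * ahat 0 x * f₀ x + bhat 0 x ≠ 0 := fun x hx => by
    rw [(hspec x hx).1]
    exact mul_ne_zero hε0 (hs0 x hx)
  obtain ⟨fhat, hfhat, hfhat0⟩ := Riccati.exists_isFormalSolution hWo haW hbW hcW hf₀d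
    (fun x hx => (hspec x hx).2) hne
  refine ⟨fhat, ⟨hfhat, fun x _ => congrFun hfhat0 x⟩, fun ghat hg hg0 k =>
    hfhat.unique hWo hg (fun x hx => (hg0 hx).trans (congrFun hfhat0 x).symm)
      (by rwa [hfhat0]) k, fun U₀ hU₀ _ hU₀c hU₀W => ?_⟩
  -- the equation in the Liouville coordinate
  obtain ⟨d₁, hd₁, hd₁S, gA⟩ := Riccati.exists_isGevrey_pullback hW.subset ha hahat
    hW.differentiableOn hs0 hψ hψW hGa
  obtain ⟨d₂, hd₂, -, gB⟩ := Riccati.exists_isGevrey_pullback hW.subset hb hbhat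
    hW.differentiableOn hs0 hψ hψW hGb
  obtain ⟨d₃, hd₃, -, gC⟩ := Riccati.exists_isGevrey_pullback hW.subset hc hchat
    hW.differentiableOn hs0 hψ hψW hGc
  have hd : 0 < min d₁ (min d₂ d₃) := lt_min hd₁ (lt_min hd₂ hd₃)
  have hdd₂ : min d₁ (min d₂ d₃) ≤ d₂ := (min_le_right _ _).trans (min_le_left _ _)
  have hdd₃ : min d₁ (min d₂ d₃) ≤ d₃ := (min_le_right _ _).trans (min_le_right _ _)
  replace gA := gA.mono subset_rfl (Riccati.borelDisc_mono hd (min_le_left _ _))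
  replace gB := gB.mono subset_rfl (Riccati.borelDisc_mono hd hdd₂)
  replace gC := gC.mono subset_rfl (Riccati.borelDisc_mono hd hdd₃)
  have hF : DifferentiableOn ℂ (fun z => f₀ (ψ z)) H := hf₀d.comp hψ hψW
  obtain ⟨r', R, hr', hr'r, hO, hKO⟩ := Riccati.exists_cover_of_isCompact hr hψ hψd hF.continuousOn
    hU₀c (hψimg.symm ▸ hU₀W)
  obtain ⟨d, hd0, hdd, F, Fk, hFk0, hFG, hFode⟩ := Riccati.exists_gevrey_riccati hε hr' hr'r hd
    gA gB gC hF
    (fun z hz => by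
      have h1 := hW.sq_eq _ (hψW hz)
      have h2 := hs0 _ (hψW hz)
      rw [Riccati.disc₀] at h1
      field_simp
      linear_combination -h1)
    (fun z hz => by
      have h1 := (hspec _ (hψW hz)).2
      have h2 := hs0 _ (hψW hz)
      field_simp
      linear_combination h1)
    (fun z hz => by
      have h1 := (hspec _ (hψW hz)).1
      have h2 := hs0 _ (hψW hz)
      field_simp
      linear_combination h1) R
  set O := Riccati.halfstrip θ ε z₁ r' ∩ {z | ‖f₀ (ψ z)‖ < R} with hOdef
  have hOH : O ⊆ H := inter_subset_left.trans (Riccati.halfstrip_mono hr'r.le)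
  have hdS : Riccati.borelDisc θ d ⊆ Riccati.borelDisc θ (min d₁ (min d₂ d₃)) :=
    Riccati.borelDisc_mono hd0 hdd
  -- its coefficients agree with the formal solution
  have hform := Riccati.IsGevrey.isFormalSolution hd0 hO (gA.mono hOH hdS) (gB.mono hOH hdS)
    (gC.mono hOH hdS) hFG hFode
  have hform' := (hfhat.comp hWo hH hψ hψW hsψ).mono hOH
  have hFk : ∀ k, ∀ z ∈ O, Fk k z = fhat k (ψ z) := by
    refine fun k => hform'.unique hO hform (fun z _ => ?_) (fun z hz => ?_) k
    · rw [hFk0, hfhat0]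
    · have h1 := hne _ (hψW (hOH hz))
      have h2 := hs0 _ (hψW (hOH hz))
      rw [hfhat0]
      intro h3
      field_simp at h3
      exact h1 (by linear_combination h3)
  obtain ⟨f, hf⟩ := hFG.exists_descent hd0 hFk
  have hU₀O : U₀ ⊆ ψ '' O := subset_closure.trans hKO
  have hsol := Riccati.isHolomorphicSolution_of_descent hH hψ hO hOH hsψ hFG.holo hFode hf hU₀O
  have hGf : Riccati.UnifGevreyAsymptotic θ U₀ (Riccati.borelDisc θ d) (fun _ => 1) f fhat := by
    obtain ⟨C, M, hC, hM, hbd⟩ := hFG.bound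
    refine ⟨_, subset_rfl, Riccati.isSectorialDomain_borelDisc hd0, C, M, hC, hM,
      fun n x hx h hh => ?_⟩
    obtain ⟨z, hz, rfl⟩ := hU₀O hx
    have h1 := hbd n z hz h hh
    simp only [hFk _ z hz, ← hf z hz h hh] at h1
    rw [Riccati.remainder_eq_rem, norm_one, one_mul]
    refine h1.trans (le_of_eq ?_)
    rw [Riccati.gev]
    ring
  refine ⟨Riccati.borelDisc θ d, hdS.trans ((Riccati.borelDisc_mono hd (min_le_left _ _)).trans
    hd₁S), Riccati.isSectorialDomain_borelDisc hd0, f, ⟨hsol, hGf⟩, fun g hg hgG =>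
    Riccati.eq_of_unifGevreyAsymptotic hd0 hsol.differentiableOn hg.differentiableOn hGf hgG⟩
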